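/- Let $G$ be a finite abelian group, $\widehat G=\mathrm{Hom}(G,\mathbb C^\times)$, and $n\ge 0$. **Compositions and partitions.** For a set $L$, let $\Sigma_n[L]$ be the set of $L$-compositions of $[n]$: tuples $s=((S_1,g_1),\dots,(S_k,g_k))$ where $|s|:=(S_1,\dots,S_k)$ is an ordered partition of $[n]$ into nonempty blocks and $g_i\in L$. Let $\Pi_n[L]$ be the set of $L$-partitions $\{(S_1,g_1),\dots,(S_k,g_k)\}$ of $[n]$. Let $\Gamma_n[L]$ be the set of $L$-compositions $p=((a_1,g_1),\dots,(a_k,g_k))$ of the integer $n$ (with $a_i\ge1$, $\sum a_i=n$, $g_i\in L$, $|p|:=(a_1,\dots,a_k)$), and $\Lambda_n[L]$ the set of $L$-partitions of $n$ (multisets $\{(a_1,g_1),\dots,(a_k,g_k)\}$). The map $\mathsf{supp}$ forgets the order of the blocks, $\mathsf{type}$ replaces each block $S_i$ by its size, and $\ell$ is the number of blocks. $\Sigma_n$ and $\Pi_n$ are the unlabelled versions; $\Pi_n$ is ordered by $X\le Y$ iff $Y$ refines $X$. **Hsiao's algebra.** $\Sigma_n[G]$ is a monoid under $st=\big((S_i\cap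 T_j,\,h_jg_i)\big)_{(i,j)}$, taken in lexicographic order with the empty intersections omitted, for $s=((S_i,g_i))_i$ and $t=((T_j,h_j))_j$. Let $\mathbb C\Sigma_n[G]$ be its algebra, with basis $\mathtt H_s$, and let $\mathfrak S_n$ act by permuting $[n]$ and fixing the labels. View $\mathbb C\Sigma_n\subseteq\mathbb C\Sigma_n[G]$ by labelling all blocks by $1_G$. The uniform section is $\mathfrak u_X=\frac{1}{\#\{x\in\Sigma_n:\,\mathsf{supp}(x)=X\}}\sum_{\mathsf{supp}(x)=X}\mathtt H_x$ for $X\in\Pi_n$. Define recursively $\mathfrak e^\circ_X=\mathfrak u_X-\sum_{Y>X}\mathfrak u_X\mathfrak e^\circ_Y$, and put $\mathtt Q^\circ_x=\mathtt H_x\mathfrak e^\circ_{\mathsf{supp}(x)}$ for $x\in\Sigma_n$. For $\phi=((S_i,\phi_i))_i\in\Sigma_n[\widehat G]$ and $s=((S_i,g_i))_i\in\Sigma_n[G]$ with $|s|=|\phi|$, let $\phi(s)=\prod_i\phi_i(g_i)$; put $$\mathtt E_\phi=\frac1{\#\{s\in\Sigma_n[G]:|s|=|\phi|\}}\sum_{|s|=|\phi|}\overline{\phi(s)}\,\mathtt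 H_s,\qquad \mathtt Q_\phi=\mathtt E_\phi\mathtt Q^\circ_{|\phi|}.$$ For $\Phi\in\Pi_n[\widehat G]$ put $\mathfrak e_\Phi=\mathfrak u_{|\Phi|}\mathtt Q_\phi$, where $\phi$ is any element with $\mathsf{supp}(\phi)=\Phi$ (the choice does not matter). For $\lambda\in\Lambda_n[\widehat G]$ put $\mathfrak e_\lambda=\sum_{\mathsf{type}(\Phi)=\lambda}\mathfrak e_\Phi$. For $p\in\Gamma_n[G]$ and $\alpha\in\Gamma_n[\widehat G]$ put $\mathcal H_p=\sum_{\mathsf{type}(s)=p}\mathtt H_s$ and $\mathcal E_\alpha=\sum_{\mathsf{type}(\phi)=\alpha}\mathtt E_\phi$. **Orders and degrees.** For $p,q\in\Gamma_n[G]$ write $p\le q$ if $|q|$ refines $|p|$ and the blocks of $q$ refining a given block of $p$ carry the label of that block. For $\alpha,\beta\in\Gamma_n[\widehat G]$ write $\alpha\trianglelefteq\beta$ if $|\beta|$ refines $|\alpha|$ and the product of the labels of the blocks of $\beta$ refining a given block of $\alpha$ is the label of that block. In both cases $\deg(q/p)$ (resp. $\deg(\beta/\alpha)$) is the product, over the blocks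 of $p$ (resp. $\alpha$), of the number of blocks of $q$ (resp. $\beta$) refining that block. If $|p|=|\alpha|$, let $\alpha(p)=\prod_i\alpha_i(g_i)$, where $\alpha_i$ and $g_i$ are the labels of the $i$-th blocks of $\alpha$ and $p$. **Theorem.** The families $\{\mathcal H_q\}_{q\in\Gamma_n[G]}$ and $\{\mathcal E_\beta\}_{\beta\in\Gamma_n[\widehat G]}$ are bases of the invariant subalgebra $(\mathbb C\Sigma_n[G])^{\mathfrak S_n}$, the family $\{\mathfrak e_\lambda\}_{\lambda\in\Lambda_n[\widehat G]}$ is a complete system of primitive orthogonal idempotents of this subalgebra, and for all $\lambda\in\Lambda_n[\widehat G]$ $$\mathfrak e_\lambda=\frac1{\ell(\lambda)!}\sum_{\substack{\alpha\in\Gamma_n[\widehat G]\\ \mathsf{supp}(\alpha)=\lambda}}\ \sum_{\substack{\beta\in\Gamma_n[\widehat G]\\ \alpha\trianglelefteq\beta}}\frac{(-1)^{\ell(\beta)-\ell(\alpha)}}{\deg(\beta/\alpha)}\,\mathcal E_\beta =\frac1{|G|^{\ell(\lambda)}\,\ell(\lambda)!}\sum_{\substack{\alpha\in\Gamma_n[\widehat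 G]\\ \mathsf{supp}(\alpha)=\lambda}}\ \sum_{\substack{p\in\Gamma_n[G]\\ |p|=|\alpha|}}\overline{\alpha(p)}\sum_{\substack{q\in\Gamma_n[G]\\ p\le q}}\frac{(-1)^{\ell(q)-\ell(p)}}{\deg(q/p)}\,\mathcal H_q .$$ -/

import Mathlib

namespace Hsiao

/-! ### Compositions and partitions with labels -/

/-- An `L`-composition of the set `[n] = Fin n`: a list `((S₁, g₁), …, (S_k, g_k))` in which
`(S₁, …, S_k)` is an ordered set partition of `[n]` and `gᵢ ∈ L`. -/
@[ext]
structure SetComp (n : ℕ) (L : Type*) where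
  blocks : List (Finset (Fin n) × L)
  nonempty : ∀ B ∈ blocks, B.1.Nonempty
  disjoint : blocks.Pairwise fun B C => Disjoint B.1 C.1
  cover : ∀ i : Fin n, ∃ B ∈ blocks, i ∈ B.1

/-- An `L`-composition of the integer `n`: a list `((a₁, g₁), …, (a_k, g_k))` with `aᵢ ≥ 1`,
`a₁ + ⋯ + a_k = n` and `gᵢ ∈ L`. -/
@[ext]
structure IntComp (n : ℕ) (L : Type*) where
  blocks : List (ℕ × L)
  pos : ∀ b ∈ blocks, 0 < b.1
  sum_eq : (blocks.map Prod.fst).sum = n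

/-- An `L`-partition of the integer `n`: a multiset `{(a₁, g₁), …, (a_k, g_k)}` with `aᵢ ≥ 1`,
`a₁ + ⋯ + a_k = n` and `gᵢ ∈ L`. -/
@[ext]
structure IntPart (n : ℕ) (L : Type*) where
  blocks : Multiset (ℕ × L)
  pos : ∀ b ∈ blocks, 0 < b.1
  sum_eq : (blocks.map Prod.fst).sum = n

namespace SetComp

variable {n : ℕ} {L M : Type*}

/-- The number of blocks. -/
def length (s : SetComp n L) : ℕ := s.blocks.length

/-- Two `L`-compositions of `[n]` are equivalent when they differ by a permutation of their
(labelled) blocks. -/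
def setoid (n : ℕ) (L : Type*) : Setoid (SetComp n L) where
  r s t := s.blocks.Perm t.blocks
  iseqv := ⟨fun _ => List.Perm.refl _, fun h => h.symm, fun h k => h.trans k⟩

/-- Change the labels along a map. -/
def relabel (f : L → M) (s : SetComp n L) : SetComp n M where
  blocks := s.blocks.map fun B => (B.1, f B.2)
  nonempty := by
    intro B hB
    obtain ⟨C, hC, rfl⟩ := List.mem_map.1 hB
    exact s.nonempty C hC
  disjoint := List.pairwise_map.2 s.disjoint
  cover i := by
    obtain ⟨B, hB, hi⟩ := s.cover i
    exact ⟨_, List.mem_map_of_mem hB, hi⟩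

/-- The underlying set composition `|s|` of `s`, that is, `s` with its labels forgotten. Set
compositions of `[n]` are the compositions with labels in the trivial group. -/
def under (s : SetComp n L) : SetComp n Unit := s.relabel fun _ => ()

/-- A permutation `w` of `[n]` acts by replacing each block `S` by its image `w(S)` and by leaving
the labels unchanged. -/
def perm (w : Equiv.Perm (Fin n)) (s : SetComp n L) : SetComp n L where
  blocks := s.blocks.map fun B => (B.1.map w.toEmbedding, B.2)
  nonempty := by
    intro B hB
    obtain ⟨C, hC, rfl⟩ := List.mem_map.1 hB
    exact (s.nonempty C hC).map
  disjoint := List.pairwise_map.2 (s.disjoint.imp fun h => (Finset.disjoint_map _).2 h)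
  cover i := by
    obtain ⟨B, hB, hi⟩ := s.cover (w.symm i)
    exact ⟨_, List.mem_map_of_mem hB, Finset.mem_map.2 ⟨_, hi, by simp⟩⟩

/-- The type of a composition of `[n]`: the sizes of its blocks, in order, with their labels. -/
def type (s : SetComp n L) : IntComp n L where
  blocks := s.blocks.map fun B => (B.1.card, B.2)
  pos := by
    intro b hb
    obtain ⟨C, hC, rfl⟩ := List.mem_map.1 hb
    exact (s.nonempty C hC).card_pos
  sum_eq := by
    have key : ∀ l : List (Finset (Fin n) × L), l.Pairwise (fun B C => Disjoint B.1 C.1) →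
        ∃ U : Finset (Fin n), (∀ i, i ∈ U ↔ ∃ B ∈ l, i ∈ B.1) ∧
          (l.map fun B => B.1.card).sum = U.card := by
      intro l
      induction l with
      | nil => exact fun _ => ⟨∅, by simp, by simp⟩
      | cons a l ih =>
        intro h
        obtain ⟨h1, h2⟩ := List.pairwise_cons.1 h
        obtain ⟨U, hU, hc⟩ := ih h2
        refine ⟨a.1 ∪ U, fun i => by simp [hU], ?_⟩
        rw [Finset.card_union_of_disjoint, List.map_cons, List.sum_cons, hc]
        refine Finset.disjoint_left.2 fun i hi hiU => ?_
        obtain ⟨B, hB, hiB⟩ := (hU i).1 hiU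
        exact Finset.disjoint_left.1 (h1 B hB) hi hiB
    obtain ⟨U, hU, hc⟩ := key s.blocks s.disjoint
    have hU' : U = Finset.univ := by
      ext i
      simpa [hU] using s.cover i
    rw [hU', Finset.card_univ, Fintype.card_fin] at hc
    simpa [List.map_map, Function.comp_def] using hc

/-- The set partition of `[n]` underlying a composition of `[n]`. -/
def setPartition (s : SetComp n L) : Finpartition (Finset.univ : Finset (Fin n)) where
  parts := (s.blocks.map Prod.fst).toFinset
  supIndep := by
    rw [Finset.supIndep_iff_pairwiseDisjoint]
    intro A hA B hB hAB
    obtain ⟨A, hA', rfl⟩ := List.mem_map.1 (List.mem_toFinset.1 hA)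
    obtain ⟨B, hB', rfl⟩ := List.mem_map.1 (List.mem_toFinset.1 hB)
    have : Std.Symm fun B C : Finset (Fin n) × L => Disjoint B.1 C.1 := ⟨fun _ _ h => h.symm⟩
    exact s.disjoint.forall hA' hB' fun h => hAB (by rw [h])
  sup_parts := by
    ext i
    obtain ⟨B, hB, hi⟩ := s.cover i
    simp only [Finset.mem_sup, List.mem_toFinset, List.mem_map, id_eq, Finset.mem_univ, iff_true]
    exact ⟨B.1, ⟨B, hB, rfl⟩, hi⟩
  bot_notMem := by
    intro h
    obtain ⟨B, hB, h⟩ := List.mem_map.1 (List.mem_toFinset.1 h)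
    exact (s.nonempty B hB).ne_empty h

theorem blocks_injective : Function.Injective (blocks : SetComp n L → _) :=
  fun _ _ h => SetComp.ext h

instance [Finite L] : Finite (SetComp n L) := by
  classical
  have := Fintype.ofFinite L
  have hnd : ∀ s : SetComp n L, s.blocks.Nodup := fun s => by
    refine (List.Pairwise.and_mem.1 s.disjoint).imp ?_
    rintro B C ⟨hB, -, h⟩ rfl
    exact (s.nonempty B hB).ne_empty (disjoint_self.1 h)
  exact Finite.of_injective (β := {l : List (Finset (Fin n) × L) // l.Nodup})
    (fun s => ⟨s.blocks, hnd s⟩) fun s t h => blocks_injective (congrArg Subtype.val h)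

noncomputable instance [Finite L] : Fintype (SetComp n L) := Fintype.ofFinite _

end SetComp

/-- An `L`-partition of the set `[n]`: an `L`-composition of `[n]` up to the order of its blocks,
that is, a set `{(S₁, g₁), …, (S_k, g_k)}`. The quotient map is the support map. -/
def SetPart (n : ℕ) (L : Type*) : Type _ := Quotient (SetComp.setoid n L)

namespace IntComp

variable {n : ℕ} {L : Type*}

/-- The number of blocks. -/
def length (p : IntComp n L) : ℕ := p.blocks.length

/-- The underlying integer composition `|p| = (a₁, …, a_k)`. -/
def under (p : IntComp n L) : List ℕ := p.blocks.map Prod.fst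

/-- The support of a composition of `n`: the partition of `n` obtained by forgetting the order. -/
def supp (p : IntComp n L) : IntPart n L where
  blocks := p.blocks
  pos := p.pos
  sum_eq := by simpa using p.sum_eq

/-- The sum `a₁ + ⋯ + aᵢ` of the sizes of the first `i` blocks. -/
def partialSum (p : IntComp n L) (i : ℕ) : ℕ := ((p.blocks.take i).map Prod.fst).sum

/-- The indices of the blocks of `q` which lie in the `i`-th block of `p`: here the `i`-th block of
`p = ((a₁, g₁), …, (a_k, g_k))` occupies the interval from `a₁ + ⋯ + aᵢ₋₁` to `a₁ + ⋯ + aᵢ`. -/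
def inBlock {M : Type*} (q : IntComp n M) (p : IntComp n L) (i : Fin p.length) :
    Finset (Fin q.length) :=
  Finset.univ.filter fun j =>
    p.partialSum i ≤ q.partialSum j ∧ q.partialSum (j + 1) ≤ p.partialSum (i + 1)

/-- The integer composition underlying `q` refines the one underlying `p`. -/
def Refines {M : Type*} (q : IntComp n M) (p : IntComp n L) : Prop :=
  ∀ j : Fin q.length, ∃ i : Fin p.length, j ∈ q.inBlock p i

/-- `p ≤ q`: `q` is a label-preserving refinement of `p`. -/
def LabelLE (p q : IntComp n L) : Prop :=
  q.Refines p ∧ ∀ i : Fin p.length, ∀ j ∈ q.inBlock p i, (q.blocks.get j).2 = (p.blocks.get i).2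

/-- `q` is a multiplicative refinement of `p`: the product of the labels of the blocks of `q` in a
given block of `p` is the label of that block. -/
def MulLE [CommMonoid L] (p q : IntComp n L) : Prop :=
  q.Refines p ∧
    ∀ i : Fin p.length, ∏ j ∈ q.inBlock p i, (q.blocks.get j).2 = (p.blocks.get i).2

/-- `deg(q/p)`: the product over the blocks of `p` of the number of blocks of `q` refining it. -/
def deg {M : Type*} (q : IntComp n M) (p : IntComp n L) : ℕ :=
  ∏ i : Fin p.length, (q.inBlock p i).card

instance [Finite L] : Finite (IntComp n L) := by
  have h := List.finite_length_le (Fin (n + 1) × L) n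
  have : Finite {l : List (Fin (n + 1) × L) // l.length ≤ n} := h
  have hlen : ∀ p : IntComp n L, p.blocks.length ≤ n := fun p => by
    have := List.length_le_sum_of_one_le (p.blocks.map Prod.fst) (by
      intro a ha
      obtain ⟨b, hb, rfl⟩ := List.mem_map.1 ha
      exact p.pos b hb)
    simpa [p.sum_eq] using this
  refine Finite.of_injective (β := {l : List (Fin (n + 1) × L) // l.length ≤ n})
    (fun p => ⟨p.blocks.map fun b => (Fin.ofNat (n + 1) b.1, b.2), by simpa using hlen p⟩) ?_
  intro p q hpq
  have h1 : ∀ p : IntComp n L, (p.blocks.map fun b => (Fin.ofNat (n + 1) b.1, b.2)).map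
      (fun b => ((b.1 : ℕ), b.2)) = p.blocks := fun p => by
    rw [List.map_map]
    conv_rhs => rw [← List.map_id p.blocks]
    refine List.map_congr_left fun b hb => ?_
    have hb' : b.1 ≤ n := by
      have := List.single_le_sum (l := p.blocks.map Prod.fst) (by simp) b.1
        (List.mem_map_of_mem hb)
      rwa [p.sum_eq] at this
    simp [Fin.ofNat, Nat.mod_eq_of_lt (Nat.lt_succ_of_le hb')]
  refine IntComp.ext ?_
  rw [← h1 p, ← h1 q]
  exact congrArg (List.map _) (congrArg Subtype.val hpq)

noncomputable instance [Finite L] : Fintype (IntComp n L) := Fintype.ofFinite _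

end IntComp

namespace IntPart

variable {n : ℕ} {L : Type*}

/-- The number of blocks. -/
def length (l : IntPart n L) : ℕ := Multiset.card l.blocks

instance [Finite L] : Finite (IntPart n L) :=
  Finite.of_surjective (IntComp.supp : IntComp n L → IntPart n L) fun l => by
    obtain ⟨m, hpos, hsum⟩ := l
    induction m using Quotient.inductionOn with
    | h a => exact ⟨⟨a, hpos, by simpa using hsum⟩, rfl⟩

noncomputable instance [Finite L] : Fintype (IntPart n L) := Fintype.ofFinite _

end IntPart

namespace SetPart

variable {n : ℕ} {L : Type*}

/-- The type of an `L`-partition of `[n]`: the multiset of the sizes of its blocks, with labels. -/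
def type (S : SetPart n L) : IntPart n L :=
  Quotient.lift (s := SetComp.setoid n L) (fun s => s.type.supp)
    (fun _ _ h => IntPart.ext (Multiset.coe_eq_coe.2 (List.Perm.map _ h))) S

instance [Finite L] : Finite (SetPart n L) :=
  inferInstanceAs (Finite (Quotient (SetComp.setoid n L)))

noncomputable instance [Finite L] : Fintype (SetPart n L) := Fintype.ofFinite _

end SetPart

/-! ### The semigroup of `G`-compositions of `[n]` -/

namespace SetComp

section Mul

variable {n : ℕ} {L M : Type*} [Monoid L] [Monoid M]

/-- The list of the pairs `(Sᵢ ∩ Tⱼ, hⱼ gᵢ)`, ordered lexicographically by `(i, j)`. -/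
def interList (s t : List (Finset (Fin n) × L)) : List (Finset (Fin n) × L) :=
  s.flatMap fun B => t.map fun C => (B.1 ∩ C.1, C.2 * B.2)

/-- Omit the pairs whose set is empty. -/
def dagger (s : List (Finset (Fin n) × L)) : List (Finset (Fin n) × L) :=
  s.filter fun B => B.1.Nonempty

theorem mem_interList {s t : List (Finset (Fin n) × L)} {D : Finset (Fin n) × L} :
    D ∈ interList s t ↔ ∃ B ∈ s, ∃ C ∈ t, (B.1 ∩ C.1, C.2 * B.2) = D := by
  simp [interList]

/-- The product of two `G`-compositions of `[n]`. -/
instance : Mul (SetComp n L) where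
  mul s t :=
    { blocks := dagger (interList s.blocks t.blocks)
      nonempty := fun B hB => by simpa using (List.mem_filter.1 hB).2
      disjoint := by
        refine List.Pairwise.filter _ (List.pairwise_flatMap.2 ⟨fun B _ => ?_, ?_⟩)
        · exact List.pairwise_map.2 (t.disjoint.imp fun h =>
            h.mono Finset.inter_subset_right Finset.inter_subset_right)
        · refine s.disjoint.imp fun {B C} h => ?_
          intro x hx y hy
          obtain ⟨_, _, rfl⟩ := List.mem_map.1 hx
          obtain ⟨_, _, rfl⟩ := List.mem_map.1 hy
          exact h.mono Finset.inter_subset_left Finset.inter_subset_left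
      cover := fun i => by
        obtain ⟨B, hB, hiB⟩ := s.cover i
        obtain ⟨C, hC, hiC⟩ := t.cover i
        have hi : i ∈ B.1 ∩ C.1 := Finset.mem_inter.2 ⟨hiB, hiC⟩
        exact ⟨_, List.mem_filter.2 ⟨mem_interList.2 ⟨B, hB, C, hC, rfl⟩,
          decide_eq_true ⟨i, hi⟩⟩, hi⟩ }

theorem mul_blocks (s t : SetComp n L) :
    (s * t).blocks = dagger (interList s.blocks t.blocks) := rfl

theorem dagger_blocks {K : Type*} (s : SetComp n K) : dagger s.blocks = s.blocks :=
  List.filter_eq_self.2 fun B hB => by simpa using s.nonempty B hB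

/-- The unit is the composition with the single block `[n]` labelled by `1` (the empty composition
when `n = 0`). -/
instance : One (SetComp n L) where
  one :=
    { blocks := dagger [(Finset.univ, 1)]
      nonempty := fun B hB => by simpa using (List.mem_filter.1 hB).2
      disjoint := List.Pairwise.filter _ (List.pairwise_singleton _ _)
      cover := fun i => ⟨(Finset.univ, 1), List.mem_filter.2 ⟨by simp, by simpa using ⟨i, by simp⟩⟩,
        by simp⟩ }

theorem one_blocks : (1 : SetComp n L).blocks = dagger [(Finset.univ, 1)] := rfl

theorem dagger_interList_left (s t : List (Finset (Fin n) × L)) :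
    dagger (interList (dagger s) t) = dagger (interList s t) := by
  induction s with
  | nil => rfl
  | cons B s ih =>
    by_cases hB : B.1.Nonempty
    · have : dagger (B :: s) = B :: dagger s := List.filter_cons_of_pos (by simpa using hB)
      rw [this]
      simp only [interList, dagger, List.flatMap_cons, List.filter_append] at ih ⊢
      rw [ih]
    · have : dagger (B :: s) = dagger s := List.filter_cons_of_neg (by simpa using hB)
      rw [this, ih]
      have h0 : dagger (t.map fun C => (B.1 ∩ C.1, C.2 * B.2)) = [] := by
        rw [Finset.not_nonempty_iff_eq_empty] at hB
        refine List.filter_eq_nil_iff.2 fun D hD => ?_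
        obtain ⟨C, -, rfl⟩ := List.mem_map.1 hD
        simp [hB]
      simp only [interList, dagger, List.flatMap_cons, List.filter_append] at h0 ⊢
      rw [h0, List.nil_append]

theorem dagger_interList_right (s t : List (Finset (Fin n) × L)) :
    dagger (interList s (dagger t)) = dagger (interList s t) := by
  have key : ∀ B : Finset (Fin n) × L,
      dagger ((dagger t).map fun C => (B.1 ∩ C.1, C.2 * B.2)) =
        dagger (t.map fun C => (B.1 ∩ C.1, C.2 * B.2)) := fun B => by
    simp only [dagger, List.filter_map, List.filter_filter, Function.comp_def]
    congr 1
    refine List.filter_congr fun C _ => ?_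
    have : (B.1 ∩ C.1).Nonempty → C.1.Nonempty := fun h => h.mono Finset.inter_subset_right
    by_cases h : (B.1 ∩ C.1).Nonempty
    · simp [h, this h]
    · simp [h]
  induction s with
  | nil => rfl
  | cons B s ih =>
    have hB := key B
    simp only [interList, dagger, List.flatMap_cons, List.filter_append] at ih hB ⊢
    rw [hB, ih]

theorem interList_assoc (s t u : List (Finset (Fin n) × L)) :
    interList (interList s t) u = interList s (interList t u) := by
  simp only [interList, List.flatMap_assoc, List.map_flatMap, List.flatMap_map, List.map_map,
    Function.comp_def, Finset.inter_assoc, mul_assoc]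

instance : Monoid (SetComp n L) where
  mul_assoc s t u := SetComp.ext <| by
    rw [mul_blocks, mul_blocks, mul_blocks, mul_blocks, dagger_interList_left,
      dagger_interList_right, interList_assoc]
  one_mul s := SetComp.ext <| by
    rw [mul_blocks, one_blocks, dagger_interList_left]
    conv_rhs => rw [← dagger_blocks]
    simp [interList]
  mul_one s := SetComp.ext <| by
    rw [mul_blocks, one_blocks, dagger_interList_right]
    conv_rhs => rw [← dagger_blocks]
    simp [interList, List.flatMap_singleton']

/-- Relabelling along a group morphism is a semigroup morphism. -/
def relabelHom (f : L →* M) : SetComp n L →* SetComp n M where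
  toFun := relabel f
  map_one' := SetComp.ext <| by
    simp [relabel, one_blocks, dagger, List.filter_cons]
    split <;> simp
  map_mul' s t := SetComp.ext <| by
    simp [relabel, mul_blocks, dagger, interList, List.filter_map, List.filter_flatMap,
      List.map_flatMap, List.flatMap_map, Function.comp_def]

/-- The action of a permutation of `[n]`, as a semigroup morphism. -/
def permHom (w : Equiv.Perm (Fin n)) : SetComp n L →* SetComp n L where
  toFun := perm w
  map_one' := SetComp.ext <| by
    simp [perm, one_blocks, dagger, List.filter_cons]
    split <;> simp
  map_mul' s t := SetComp.ext <| by
    simp [perm, mul_blocks, dagger, interList, List.filter_map, List.filter_flatMap,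
      List.map_flatMap, List.flatMap_map, Function.comp_def, ← Finset.map_inter]

end Mul

end SetComp

/-! ### Idempotents of `ℂΣ_n`, the algebra of set compositions, for the uniform section -/

section LRB

variable {n : ℕ}

open Classical in
/-- The uniform section of the support map `Σ_n → Π_n`: the average `u_X` of the basis elements
`H_x` over all set compositions `x` with support `X`. -/
noncomputable def uniformSection (X : Finpartition (Finset.univ : Finset (Fin n))) :
    MonoidAlgebra ℂ (SetComp n Unit) :=
  ((Finset.univ.filter fun x : SetComp n Unit => x.setPartition = X).card : ℂ)⁻¹ •
    ∑ x : SetComp n Unit with x.setPartition = X, MonoidAlgebra.single x 1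

open Classical in
/-- The idempotents of `ℂΣ_n` given by `e_X = u_X - ∑_{Y > X} u_X e_Y`, where `Y > X` in the
support lattice `Π_n` means that `Y` strictly refines `X`; this is `Y < X` for the order on
`Finpartition`. -/
noncomputable def lrbIdem (X : Finpartition (Finset.univ : Finset (Fin n))) :
    MonoidAlgebra ℂ (SetComp n Unit) :=
  uniformSection X -
    ∑ Y : {Y : Finpartition (Finset.univ : Finset (Fin n)) // Y < X},
      uniformSection X * lrbIdem Y.1
termination_by (wellFounded_lt (α := Finpartition (Finset.univ : Finset (Fin n)))).wrap X
decreasing_by exact Y.2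

/-- The `Q`-basis `Q_x = H_x e_{supp x}` of `ℂΣ_n`. -/
noncomputable def lrbQ (x : SetComp n Unit) : MonoidAlgebra ℂ (SetComp n Unit) :=
  MonoidAlgebra.single x 1 * lrbIdem x.setPartition

end LRB

/-! ### Hsiao's algebra `ℂΣ_n[G]` and its invariant subalgebra -/

/-- The dual group `Hom(G, ℂˣ)`. -/
abbrev Dual (G : Type*) [CommGroup G] : Type _ := G →* ℂˣ

/-- The value `φ₁(g₁) ⋯ φ_k(g_k)`. -/
def evalLabels {G : Type*} [CommGroup G] (f : List (Dual G)) (g : List G) : ℂˣ :=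
  (List.zipWith (fun φ x => φ x) f g).prod

section Algebra

variable {G : Type*} [CommGroup G] {n : ℕ}

/-- The evaluation `φ(s)` of a `Ĝ`-composition of `[n]` at a `G`-composition of `[n]` with the same
underlying set composition. -/
def SetComp.eval (φ : SetComp n (Dual G)) (s : SetComp n G) : ℂˣ :=
  evalLabels (φ.blocks.map Prod.snd) (s.blocks.map Prod.snd)

/-- The evaluation `α(p)` of a `Ĝ`-composition of `n` at a `G`-composition of `n` with the same
underlying composition. -/
def IntComp.eval (α : IntComp n (Dual G)) (p : IntComp n G) : ℂˣ :=
  evalLabels (α.blocks.map Prod.snd) (p.blocks.map Prod.snd)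

/-- The inclusion `ℂΣ_n ⊆ ℂΣ_n[G]` which labels all blocks by the unit of `G`; it identifies `Σ_n`
with the set of idempotents of `Σ_n[G]`. -/
noncomputable def incl (G : Type*) [CommGroup G] (n : ℕ) :
    MonoidAlgebra ℂ (SetComp n Unit) →ₐ[ℂ] MonoidAlgebra ℂ (SetComp n G) :=
  MonoidAlgebra.mapDomainAlgHom ℂ ℂ (SetComp.relabelHom (1 : Unit →* G))

/-- The subalgebra of the elements of `ℂΣ_n[G]` fixed by the action of the symmetric group, which
permutes the basis `H_s` through `w • H_s = H_{w • s}`. -/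
noncomputable def invariants (G : Type*) [CommGroup G] (n : ℕ) :
    Subalgebra ℂ (MonoidAlgebra ℂ (SetComp n G)) :=
  ⨅ w : Equiv.Perm (Fin n), AlgHom.equalizer
    (MonoidAlgebra.mapDomainAlgHom ℂ ℂ (SetComp.permHom w)) (AlgHom.id ℂ _)

variable [Finite G]

open Classical in
/-- The isotypic projector `E_φ = |G_x|⁻¹ ∑_{s ∈ G_x} conj (φ(s)) H_s` of `φ`, where `x = |φ|` and
`G_x` is the maximal subgroup of the `s ∈ Σ_n[G]` with `|s| = x`. -/
noncomputable def isoE (φ : SetComp n (Dual G)) : MonoidAlgebra ℂ (SetComp n G) :=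
  ((Finset.univ.filter fun s : SetComp n G => s.under = φ.under).card : ℂ)⁻¹ •
    ∑ s : SetComp n G with s.under = φ.under,
      MonoidAlgebra.single s (starRingEnd ℂ (φ.eval s : ℂ))

/-- The elements `Q_φ = E_φ Q_{|φ|}`. -/
noncomputable def isoQ (φ : SetComp n (Dual G)) : MonoidAlgebra ℂ (SetComp n G) :=
  isoE φ * incl G n (lrbQ φ.under)

/-- The idempotents `e_Φ = u_{|Φ|} Q_φ` of `ℂΣ_n[G]`, where `φ` is any `Ĝ`-composition with support
`Φ` (the product does not depend on the choice). -/
noncomputable def idem (Φ : SetPart n (Dual G)) : MonoidAlgebra ℂ (SetComp n G) :=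
  incl G n (uniformSection (Quotient.out Φ).setPartition) * isoQ (Quotient.out Φ)

open Classical in
/-- The elements `e_λ`: the sum of the `e_Φ` over all `Ĝ`-partitions `Φ` of `[n]` of type `λ`. -/
noncomputable def invIdem (l : IntPart n (Dual G)) : MonoidAlgebra ℂ (SetComp n G) :=
  ∑ Φ : SetPart n (Dual G) with Φ.type = l, idem Φ

open Classical in
/-- The orbit sum `H_p` of the basis elements `H_s` with `s` of type `p`. -/
noncomputable def symH (p : IntComp n G) : MonoidAlgebra ℂ (SetComp n G) :=
  ∑ s : SetComp n G with s.type = p, MonoidAlgebra.single s 1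

open Classical in
/-- The orbit sum `E_α` of the elements `E_φ` with `φ` of type `α`. -/
noncomputable def symE (α : IntComp n (Dual G)) : MonoidAlgebra ℂ (SetComp n G) :=
  ∑ φ : SetComp n (Dual G) with φ.type = α, isoE φ

end Algebra

/-! ### Complete systems of primitive orthogonal idempotents -/

/-- A nonzero idempotent which is not the sum of two nonzero orthogonal idempotents. -/
structure IsPrimitiveIdem {A : Type*} [Ring A] (e : A) : Prop where
  idem : IsIdempotentElem e
  ne_zero : e ≠ 0
  indecomposable : ∀ a b : A, IsIdempotentElem a → IsIdempotentElem b → a * b = 0 → b * a = 0 →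
    e = a + b → a = 0 ∨ b = 0

/-- A complete system of primitive orthogonal idempotents. -/
structure IsCSoPOI {A ι : Type*} [Ring A] [Fintype ι] (e : ι → A) : Prop where
  primitive : ∀ i, IsPrimitiveIdem (e i)
  complete : CompleteOrthogonalIdempotents e

end Hsiao

/-!
A composition `s` of `[n]` is determined by the total preorder of `[n]` whose classes are its blocks
and by the label of the block of each point (`SetComp.ext_pos`). In these terms, the product of
compositions is the lexicographic product of preorders together with the pointwise product of
labels, and most identities between compositions become statements about points.

The argument has five ingredients.

* For the unlabelled compositions, `H_w e_X = 0` unless `X` refines the support of `w`, and the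
  `e_X` add up to `1` (`single_mul_lrbIdem_eq_zero`, `sum_lrbIdem`). The coefficients of `Q_x` are
  found by an eigenvalue argument: let `b_M` be the sum of the compositions `H_f` of the fibres of
  all functions `f : [n] → {0, …, M - 1}`. Left multiplication by `b_M` has `e_Z` as an
  eigenvector, with eigenvalue `M` to the number of blocks of `Z` (`fibreSum_mul_lrbIdem`). The
  element obtained from `x` by refining each of its blocks by a function with `mᵢ` values is
  polynomial in the `mᵢ`, and its right multiplication by `b_M` replaces each `mᵢ` by `mᵢ M`
  (`refinementSum_mul_fibreSum`), so that the coefficient `R` of `∏ mᵢ` satisfies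
  `R b_M = M ^ ℓ(x) R`. Comparing eigenvalues, `R e_Z = 0` for `Z ≠ supp x`, whence
  `R = R e_{supp x} = Q_x` (`lrbQ_eq`), and the linear coefficients of the binomial polynomials
  `mᵢ choose c` are the numbers `(-1) ^ (c - 1) / c`.
* The `E_φ` with given blocks are the primitive idempotents of the group algebra of a power of `G`.
  Together with the annihilation properties of the `e_X`, this shows that the `e_Φ` are nonzero
  orthogonal idempotents with sum `1` (`idem_mul_idem`, `sum_idem`, `idem_ne_zero`), and that
  `e_Φ = (1 / k!) ∑ Q_φ` over the orderings `φ` of the `k` blocks of `Φ` (`idem_eq_sum`).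
* The symmetric group acts transitively on the compositions of a given type, and `t` refines exactly
  one composition of type `p` when its type refines `p` (`sum_refinedBy`). Summing over types gives
  the formula for `e_λ` in terms of the `H_q`. The formula in terms of the `E_β` follows by the
  Fourier transform along the map from the blocks of `q` to those of `α`
  (`sum_conj_tupleEval_fibres`).
* The orbit sums `H_q` are a basis of the invariants since each invariant element is determined by
  its coefficients at one composition of each type; the `E_β` are obtained from them by the
  invertible Fourier transform (`symE_eq`, `symH_eq`).
* For `Ψ` and `Φ` with the same number of blocks, `e_Ψ H_s e_Φ` is zero if `Ψ ≠ Φ` and a multiple of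
  `e_Φ` if `Ψ = Φ` (`compIdem_mul_single_mul_compIdem`). For an invariant `a`, the scalar in
  `e_Φ a e_Φ` depends only on the type of `Φ`, so that `e_λ a e_λ` is a multiple of `e_λ`
  (`exists_invIdem_mul_mul_invIdem_eq_smul`). A nonzero idempotent with this property is primitive.
-/

namespace Hsiao

/-! ### The index of the block containing a point -/

/-- Two surjections onto linear orders which induce the same preorder differ by an order
isomorphism. -/
theorem exists_orderIso_of_le_iff_le {ι α β : Type*} [LinearOrder α] [LinearOrder β]
    {f : ι → α} {g : ι → β} (hf : Function.Surjective f) (hg : Function.Surjective g)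
    (h : ∀ i j, f i ≤ f j ↔ g i ≤ g j) : ∃ e : α ≃o β, ∀ i, e (f i) = g i := by
  have hφ : ∀ i, g (Function.surjInv hf (f i)) = g i := fun i =>
    le_antisymm ((h _ _).1 (Function.surjInv_eq hf _).le) ((h _ _).1 (Function.surjInv_eq hf _).ge)
  let e : α ≃ β := Equiv.ofBijective (fun a => g (Function.surjInv hf a)) <| by
    constructor
    · intro a b hab
      rw [← Function.surjInv_eq hf a, ← Function.surjInv_eq hf b]
      exact le_antisymm ((h _ _).2 hab.le) ((h _ _).2 hab.ge)
    · intro b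
      obtain ⟨i, rfl⟩ := hg b
      exact ⟨f i, hφ i⟩
  refine ⟨⟨e, ?_⟩, hφ⟩
  intro a b
  change g _ ≤ g _ ↔ _
  rw [← h, Function.surjInv_eq hf, Function.surjInv_eq hf]

theorem val_eq_of_le_iff_le {ι : Type*} {k l : ℕ} {f : ι → Fin k} {g : ι → Fin l}
    (hf : Function.Surjective f) (hg : Function.Surjective g)
    (h : ∀ i j, f i ≤ f j ↔ g i ≤ g j) : k = l ∧ ∀ i, (f i : ℕ) = g i := by
  obtain ⟨e, he⟩ := exists_orderIso_of_le_iff_le hf hg h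
  refine ⟨by simpa using Fintype.card_congr e.toEquiv, fun i => ?_⟩
  rw [← he, Fin.coe_orderIso_apply]

namespace SetComp

variable {n : ℕ} {L M : Type*}

theorem exists_mem_get (s : SetComp n L) (i : Fin n) :
    ∃ j : Fin s.length, i ∈ (s.blocks.get j).1 := by
  obtain ⟨B, hB, hi⟩ := s.cover i
  obtain ⟨j, rfl⟩ := List.mem_iff_get.1 hB
  exact ⟨j, hi⟩

/-- The index of the block of `s` which contains `i`. -/
noncomputable def pos (s : SetComp n L) (i : Fin n) : Fin s.length := (s.exists_mem_get i).choose

theorem mem_pos (s : SetComp n L) (i : Fin n) : i ∈ (s.blocks.get (s.pos i)).1 :=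
  (s.exists_mem_get i).choose_spec

/-- The label of the block of `s` which contains `i`. -/
noncomputable def labAt (s : SetComp n L) (i : Fin n) : L := (s.blocks.get (s.pos i)).2

theorem mem_get_iff (s : SetComp n L) {i : Fin n} {j : Fin s.length} :
    i ∈ (s.blocks.get j).1 ↔ s.pos i = j := by
  refine ⟨fun h => ?_, fun h => h ▸ s.mem_pos i⟩
  have hd := List.pairwise_iff_get.1 s.disjoint
  rcases lt_trichotomy (s.pos i) j with hl | hl | hl
  · exact (Finset.disjoint_left.1 (hd _ _ hl) (s.mem_pos i) h).elim
  · exact hl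
  · exact (Finset.disjoint_left.1 (hd _ _ hl) h (s.mem_pos i)).elim

theorem pos_surjective (s : SetComp n L) : Function.Surjective s.pos := fun j => by
  obtain ⟨i, hi⟩ := s.nonempty _ (List.get_mem s.blocks j)
  exact ⟨i, s.mem_get_iff.1 hi⟩

theorem labAt_eq_of_pos_eq (s : SetComp n L) {i j : Fin n} (h : s.pos i = s.pos j) :
    s.labAt i = s.labAt j := by rw [labAt, labAt, h]

theorem labAt_of_mem (s : SetComp n L) {B : Finset (Fin n) × L} (hB : B ∈ s.blocks) {i : Fin n}
    (hi : i ∈ B.1) : s.labAt i = B.2 := by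
  obtain ⟨j, rfl⟩ := List.mem_iff_get.1 hB
  rw [labAt, s.mem_get_iff.1 hi]

theorem pos_eq_iff_of_mem (s : SetComp n L) {B : Finset (Fin n) × L} (hB : B ∈ s.blocks)
    {i j : Fin n} (hi : i ∈ B.1) : s.pos i = s.pos j ↔ j ∈ B.1 := by
  obtain ⟨k, rfl⟩ : ∃ k : Fin s.length, s.blocks.get k = B := List.mem_iff_get.1 hB
  rw [s.mem_get_iff.1 hi, eq_comm]
  exact s.mem_get_iff.symm

theorem exists_mem_of_pos_eq (s : SetComp n L) {i j : Fin n} (h : s.pos i = s.pos j) :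
    ∃ B ∈ s.blocks, i ∈ B.1 ∧ j ∈ B.1 :=
  ⟨_, List.get_mem s.blocks (s.pos i), s.mem_pos i, h ▸ s.mem_pos j⟩

theorem get_eq (s : SetComp n L) (j : Fin s.length) :
    (s.blocks.get j).1 = Finset.univ.filter fun i => s.pos i = j := by
  ext i; simp only [Finset.mem_filter, Finset.mem_univ, true_and]; exact s.mem_get_iff

/-- A composition is determined by the total preorder of `[n]` which it induces and by its labels,
seen as functions on `[n]`. -/
theorem ext_pos {s t : SetComp n L} (h : ∀ i j, s.pos i ≤ s.pos j ↔ t.pos i ≤ t.pos j)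
    (hl : ∀ i, s.labAt i = t.labAt i) : s = t := by
  obtain ⟨hk, hv⟩ := val_eq_of_le_iff_le s.pos_surjective t.pos_surjective h
  refine SetComp.ext (List.ext_get hk fun j h1 h2 => Prod.ext ?_ ?_)
  · refine (s.get_eq ⟨j, h1⟩).trans (Eq.trans ?_ (t.get_eq ⟨j, h2⟩).symm)
    ext i
    simp [Fin.ext_iff, hv]
  · obtain ⟨i, hi⟩ := s.pos_surjective ⟨j, h1⟩
    have ht : t.pos i = ⟨j, h2⟩ := Fin.ext (by rw [← hv, hi])
    have := hl i
    rwa [labAt, labAt, hi, ht] at this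

theorem pairwise_pos (s : SetComp n L) :
    s.blocks.Pairwise fun B C => ∀ i ∈ B.1, ∀ j ∈ C.1, s.pos i < s.pos j := by
  rw [List.pairwise_iff_get]
  intro a b hab i hi j hj
  rwa [s.mem_get_iff.1 hi, s.mem_get_iff.1 hj]

/-- The preorder of a composition is that of any function which is constant on the blocks and
increases from each block to the later ones. -/
theorem pos_le_pos_iff (s : SetComp n L) {α : Type*} [LinearOrder α] {f : Fin n → α}
    (h1 : s.blocks.Pairwise fun B C => ∀ i ∈ B.1, ∀ j ∈ C.1, f i < f j)
    (h2 : ∀ B ∈ s.blocks, ∀ i ∈ B.1, ∀ j ∈ B.1, f i = f j) (i j : Fin n) :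
    s.pos i ≤ s.pos j ↔ f i ≤ f j := by
  have h1' := List.pairwise_iff_get.1 h1
  rcases lt_trichotomy (s.pos i) (s.pos j) with h | h | h
  · have := h1' _ _ h i (s.mem_pos i) j (s.mem_pos j)
    exact ⟨fun _ => this.le, fun _ => h.le⟩
  · obtain ⟨B, hB, hi, hj⟩ := s.exists_mem_of_pos_eq h
    exact ⟨fun _ => (h2 B hB i hi j hj).le, fun _ => h.le⟩
  · have := h1' _ _ h j (s.mem_pos j) i (s.mem_pos i)
    exact ⟨fun h' => absurd h' h.not_ge, fun h' => absurd h' this.not_ge⟩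

theorem pos_eq_pos_iff_of_le {K : Type*} {s : SetComp n L} {t : SetComp n K}
    (h : ∀ i j, s.pos i ≤ s.pos j ↔ t.pos i ≤ t.pos j) (i j : Fin n) :
    s.pos i = s.pos j ↔ t.pos i = t.pos j := by
  rw [le_antisymm_iff, le_antisymm_iff, h, h]

theorem length_relabel (f : L → M) (s : SetComp n L) : (s.relabel f).length = s.length :=
  List.length_map _

theorem pos_relabel_le (f : L → M) (s : SetComp n L) (i j : Fin n) :
    (s.relabel f).pos i ≤ (s.relabel f).pos j ↔ s.pos i ≤ s.pos j := by
  refine pos_le_pos_iff _ (List.pairwise_map.2 s.pairwise_pos) ?_ i j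
  intro B hB i hi j hj
  obtain ⟨C, hC, rfl⟩ := List.mem_map.1 hB
  exact (s.pos_eq_iff_of_mem hC hi).2 hj

theorem labAt_relabel (f : L → M) (s : SetComp n L) (i : Fin n) :
    (s.relabel f).labAt i = f (s.labAt i) :=
  labAt_of_mem (s.relabel f) (B := ((s.blocks.get (s.pos i)).1, f (s.labAt i)))
    (List.mem_map_of_mem (f := fun B : Finset (Fin n) × L => (B.1, f B.2))
      (List.get_mem s.blocks (s.pos i))) (s.mem_pos i)

theorem pos_under_le (s : SetComp n L) (i j : Fin n) :
    s.under.pos i ≤ s.under.pos j ↔ s.pos i ≤ s.pos j := pos_relabel_le _ s i j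

theorem length_under (s : SetComp n L) : s.under.length = s.length := length_relabel _ s

theorem pos_perm_le (w : Equiv.Perm (Fin n)) (s : SetComp n L) (i j : Fin n) :
    (s.perm w).pos i ≤ (s.perm w).pos j ↔ s.pos (w.symm i) ≤ s.pos (w.symm j) := by
  refine pos_le_pos_iff (f := fun i => s.pos (w.symm i)) _
    (List.pairwise_map.2 (s.pairwise_pos.imp ?_)) ?_ i j
  · intro B C h i hi j hj
    obtain ⟨i, hi', rfl⟩ := Finset.mem_map.1 hi
    obtain ⟨j, hj', rfl⟩ := Finset.mem_map.1 hj
    simpa using h i hi' j hj'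
  · intro B hB i hi j hj
    obtain ⟨C, hC, rfl⟩ := List.mem_map.1 hB
    obtain ⟨i, hi', rfl⟩ := Finset.mem_map.1 hi
    obtain ⟨j, hj', rfl⟩ := Finset.mem_map.1 hj
    simpa using (s.pos_eq_iff_of_mem hC hi').2 hj'

theorem labAt_perm (w : Equiv.Perm (Fin n)) (s : SetComp n L) (i : Fin n) :
    (s.perm w).labAt i = s.labAt (w.symm i) :=
  labAt_of_mem (s.perm w) (B := ((s.blocks.get (s.pos (w.symm i))).1.map w.toEmbedding, _))
    (List.mem_map_of_mem (f := fun B : Finset (Fin n) × L => (B.1.map w.toEmbedding, B.2))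
      (List.get_mem s.blocks (s.pos (w.symm i))))
    (Finset.mem_map.2 ⟨w.symm i, s.mem_pos _, w.apply_symm_apply i⟩)

theorem perm_type (w : Equiv.Perm (Fin n)) (s : SetComp n L) : (s.perm w).type = s.type :=
  IntComp.ext (by simp [type, perm, Function.comp_def])

theorem under_eq_iff {K : Type*} {s : SetComp n L} {t : SetComp n K} :
    s.under = t.under ↔ ∀ i j, s.pos i ≤ s.pos j ↔ t.pos i ≤ t.pos j := by
  refine ⟨fun h i j => ?_, fun h => ext_pos (fun i j => ?_) fun _ => rfl⟩
  · rw [← pos_under_le s, ← pos_under_le t, h]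
  · rw [pos_under_le s, pos_under_le t, h]

theorem eq_of_under_eq {s t : SetComp n L} (h : s.under = t.under)
    (hl : ∀ i, s.labAt i = t.labAt i) : s = t := ext_pos (under_eq_iff.1 h) hl

theorem under_unit (x : SetComp n Unit) : x.under = x :=
  ext_pos (pos_under_le x) fun _ => rfl

theorem under_relabel (f : L → M) (s : SetComp n L) : (s.relabel f).under = s.under :=
  under_eq_iff.2 (pos_relabel_le f s)

/-! ### Products -/

section Mul

variable [Monoid L] [Monoid M]

/-- The preorder of a product is the lexicographic preorder. -/
theorem pos_mul_le_iff (s t : SetComp n L) (i j : Fin n) :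
    (s * t).pos i ≤ (s * t).pos j ↔ toLex (s.pos i, t.pos i) ≤ toLex (s.pos j, t.pos j) := by
  refine pos_le_pos_iff (f := fun i => toLex (s.pos i, t.pos i)) _ ?_ ?_ i j
  · rw [mul_blocks]
    refine List.Pairwise.filter _ (List.pairwise_flatMap.2 ⟨fun B hB => ?_, ?_⟩)
    · refine List.pairwise_map.2 (t.pairwise_pos.imp fun {C D} h i hi j hj => ?_)
      rw [Finset.mem_inter] at hi hj
      exact Prod.Lex.toLex_lt_toLex.2
        (Or.inr ⟨(s.pos_eq_iff_of_mem hB hi.1).2 hj.1, h i hi.2 j hj.2⟩)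
    · refine s.pairwise_pos.imp fun {B C} h x hx y hy i hi j hj => ?_
      obtain ⟨_, _, rfl⟩ := List.mem_map.1 hx
      obtain ⟨_, _, rfl⟩ := List.mem_map.1 hy
      rw [Finset.mem_inter] at hi hj
      exact Prod.Lex.toLex_lt_toLex.2 (Or.inl (h i hi.1 j hj.1))
  · intro D hD i hi j hj
    obtain ⟨B, hB, C, hC, rfl⟩ := mem_interList.1 (List.mem_filter.1 hD).1
    rw [Finset.mem_inter] at hi hj
    simp only [(s.pos_eq_iff_of_mem hB hi.1).2 hj.1, (t.pos_eq_iff_of_mem hC hi.2).2 hj.2]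

theorem pos_mul_le (s t : SetComp n L) (i j : Fin n) :
    (s * t).pos i ≤ (s * t).pos j ↔
      s.pos i < s.pos j ∨ s.pos i = s.pos j ∧ t.pos i ≤ t.pos j := by
  rw [pos_mul_le_iff, Prod.Lex.toLex_le_toLex]

theorem pos_mul_eq (s t : SetComp n L) (i j : Fin n) :
    (s * t).pos i = (s * t).pos j ↔ s.pos i = s.pos j ∧ t.pos i = t.pos j := by
  rw [le_antisymm_iff, pos_mul_le_iff, pos_mul_le_iff, ← le_antisymm_iff]
  simp

theorem labAt_mul (s t : SetComp n L) (i : Fin n) :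
    (s * t).labAt i = t.labAt i * s.labAt i := by
  have hi : i ∈ (s.blocks.get (s.pos i)).1 ∩ (t.blocks.get (t.pos i)).1 :=
    Finset.mem_inter.2 ⟨s.mem_pos i, t.mem_pos i⟩
  exact labAt_of_mem _ (B := (_, t.labAt i * s.labAt i)) (List.mem_filter.2
    ⟨mem_interList.2 ⟨_, List.get_mem _ _, _, List.get_mem _ _, rfl⟩, decide_eq_true ⟨i, hi⟩⟩) hi

theorem under_mul (s t : SetComp n L) : (s * t).under = s.under * t.under :=
  (relabelHom (1 : L →* Unit)).map_mul s t

end Mul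

/-! ### Supports -/

theorem setPartition_le_iff {s : SetComp n L} {t : SetComp n M} :
    s.setPartition ≤ t.setPartition ↔ ∀ i j, s.pos i = s.pos j → t.pos i = t.pos j := by
  constructor
  · intro h i j hij
    obtain ⟨B, hB, hi, hj⟩ := s.exists_mem_of_pos_eq hij
    obtain ⟨C, hC, hBC⟩ := h (List.mem_toFinset.2 (List.mem_map_of_mem hB))
    obtain ⟨D, hD, rfl⟩ := List.mem_map.1 (List.mem_toFinset.1 hC)
    exact (t.pos_eq_iff_of_mem hD (hBC hi)).2 (hBC hj)
  · intro h B hB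
    obtain ⟨B, hB', rfl⟩ := List.mem_map.1 (List.mem_toFinset.1 hB)
    obtain ⟨i, hi⟩ := s.nonempty B hB'
    refine ⟨_, List.mem_toFinset.2 (List.mem_map_of_mem (List.get_mem t.blocks (t.pos i))), ?_⟩
    intro j hj
    exact t.mem_get_iff.2 (h i j ((s.pos_eq_iff_of_mem hB' hi).2 hj)).symm

theorem setPartition_eq_iff {s : SetComp n L} {t : SetComp n M} :
    s.setPartition = t.setPartition ↔ ∀ i j, s.pos i = s.pos j ↔ t.pos i = t.pos j := by
  rw [le_antisymm_iff, setPartition_le_iff, setPartition_le_iff]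
  exact ⟨fun h i j => ⟨h.1 i j, h.2 i j⟩, fun h => ⟨fun i j => (h i j).1, fun i j => (h i j).2⟩⟩

theorem setPartition_relabel (f : L → M) (s : SetComp n L) :
    (s.relabel f).setPartition = s.setPartition :=
  setPartition_eq_iff.2 (pos_eq_pos_iff_of_le (pos_relabel_le f s))

theorem setPartition_under (s : SetComp n L) : s.under.setPartition = s.setPartition :=
  setPartition_relabel _ s

theorem setPartition_eq_of_under_eq {s : SetComp n L} {t : SetComp n M} (h : s.under = t.under) :
    s.setPartition = t.setPartition := by rw [← setPartition_under, h, setPartition_under]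

/-- Supports turn products into meets, for the order on `Finpartition` in which the finer partition
is the smaller one. -/
theorem le_setPartition_mul [Monoid L] {u : SetComp n M} {s t : SetComp n L} :
    u.setPartition ≤ (s * t).setPartition ↔
      u.setPartition ≤ s.setPartition ∧ u.setPartition ≤ t.setPartition := by
  simp only [setPartition_le_iff, pos_mul_eq]
  exact ⟨fun h => ⟨fun i j hij => (h i j hij).1, fun i j hij => (h i j hij).2⟩,
    fun h i j hij => ⟨h.1 i j hij, h.2 i j hij⟩⟩

theorem setPartition_mul_le_left [Monoid L] (s t : SetComp n L) :
    (s * t).setPartition ≤ s.setPartition := (le_setPartition_mul.1 le_rfl).1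

theorem setPartition_mul_le_right [Monoid L] (s t : SetComp n L) :
    (s * t).setPartition ≤ t.setPartition := (le_setPartition_mul.1 le_rfl).2

theorem setPartition_mul_of_ge [Monoid L] {s t : SetComp n L}
    (h : t.setPartition ≤ s.setPartition) : (s * t).setPartition = t.setPartition :=
  le_antisymm (setPartition_mul_le_right s t) (le_setPartition_mul.2 ⟨h, le_rfl⟩)

theorem under_mul_of_le [Monoid L] {s t : SetComp n L} (h : s.setPartition ≤ t.setPartition) :
    (s * t).under = s.under := by
  rw [setPartition_le_iff] at h
  rw [under_eq_iff]
  intro i j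
  rw [pos_mul_le, le_iff_lt_or_eq (a := s.pos i)]
  exact ⟨fun h' => Or.imp_right And.left h',
    fun h' => Or.imp_right (fun h' => ⟨h', (h i j h').le⟩) h'⟩

theorem mul_eq_left_of_le {x y : SetComp n Unit} (h : x.setPartition ≤ y.setPartition) :
    x * y = x := eq_of_under_eq (under_mul_of_le h) fun _ => rfl

theorem nodup_blocks_fst (s : SetComp n L) : (s.blocks.map Prod.fst).Nodup := by
  rw [List.Nodup, List.pairwise_map]
  refine (List.Pairwise.and_mem.1 s.disjoint).imp ?_
  rintro B C ⟨hB, -, h⟩ hBC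
  exact (s.nonempty B hB).ne_empty (disjoint_self.1 (hBC ▸ h))

theorem card_parts (s : SetComp n L) : s.setPartition.parts.card = s.length := by
  rw [setPartition, List.toFinset_card_of_nodup s.nodup_blocks_fst, List.length_map, length]

/-- The composition with the blocks of `x`, all of them labelled by `1`. -/
def ofUnit (L : Type*) [Monoid L] (x : SetComp n Unit) : SetComp n L := x.relabel fun _ => 1

section ofUnit

variable [Monoid L]

theorem ofUnit_eq (x : SetComp n Unit) : ofUnit L x = relabelHom (1 : Unit →* L) x := rfl

theorem ofUnit_mul (x y : SetComp n Unit) : ofUnit L (x * y) = ofUnit L x * ofUnit L y :=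
  (relabelHom (1 : Unit →* L)).map_mul x y

theorem labAt_ofUnit (x : SetComp n Unit) (i : Fin n) : (ofUnit L x).labAt i = 1 :=
  labAt_relabel _ x i

theorem under_ofUnit (x : SetComp n Unit) : (ofUnit L x).under = x := by
  rw [ofUnit, under_relabel, under_unit]

theorem setPartition_ofUnit (x : SetComp n Unit) : (ofUnit L x).setPartition = x.setPartition :=
  setPartition_relabel _ x

theorem mul_ofUnit_of_le {s : SetComp n L} {x : SetComp n Unit}
    (h : s.setPartition ≤ x.setPartition) : s * ofUnit L x = s :=
  eq_of_under_eq (under_mul_of_le (by rwa [setPartition_ofUnit])) fun i => by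
    rw [labAt_mul, labAt_ofUnit, one_mul]

theorem mul_ofUnit_under (s : SetComp n L) : s * ofUnit L s.under = s :=
  mul_ofUnit_of_le (setPartition_under s).ge

theorem ofUnit_under_mul (s : SetComp n L) : ofUnit L s.under * s = s :=
  eq_of_under_eq (by rw [under_mul, under_ofUnit, mul_eq_left_of_le le_rfl]) fun i => by
    rw [labAt_mul, labAt_ofUnit, mul_one]

end ofUnit

/-- Two compositions differ only by the order of their blocks if and only if they have the same set
partition and the same labels. -/
theorem perm_blocks_iff {s t : SetComp n L} :
    s.blocks.Perm t.blocks ↔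
      s.setPartition = t.setPartition ∧ ∀ i, s.labAt i = t.labAt i := by
  classical
  have nd : ∀ s : SetComp n L, s.blocks.Nodup := fun s => s.nodup_blocks_fst.of_map
  constructor
  · intro h
    refine ⟨?_, fun i => ?_⟩
    · apply Finpartition.ext
      simp only [setPartition]
      exact List.toFinset_eq_of_perm _ _ (h.map _)
    · exact (t.labAt_of_mem (h.subset (List.get_mem s.blocks (s.pos i))) (s.mem_pos i)).symm
  · rintro ⟨h, hl⟩
    rw [setPartition_eq_iff] at h
    have key : ∀ s t : SetComp n L, (∀ i j, s.pos i = s.pos j ↔ t.pos i = t.pos j) →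
        (∀ i, s.labAt i = t.labAt i) → ∀ B ∈ s.blocks, B ∈ t.blocks := by
      intro s t h hl B hB
      obtain ⟨i, hi⟩ := s.nonempty B hB
      have : B = t.blocks.get (t.pos i) := by
        refine Prod.ext ?_ ?_
        · ext j
          rw [t.mem_get_iff, ← s.pos_eq_iff_of_mem hB hi, h, eq_comm]
        · rw [← s.labAt_of_mem hB hi, hl]; rfl
      rw [this]
      exact List.get_mem _ _
    rw [List.perm_ext_iff_of_nodup (nd s) (nd t)]
    exact fun B => ⟨key s t h hl B, key t s (fun i j => (h i j).symm) (fun i => (hl i).symm) B⟩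

end SetComp

end Hsiao

namespace Hsiao

open MonoidAlgebra

/-! ### Set partitions and their orderings -/

namespace SetComp

variable {n : ℕ}

/-- A list of the blocks of a set partition, as a set composition. -/
def ofList (X : Finpartition (Finset.univ : Finset (Fin n))) (l : List (Finset (Fin n)))
    (hn : l.Nodup) (hl : ∀ B, B ∈ l ↔ B ∈ X.parts) : SetComp n Unit where
  blocks := l.map fun B => (B, ())
  nonempty := by
    intro B hB
    obtain ⟨C, hC, rfl⟩ := List.mem_map.1 hB
    exact X.nonempty_of_mem_parts ((hl C).1 hC)
  disjoint := by
    rw [List.pairwise_map]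
    refine (List.Pairwise.and_mem.1 hn).imp ?_
    rintro B C ⟨hB, hC, h⟩
    exact X.disjoint ((hl B).1 hB) ((hl C).1 hC) h
  cover i := by
    obtain ⟨B, hB, hi⟩ := X.exists_mem (Finset.mem_univ i)
    exact ⟨_, List.mem_map_of_mem ((hl B).2 hB), hi⟩

theorem setPartition_ofList (X : Finpartition (Finset.univ : Finset (Fin n)))
    (l : List (Finset (Fin n))) (hn : l.Nodup) (hl : ∀ B, B ∈ l ↔ B ∈ X.parts) :
    (ofList X l hn hl).setPartition = X := by
  apply Finpartition.ext
  ext B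
  simp [setPartition, ofList, Function.comp_def, hl]

theorem exists_setPartition_eq (X : Finpartition (Finset.univ : Finset (Fin n))) :
    ∃ x : SetComp n Unit, x.setPartition = X :=
  ⟨_, setPartition_ofList X X.parts.toList X.parts.nodup_toList fun _ => Finset.mem_toList⟩

theorem map_fst_injective : Function.Injective fun x : SetComp n Unit => x.blocks.map Prod.fst :=
  fun x y h => SetComp.ext <| by
    have : Function.Injective (Prod.fst : Finset (Fin n) × Unit → _) :=
      fun a b h => Prod.ext h rfl
    exact this.list_map h

open Classical in
/-- A set partition with `k` blocks has `k!` orderings. -/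
theorem card_filter_setPartition (X : Finpartition (Finset.univ : Finset (Fin n))) :
    (Finset.univ.filter fun x : SetComp n Unit => x.setPartition = X).card
      = X.parts.card.factorial := by
  rw [← Finset.length_toList X.parts, ← List.length_permutations,
    ← List.toFinset_card_of_nodup (List.nodup_permutations _ X.parts.nodup_toList)]
  refine Finset.card_bij (fun x _ => x.blocks.map Prod.fst) ?_
    (fun x _ y _ h => map_fst_injective h) ?_
  · intro x hx
    rw [Finset.mem_filter] at hx
    rw [List.mem_toFinset, List.mem_permutations,
      List.perm_ext_iff_of_nodup x.nodup_blocks_fst X.parts.nodup_toList]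
    intro B
    rw [Finset.mem_toList, ← hx.2, setPartition, List.mem_toFinset]
  · intro l hl
    rw [List.mem_toFinset, List.mem_permutations] at hl
    refine ⟨ofList X l (hl.nodup_iff.2 X.parts.nodup_toList)
      (fun B => by rw [hl.mem_iff, Finset.mem_toList]), ?_, ?_⟩
    · rw [Finset.mem_filter]
      exact ⟨Finset.mem_univ _, setPartition_ofList _ _ _ _⟩
    · simp [ofList, Function.comp_def]

theorem setPartition_le_one (x : SetComp n Unit) :
    x.setPartition ≤ (1 : SetComp n Unit).setPartition := by
  have := setPartition_mul_le_right x 1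
  rwa [mul_one] at this

end SetComp

/-! ### The idempotents of the left regular band of set compositions -/

section LRB

variable {n : ℕ} {X Y Z : Finpartition (Finset.univ : Finset (Fin n))}

open Classical in
theorem card_setPartition_ne_zero (X : Finpartition (Finset.univ : Finset (Fin n))) :
    ((Finset.univ.filter fun x : SetComp n Unit => x.setPartition = X).card : ℂ) ≠ 0 := by
  rw [SetComp.card_filter_setPartition]
  exact_mod_cast Nat.factorial_ne_zero _

/-- If `a * H_x` does not depend on the ordering `x` of `X`, then it is equal to `a * u_X`. -/
theorem mul_uniformSection_eq {A : Type*} [Ring A] [Algebra ℂ A]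
    (f : MonoidAlgebra ℂ (SetComp n Unit) →ₐ[ℂ] A) {a b : A}
    (h : ∀ x : SetComp n Unit, x.setPartition = X → a * f (single x 1) = b) :
    a * f (uniformSection X) = b := by
  classical
  rw [uniformSection, map_smul, map_sum, mul_smul_comm, Finset.mul_sum,
    Finset.sum_congr rfl fun x hx => h x (Finset.mem_filter.1 hx).2, Finset.sum_const,
    ← Nat.cast_smul_eq_nsmul ℂ, smul_smul, inv_mul_cancel₀, one_smul]
  exact card_setPartition_ne_zero X

theorem uniformSection_mul_eq {A : Type*} [Ring A] [Algebra ℂ A]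
    (f : MonoidAlgebra ℂ (SetComp n Unit) →ₐ[ℂ] A) {a b : A}
    (h : ∀ x : SetComp n Unit, x.setPartition = X → f (single x 1) * a = b) :
    f (uniformSection X) * a = b := by
  classical
  rw [uniformSection, map_smul, map_sum, smul_mul_assoc, Finset.sum_mul,
    Finset.sum_congr rfl fun x hx => h x (Finset.mem_filter.1 hx).2, Finset.sum_const,
    ← Nat.cast_smul_eq_nsmul ℂ, smul_smul, inv_mul_cancel₀, one_smul]
  exact card_setPartition_ne_zero X

theorem single_mul_uniformSection {w : SetComp n Unit} (h : w.setPartition ≤ X) :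
    single w (1 : ℂ) * uniformSection X = single w 1 :=
  mul_uniformSection_eq (AlgHom.id ℂ _) fun x hx => by
    rw [AlgHom.id_apply, single_mul_single, one_mul, SetComp.mul_eq_left_of_le (h.trans hx.ge)]

theorem uniformSection_mul_uniformSection (h : X ≤ Y) :
    (uniformSection X * uniformSection Y : MonoidAlgebra ℂ (SetComp n Unit)) =
      uniformSection X := by
  conv_lhs => enter [1]; rw [uniformSection]
  rw [smul_mul_assoc, Finset.sum_mul, Finset.sum_congr rfl fun x hx =>
    single_mul_uniformSection ((Finset.mem_filter.1 hx).2.trans_le h), uniformSection]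

open Classical in
theorem lrbIdem_eq (X : Finpartition (Finset.univ : Finset (Fin n))) :
    lrbIdem X = uniformSection X - ∑ Y with Y < X, uniformSection X * lrbIdem Y := by
  rw [lrbIdem]
  congr 1
  exact (Finset.sum_subtype (p := fun Y => Y < X) _ (by simp) fun Y =>
    uniformSection X * lrbIdem Y).symm

theorem uniformSection_mul_lrbIdem (X : Finpartition (Finset.univ : Finset (Fin n))) :
    uniformSection X * lrbIdem X = lrbIdem X := by
  classical
  conv_lhs => rw [lrbIdem_eq, mul_sub, Finset.mul_sum]
  simp only [← mul_assoc, uniformSection_mul_uniformSection le_rfl]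
  exact (lrbIdem_eq X).symm

open Classical in
theorem sum_uniformSection_mul_lrbIdem (X : Finpartition (Finset.univ : Finset (Fin n))) :
    ∑ Y with Y ≤ X, uniformSection X * lrbIdem Y = uniformSection X := by
  have : (Finset.univ.filter fun Y => Y ≤ X) = insert X (Finset.univ.filter fun Y => Y < X) := by
    ext Y; simp [le_iff_eq_or_lt]
  rw [this, Finset.sum_insert (by simp), uniformSection_mul_lrbIdem]
  conv_lhs => enter [1]; rw [lrbIdem_eq]
  exact sub_add_cancel _ _

/-- The element `H_w` annihilates `e_X` unless `X` refines the support of `w`. -/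
theorem single_mul_lrbIdem_eq_zero {w : SetComp n Unit} (h : ¬ X ≤ w.setPartition) :
    single w (1 : ℂ) * lrbIdem X = 0 := by
  classical
  induction X using (wellFounded_lt (α := Finpartition (Finset.univ : Finset (Fin n)))).induction
    generalizing w with
  | _ X ih =>
  -- `H_w u_X` is an average of basis elements with support `Z`, the meet of `X` and `supp w`, so
  -- that it is fixed by the right multiplication by `u_Z`. By induction, `H_w u_X e_Y` is zero for
  -- `Y < X` unless `Y ≤ Z`, and the remaining terms add up to `H_w u_X u_Z`.
  obtain ⟨x, hx⟩ := SetComp.exists_setPartition_eq X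
  set Z := (w * x).setPartition with hZ
  have hZX : Z ≤ X := hx ▸ SetComp.setPartition_mul_le_right w x
  have hwy : ∀ y : SetComp n Unit, y.setPartition = X → (w * y).setPartition = Z := fun y hy =>
    le_antisymm (SetComp.le_setPartition_mul.2 ⟨SetComp.setPartition_mul_le_left _ _, by
        rw [hx, ← hy]; exact SetComp.setPartition_mul_le_right _ _⟩)
      (SetComp.le_setPartition_mul.2 ⟨SetComp.setPartition_mul_le_left _ _, by rwa [hy]⟩)
  have hne : Z ≠ X := fun hc => h (hc ▸ SetComp.setPartition_mul_le_left w x)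
  have h1 : single w (1 : ℂ) * uniformSection X * uniformSection Z
      = single w (1 : ℂ) * uniformSection X := by
    rw [uniformSection, mul_smul_comm, smul_mul_assoc, Finset.mul_sum, Finset.sum_mul]
    refine congrArg _ (Finset.sum_congr rfl fun y hy => ?_)
    rw [single_mul_single, one_mul,
      single_mul_uniformSection (hwy y (Finset.mem_filter.1 hy).2).le]
  have h2 : ∀ Y, Y < X → ¬ Y ≤ Z → single w (1 : ℂ) * uniformSection X * lrbIdem Y = 0 := by
    intro Y hY hYZ
    rw [uniformSection, mul_smul_comm, smul_mul_assoc, Finset.mul_sum, Finset.sum_mul,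
      Finset.sum_eq_zero, smul_zero]
    intro y hy
    rw [single_mul_single, one_mul]
    exact ih Y hY fun hc => hYZ (hc.trans (hwy y (Finset.mem_filter.1 hy).2).le)
  have h3 : ∑ Y with Y < X, single w (1 : ℂ) * uniformSection X * lrbIdem Y
      = ∑ Y with Y ≤ Z, single w (1 : ℂ) * uniformSection X * lrbIdem Y := by
    symm
    refine Finset.sum_subset ?_ ?_
    · intro Y hY
      rw [Finset.mem_filter] at hY ⊢
      exact ⟨hY.1, hY.2.trans_lt (lt_of_le_of_ne hZX hne)⟩
    · intro Y hY hY'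
      exact h2 Y (Finset.mem_filter.1 hY).2 fun hc => hY' (Finset.mem_filter.2 ⟨by simp, hc⟩)
  rw [lrbIdem_eq, mul_sub, Finset.mul_sum]
  simp only [← mul_assoc]
  rw [h3, sub_eq_zero]
  conv_lhs => rw [← h1, ← sum_uniformSection_mul_lrbIdem Z, Finset.mul_sum]
  simp only [← mul_assoc, h1]

theorem sum_lrbIdem : ∑ X : Finpartition (Finset.univ : Finset (Fin n)), lrbIdem X = 1 := by
  classical
  have h1 : uniformSection (1 : SetComp n Unit).setPartition = 1 := by
    rw [← one_mul (uniformSection _), one_def]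
    exact single_mul_uniformSection le_rfl
  have := sum_uniformSection_mul_lrbIdem (1 : SetComp n Unit).setPartition
  rw [h1, Finset.filter_true_of_mem] at this
  · simpa using this
  · intro X _
    obtain ⟨x, rfl⟩ := SetComp.exists_setPartition_eq X
    exact x.setPartition_le_one

end LRB

end Hsiao

namespace Hsiao

/-! ### Extraction of the linear coefficient of a binomial polynomial -/

section Interpolation

open Polynomial

theorem coeff_one_descPochhammer (l : ℕ) :
    (descPochhammer ℂ (l + 1)).coeff 1 = (-1) ^ l * (l.factorial : ℂ) := by
  rw [descPochhammer_succ_left, coeff_X_mul, coeff_zero_eq_eval_zero, eval_comp]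
  have := ascPochhammer_eval_neg_eq_descPochhammer ℂ (-1) l
  rw [neg_neg, ascPochhammer_eval_one] at this
  have h2 : ((-1 : ℂ) ^ l) * (-1) ^ l = 1 := by rw [← mul_pow]; simp
  rw [this, ← mul_assoc, h2]
  simp

/-- There are weights on `0, …, n` which extract the coefficient of `t` from the polynomials in `t`
of degree at most `n`, in particular from the binomial polynomials `t ↦ (M t choose l)`. -/
theorem exists_linear_coeff_weights (n : ℕ) : ∃ a : ℕ → ℂ, ∀ l, 1 ≤ l → l ≤ n → ∀ M : ℕ,
    ∑ m ∈ Finset.range (n + 1), a m * ((m * M).choose l : ℂ) = M * ((-1) ^ (l - 1) / (l : ℂ)) := by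
  refine ⟨fun m => (Lagrange.basis (Finset.range (n + 1)) (fun i : ℕ => (i : ℂ)) m).coeff 1, ?_⟩
  intro l hl hln M
  obtain ⟨l, rfl⟩ := Nat.exists_eq_add_of_le' hl
  let p : ℂ[X] := C (((l + 1).factorial : ℂ)⁻¹) *
    (descPochhammer ℂ (l + 1)).comp (C (M : ℂ) * X)
  have hp : ∀ m : ℕ, p.eval (m : ℂ) = ((m * M).choose (l + 1) : ℂ) := by
    intro m
    have : (M : ℂ) * m = ((m * M : ℕ) : ℂ) := by push_cast; ring
    rw [eval_mul, eval_C, eval_comp, eval_mul, eval_C, eval_X, this,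
      descPochhammer_eval_eq_descFactorial, Nat.descFactorial_eq_factorial_mul_choose,
      Nat.cast_mul, inv_mul_cancel_left₀]
    exact_mod_cast Nat.factorial_ne_zero _
  have hdeg : p.degree < (Finset.range (n + 1)).card := by
    refine lt_of_le_of_lt (degree_le_of_natDegree_le (n := l + 1) ?_) ?_
    · refine (natDegree_C_mul_le _ _).trans (natDegree_comp_le.trans ?_)
      rw [descPochhammer_natDegree]
      exact (Nat.mul_le_mul_left _ ((natDegree_C_mul_le _ _).trans natDegree_X_le)).trans (by simp)
    · rw [Finset.card_range]
      exact_mod_cast Nat.lt_succ_of_le hln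
  have hinj : Set.InjOn (fun i : ℕ => (i : ℂ)) (Finset.range (n + 1)) :=
    Nat.cast_injective.injOn
  have h := congrArg (fun q : ℂ[X] => q.coeff 1) (Lagrange.eq_interpolate hinj hdeg)
  simp only [Lagrange.interpolate_apply, finsetSum_coeff, coeff_C_mul, hp] at h
  simp only [mul_comm (Polynomial.coeff _ 1)]
  rw [← h, coeff_C_mul, comp_C_mul_X_coeff, coeff_one_descPochhammer, Nat.factorial_succ]
  have h1 : (l.factorial : ℂ) ≠ 0 := by exact_mod_cast Nat.factorial_ne_zero _
  have h2 : ((l : ℂ) + 1) ≠ 0 := by exact_mod_cast Nat.succ_ne_zero l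
  push_cast
  field_simp

end Interpolation

open MonoidAlgebra

theorem card_orderEmbedding_fin (A : Type*) [Fintype A] [LinearOrder A] (m : ℕ) :
    Nat.card (A ↪o Fin m) = m.choose (Fintype.card A) := by
  classical
  have := Fintype.ofInjective (fun g : A ↪o Fin m => (g : A → Fin m)) DFunLike.coe_injective
  rw [Nat.card_eq_fintype_card, ← Finset.card_univ]
  conv_rhs => rw [← Fintype.card_fin m, ← Finset.card_univ, ← Finset.card_powersetCard]
  refine Finset.card_bij (fun g _ => Finset.univ.map g.toEmbedding) ?_ ?_ ?_
  · intro g _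
    simp [Finset.mem_powersetCard]
  · intro g _ g' _ h
    rw [← OrderEmbedding.range_inj]
    have := congrArg (fun s : Finset (Fin m) => (s : Set (Fin m))) h
    simpa using this
  · intro s hs
    have hs' := (Finset.mem_powersetCard.1 hs).2
    refine ⟨(Fintype.orderIsoFinOfCardEq A rfl).symm.toOrderEmbedding.trans
      (s.orderEmbOfFin hs'), Finset.mem_univ _, ?_⟩
    ext i
    simp only [Finset.mem_map, Finset.mem_univ, true_and, RelEmbedding.coe_toEmbedding]
    rw [← Finset.mem_coe (s := s), ← Finset.range_orderEmbOfFin s hs']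
    exact ((Fintype.orderIsoFinOfCardEq A rfl).symm.surjective.exists
      (p := fun b => s.orderEmbOfFin hs' b = i)).symm

namespace SetComp

variable {n : ℕ} {L : Type*}

/-! ### Compositions from functions -/

/-- The composition of `[n]` whose blocks are the nonempty fibres of a function with values in a
linear order, in increasing order, with the given labels. -/
def ofFun {α : Type*} [LinearOrder α] (f : Fin n → α) (g : α → L) : SetComp n L where
  blocks := ((Finset.univ.image f).sort).map fun v => (Finset.univ.filter fun i => f i = v, g v)
  nonempty := by
    intro B hB
    obtain ⟨v, hv, rfl⟩ := List.mem_map.1 hB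
    obtain ⟨i, -, rfl⟩ := Finset.mem_image.1 ((Finset.mem_sort _).1 hv)
    exact ⟨i, by simp⟩
  disjoint := by
    rw [List.pairwise_map]
    refine (Finset.sort_nodup _ _).imp fun {v w} h => Finset.disjoint_left.2 fun i hi hi' => h ?_
    rw [Finset.mem_filter] at hi hi'
    exact hi.2.symm.trans hi'.2
  cover i := ⟨_, List.mem_map_of_mem ((Finset.mem_sort _).2
    (Finset.mem_image_of_mem f (Finset.mem_univ i))), by simp⟩

section ofFun

variable {α : Type*} [LinearOrder α] (f : Fin n → α) (g : α → L)

theorem pos_ofFun_le (i j : Fin n) : (ofFun f g).pos i ≤ (ofFun f g).pos j ↔ f i ≤ f j := by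
  refine pos_le_pos_iff (f := f) _ ?_ ?_ i j
  · refine List.pairwise_map.2 ((Finset.sortedLT_sort _).pairwise.imp fun {v w} h i hi j hj => ?_)
    rw [Finset.mem_filter] at hi hj
    rwa [hi.2, hj.2]
  · intro B hB i hi j hj
    obtain ⟨v, hv, rfl⟩ := List.mem_map.1 hB
    rw [Finset.mem_filter] at hi hj
    rw [hi.2, hj.2]

theorem pos_ofFun_eq (i j : Fin n) : (ofFun f g).pos i = (ofFun f g).pos j ↔ f i = f j := by
  rw [le_antisymm_iff, pos_ofFun_le, pos_ofFun_le, ← le_antisymm_iff]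

theorem pos_ofFun_lt (i j : Fin n) : (ofFun f g).pos i < (ofFun f g).pos j ↔ f i < f j := by
  rw [lt_iff_le_not_ge, pos_ofFun_le, pos_ofFun_le, ← lt_iff_le_not_ge]

theorem labAt_ofFun (i : Fin n) : (ofFun f g).labAt i = g (f i) :=
  labAt_of_mem (ofFun f g) (B := (Finset.univ.filter fun j => f j = f i, g (f i)))
    (List.mem_map_of_mem (f := fun v => (Finset.univ.filter fun i => f i = v, g v))
      ((Finset.mem_sort _).2 (Finset.mem_image_of_mem f (Finset.mem_univ i)))) (by simp)

end ofFun

/-- The set composition of the fibres of a function. -/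
abbrev fibres {α : Type*} [LinearOrder α] (f : Fin n → α) : SetComp n Unit := ofFun f fun _ => ()

/-! ### Blocks of a refinement -/

/-- The number of blocks of `t` which meet the `i`-th block of `s`. -/
noncomputable def count {M : Type*} (s : SetComp n L) (t : SetComp n M) (i : Fin s.length) : ℕ :=
  ((Finset.univ.filter fun a => s.pos a = i).image t.pos).card

theorem one_le_count {M : Type*} (s : SetComp n L) (t : SetComp n M) (i : Fin s.length) :
    1 ≤ s.count t i := by
  obtain ⟨a, ha⟩ := s.pos_surjective i
  exact Finset.card_pos.2 ⟨t.pos a, Finset.mem_image_of_mem _ (by simp [ha])⟩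

theorem count_le {M : Type*} (s : SetComp n L) (t : SetComp n M) (i : Fin s.length) :
    s.count t i ≤ n :=
  Finset.card_image_le.trans ((Finset.card_filter_le _ _).trans (by simp))

theorem count_self (s : SetComp n L) (i : Fin s.length) : s.count s i = 1 := by
  refine le_antisymm (Finset.card_le_one.2 ?_) (s.one_le_count s i)
  simp only [Finset.mem_image, Finset.mem_filter, Finset.mem_univ, true_and]
  rintro _ ⟨a, ha, rfl⟩ _ ⟨b, hb, rfl⟩
  rw [ha, hb]

theorem setPartition_le_of_mul_eq {x y : SetComp n Unit} (h : x * y = y) :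
    y.setPartition ≤ x.setPartition := by
  have := setPartition_mul_le_left x y
  rwa [h] at this

/-- For `y` refining `x`, the functions bounded by `m i` on the `i`-th block of `x` and whose fibres
refine `x` to `y` correspond to the choice, for each `i`, of as many values as there are blocks of
`y` in the `i`-th block of `x`. -/
theorem card_mul_fibres_eq {x y : SetComp n Unit} (h : x * y = y) (m : Fin x.length → ℕ) :
    Nat.card {f : (i : Fin n) → Fin (m (x.pos i)) // x * fibres (fun i => (f i : ℕ)) = y}
      = ∏ i, (m i).choose (x.count y i) := by
  classical
  have hxy : ∀ i j, y.pos i = y.pos j → x.pos i = x.pos j :=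
    setPartition_le_iff.1 (setPartition_le_of_mul_eq h)
  let r : Fin y.length → Fin n := Function.surjInv y.pos_surjective
  have hr : ∀ j, y.pos (r j) = j := Function.surjInv_eq y.pos_surjective
  let σ : Fin y.length → Fin x.length := fun j => x.pos (r j)
  have hσ : ∀ i, σ (y.pos i) = x.pos i := fun i => hxy _ _ (hr _)
  have hcard : ∀ i, Fintype.card {j // σ j = i} = x.count y i := by
    intro i
    rw [Fintype.card_subtype, count]
    congr 1
    ext j
    simp only [Finset.mem_filter, Finset.mem_univ, true_and, Finset.mem_image]
    constructor
    · intro hj; exact ⟨r j, hj, hr j⟩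
    · rintro ⟨a, ha, rfl⟩; rw [hσ, ha]
  have hle : ∀ f : (i : Fin n) → Fin (m (x.pos i)), x * fibres (fun i => (f i : ℕ)) = y ↔
      ∀ i j, x.pos i = x.pos j → ((f i : ℕ) ≤ f j ↔ y.pos i ≤ y.pos j) := by
    intro f
    have hy : ∀ i j, y.pos i ≤ y.pos j ↔
        x.pos i < x.pos j ∨ x.pos i = x.pos j ∧ y.pos i ≤ y.pos j := fun i j => by
      rw [← pos_mul_le, h]
    constructor
    · rintro hf i j hij
      have := pos_mul_le x (fibres fun i => (f i : ℕ)) i j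
      rw [hf, pos_ofFun_le] at this
      rw [this]
      simp [hij]
    · intro hf
      refine ext_pos (fun i j => ?_) fun _ => rfl
      rw [pos_mul_le, hy, pos_ofFun_le]
      exact or_congr_right (and_congr_right fun hij => hf i j hij)
  have hcongr : ∀ (g : (i : Fin x.length) → ({j // σ j = i} ↪o Fin (m i))) (i i' : Fin x.length)
      (j : Fin y.length) (h : σ j = i) (h' : σ j = i'), (g i ⟨j, h⟩ : ℕ) = g i' ⟨j, h'⟩ := by
    rintro g i _ j h rfl
    subst h
    rfl
  rw [← Finset.prod_congr rfl fun i _ => (card_orderEmbedding_fin {j // σ j = i} (m i)).trans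
    (by rw [hcard]), ← Nat.card_pi]
  symm
  refine Nat.card_eq_of_bijective (fun g => ⟨fun i => g (x.pos i) ⟨y.pos i, hσ i⟩, ?_⟩) ⟨?_, ?_⟩
  · rw [hle]
    intro i j hij
    rw [hcongr g _ (x.pos j) _ _ ((hσ i).trans hij), Fin.val_fin_le, (g _).le_iff_le,
      Subtype.mk_le_mk]
  · intro g g' hg
    funext i
    ext ⟨j, rfl⟩
    have := congrArg (fun f => (f.1 (r j) : ℕ)) hg
    simp only at this
    rw [hcongr g _ (σ j) _ _ (by rw [hr]), hcongr g' _ (σ j) _ _ (by rw [hr])] at this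
    simpa only [hr] using this
  · rintro ⟨f, hf⟩
    rw [hle] at hf
    have hfeq : ∀ i j, y.pos i = y.pos j → (f i : ℕ) = f j := fun i j hij =>
      le_antisymm ((hf i j (hxy i j hij)).2 hij.le) ((hf j i (hxy i j hij).symm).2 hij.ge)
    refine ⟨fun i => OrderEmbedding.ofMapLEIff
      (fun j => ⟨f (r j), (f (r j)).2.trans_eq (congrArg m j.2)⟩) ?_, ?_⟩
    · rintro ⟨j, hj⟩ ⟨j', hj'⟩
      rw [Fin.mk_le_mk, hf _ _ (hj.trans hj'.symm), hr, hr, Subtype.mk_le_mk]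
    · refine Subtype.ext (funext fun i => Fin.ext ?_)
      exact hfeq _ _ (hr _)

end SetComp

end Hsiao

namespace Hsiao

open MonoidAlgebra

variable {n : ℕ}

/-! ### The Eulerian eigenvalue argument -/

/-- The sum of the elements `H_{x f}` over the set compositions `f` given by functions whose values
on the `i`-th block of `x` are less than `m i`. -/
noncomputable def refinementSum (x : SetComp n Unit) (m : Fin x.length → ℕ) :
    MonoidAlgebra ℂ (SetComp n Unit) :=
  ∑ f : (i : Fin n) → Fin (m (x.pos i)), single (x * SetComp.fibres fun i => (f i : ℕ)) 1

/-- The sum of the elements `H_f` over the set compositions `f` given by functions with `M`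
values. -/
noncomputable def fibreSum (n M : ℕ) : MonoidAlgebra ℂ (SetComp n Unit) :=
  ∑ f : Fin n → Fin M, single (SetComp.fibres f) 1

open Classical in
/-- The coefficients of `refinementSum x m` are polynomials in `m`. -/
theorem refinementSum_eq (x : SetComp n Unit) (m : Fin x.length → ℕ) :
    refinementSum x m = ∑ y with x * y = y, (∏ i, ((m i).choose (x.count y i) : ℂ)) •
      single y (1 : ℂ) := by
  rw [refinementSum, ← Finset.sum_fiberwise Finset.univ
    fun f : (i : Fin n) → Fin (m (x.pos i)) => x * SetComp.fibres fun i => (f i : ℕ)]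
  rw [Finset.sum_filter]
  refine Finset.sum_congr rfl fun y _ => ?_
  have : ∀ f ∈ Finset.univ.filter fun f : (i : Fin n) → Fin (m (x.pos i)) =>
      x * SetComp.fibres (fun i => (f i : ℕ)) = y,
      single (x * SetComp.fibres fun i => (f i : ℕ)) (1 : ℂ) = single y 1 := by
    intro f hf
    rw [(Finset.mem_filter.1 hf).2]
  rw [Finset.sum_congr rfl this, Finset.sum_const, ← Nat.cast_smul_eq_nsmul ℂ]
  split_ifs with h
  · rw [← Nat.cast_prod, ← SetComp.card_mul_fibres_eq h, Nat.card_eq_fintype_card,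
      Fintype.card_subtype]
  · rw [Finset.filter_false_of_mem, Finset.card_empty, Nat.cast_zero, zero_smul]
    rintro f - rfl
    exact h (by rw [← mul_assoc, SetComp.mul_eq_left_of_le le_rfl])

/-- Two functions bounded by `m` and `M` combine into one function bounded by `m M`, which orders
lexicographically. -/
theorem refinementSum_mul_fibreSum (x : SetComp n Unit) (m : Fin x.length → ℕ) (M : ℕ) :
    refinementSum x m * fibreSum n M = refinementSum x fun i => m i * M := by
  rw [refinementSum, fibreSum, Finset.sum_mul_sum, ← Fintype.sum_prod_type', refinementSum]
  refine Fintype.sum_equiv ((Equiv.arrowProdEquivProdArrow (Fin n)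
    (fun i => Fin (m (x.pos i))) (fun _ => Fin M)).symm.trans
    (Equiv.piCongrRight fun i => finProdFinEquiv)) _ _ ?_
  rintro ⟨f, g⟩
  rw [single_mul_single, one_mul]
  refine congrArg (fun y => single y (1 : ℂ)) (SetComp.ext_pos (fun i j => ?_) fun _ => rfl)
  rw [mul_assoc, SetComp.pos_mul_le, SetComp.pos_mul_le x, SetComp.pos_mul_le,
    SetComp.pos_ofFun_le, SetComp.pos_ofFun_le, SetComp.pos_ofFun_eq, SetComp.pos_ofFun_lt]
  refine or_congr_right (and_congr_right fun hij => ?_)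
  simp only [Equiv.trans_apply, Equiv.piCongrRight_apply, Pi.map_apply,
    Equiv.arrowProdEquivProdArrow, Equiv.coe_fn_symm_mk, finProdFinEquiv_apply_val]
  have hi := (g i).2
  have hj := (g j).2
  rw [Fin.le_def]
  constructor
  · rintro (h | ⟨h, h'⟩)
    · have := Nat.mul_le_mul_left M (Nat.succ_le_of_lt h)
      rw [Nat.mul_succ] at this
      omega
    · rw [h]; omega
  · intro h
    rcases lt_trichotomy (f i : ℕ) (f j) with h' | h' | h'
    · exact Or.inl h'
    · rw [h'] at h
      exact Or.inr ⟨h', by omega⟩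
    · have := Nat.mul_le_mul_left M (Nat.succ_le_of_lt h')
      rw [Nat.mul_succ] at this
      omega

section Eigen

variable (Z : Finpartition (Finset.univ : Finset (Fin n)))

theorem SetComp.length_eq_of_setPartition_eq {Z : Finpartition (Finset.univ : Finset (Fin n))}
    {z : SetComp n Unit} (h : z.setPartition = Z) : z.length = Z.parts.card := by
  rw [← h, z.card_parts]

/-- The index of blocks, for an ordering of `Z`. -/
noncomputable def orderingPos (z : {z : SetComp n Unit // z.setPartition = Z}) (i : Fin n) :
    Fin Z.parts.card :=
  Fin.cast (SetComp.length_eq_of_setPartition_eq z.2) (z.1.pos i)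

variable {Z}

theorem orderingPos_surjective (z : {z : SetComp n Unit // z.setPartition = Z}) :
    Function.Surjective (orderingPos Z z) :=
  (finCongr (SetComp.length_eq_of_setPartition_eq z.2)).surjective.comp z.1.pos_surjective

/-- Reordering the blocks of an ordering of `Z` according to the values of a function on their
indices. -/
noncomputable def reorder {M : ℕ} (f : Fin Z.parts.card → Fin M)
    (z : {z : SetComp n Unit // z.setPartition = Z}) :
    {z : SetComp n Unit // z.setPartition = Z} :=
  ⟨SetComp.fibres (fun i => f (orderingPos Z z i)) * z.1, by
    rw [SetComp.setPartition_mul_of_ge, z.2]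
    rw [SetComp.setPartition_le_iff]
    intro i j hij
    rw [SetComp.pos_ofFun_eq, orderingPos, orderingPos, hij]⟩

theorem reorder_bijective {M : ℕ} (f : Fin Z.parts.card → Fin M) :
    Function.Bijective (reorder f : {z : SetComp n Unit // z.setPartition = Z} → _) := by
  rw [← Finite.injective_iff_bijective]
  intro z z' h
  -- `reorder f` replaces the order of the blocks by that of `θ`, and a finite linear order has no
  -- automorphism other than the identity
  let θ : Fin Z.parts.card → Fin M ×ₗ Fin Z.parts.card := fun a => toLex (f a, a)
  have hθ : Function.Injective θ := fun a b hab => (Prod.ext_iff.1 (toLex.injective hab)).2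
  have key : ∀ (z : {z : SetComp n Unit // z.setPartition = Z}) (i j : Fin n),
      (reorder f z).1.pos i ≤ (reorder f z).1.pos j ↔
        θ (orderingPos Z z i) ≤ θ (orderingPos Z z j) := by
    intro z i j
    rw [reorder, SetComp.pos_mul_le, Prod.Lex.toLex_le_toLex, SetComp.pos_ofFun_eq,
      SetComp.pos_ofFun_lt]
    rfl
  have hs : ∀ z : {z : SetComp n Unit // z.setPartition = Z},
      Function.Surjective fun i => Set.rangeFactorization θ (orderingPos Z z i) := fun z =>
    Set.rangeFactorization_surjective.comp (orderingPos_surjective z)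
  obtain ⟨e, he⟩ := exists_orderIso_of_le_iff_le (hs z) (hs z') fun i j => by
    have h1 := key z i j
    rw [h, key z' i j] at h1
    exact h1.symm
  have hsub : Subsingleton (Set.range θ ≃o Set.range θ) :=
    OrderIso.subsingleton_of_wellFoundedLT
  rw [Subsingleton.elim e (OrderIso.refl _)] at he
  have heq : ∀ i, orderingPos Z z i = orderingPos Z z' i := fun i =>
    hθ (congrArg Subtype.val (he i))
  refine Subtype.ext (SetComp.ext_pos (fun i j => ?_) fun _ => rfl)
  have := heq i
  have h2 := heq j
  simp only [orderingPos, Fin.ext_iff, Fin.val_cast] at this h2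
  rw [Fin.le_def, Fin.le_def, this, h2]

/-- The idempotent `e_Z` is an eigenvector of the Eulerian elements: summing over the orderings of
`Z` absorbs the reorderings of the blocks. -/
theorem fibreSum_mul_lrbIdem (M : ℕ) (Z : Finpartition (Finset.univ : Finset (Fin n))) :
    fibreSum n M * lrbIdem Z = (M : ℂ) ^ Z.parts.card • lrbIdem Z := by
  classical
  have hsub : ∑ z : SetComp n Unit with z.setPartition = Z, single z (1 : ℂ) =
      ∑ z : {z : SetComp n Unit // z.setPartition = Z}, single z.1 (1 : ℂ) :=
    Finset.sum_subtype _ (by simp) fun z => single z (1 : ℂ)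
  -- the functions which are not constant on the blocks of `Z` do not contribute
  have hz : ∀ z : {z : SetComp n Unit // z.setPartition = Z},
      fibreSum n M * single z.1 1 * lrbIdem Z =
        ∑ f : Fin Z.parts.card → Fin M, single (reorder f z).1 (1 : ℂ) * lrbIdem Z := by
    intro z
    rw [fibreSum, Finset.sum_mul, Finset.sum_mul]
    simp only [single_mul_single, one_mul]
    have hinj : Function.Injective fun (f : Fin Z.parts.card → Fin M) (i : Fin n) =>
        f (orderingPos Z z i) := (orderingPos_surjective z).injective_comp_right
    refine Eq.trans ?_ (Finset.sum_image (s := Finset.univ)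
      (f := fun f : Fin n → Fin M => single (SetComp.fibres f * z.1) (1 : ℂ) * lrbIdem Z)
      hinj.injOn)
    symm
    refine Finset.sum_subset (Finset.subset_univ _) fun f _ hf => ?_
    refine single_mul_lrbIdem_eq_zero fun hZ => hf ?_
    have hc : ∀ i j, orderingPos Z z i = orderingPos Z z j → f i = f j := by
      intro i j hij
      have := SetComp.setPartition_le_iff.1 (SetComp.le_setPartition_mul.1 (z.2.trans_le hZ)).1 i j
        (by simpa [orderingPos] using hij)
      rwa [SetComp.pos_ofFun_eq] at this
    refine Finset.mem_image.2
      ⟨fun a => f (Function.surjInv (orderingPos_surjective z) a), Finset.mem_univ _, ?_⟩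
    funext i
    exact hc _ _ (Function.surjInv_eq (orderingPos_surjective z) _)
  conv_lhs => rw [← uniformSection_mul_lrbIdem Z, ← mul_assoc]
  conv_rhs => rw [← uniformSection_mul_lrbIdem Z]
  rw [uniformSection, hsub, mul_smul_comm, smul_mul_assoc, smul_mul_assoc, smul_comm,
    Finset.mul_sum, Finset.sum_mul, Finset.sum_congr rfl fun z _ => hz z, Finset.sum_comm]
  congr 1
  rw [Finset.sum_congr rfl fun f _ => (reorder_bijective f).sum_comp
    fun z : {z : SetComp n Unit // z.setPartition = Z} => single z.1 (1 : ℂ) * lrbIdem Z,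
    Finset.sum_const, ← Finset.sum_mul, ← Nat.cast_smul_eq_nsmul ℂ]
  simp

end Eigen

/-- A refinement with as many blocks is not strict. -/
theorem SetComp.setPartition_eq_of_le_of_length_le {x y : SetComp n Unit}
    (h : y.setPartition ≤ x.setPartition) (hl : y.length ≤ x.length) :
    y.setPartition = x.setPartition := by
  rw [SetComp.setPartition_le_iff] at h
  have hsurj : Function.Surjective fun j => x.pos (Function.surjInv y.pos_surjective j) := by
    intro a
    obtain ⟨i, rfl⟩ := x.pos_surjective a
    exact ⟨y.pos i, h _ _ (Function.surjInv_eq _ _)⟩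
  have hinj := ((Fintype.bijective_iff_surjective_and_card _).2
    ⟨hsurj, by
      simpa using le_antisymm hl (by simpa using Fintype.card_le_of_surjective _ hsurj)⟩).1
  refine SetComp.setPartition_eq_iff.2 fun i j => ⟨h i j, fun hij => hinj ?_⟩
  change x.pos _ = x.pos _
  rw [h _ i (Function.surjInv_eq _ _), h _ j (Function.surjInv_eq _ _), hij]

/-- The coefficient of `H_y` in `Q_x`, for `y` refining `x`. -/
noncomputable def refineCoeff (x y : SetComp n Unit) : ℂ :=
  ∏ i, (-1) ^ (x.count y i - 1) / (x.count y i : ℂ)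

open Classical in
/-- The basis elements `Q_x` for the uniform section. The right-hand side is the coefficient of
`∏ mᵢ` in the polynomial `m ↦ refinementSum x m`, hence an eigenvector of the right multiplication
by `fibreSum n 2`, with eigenvalue `2 ^ length x`; since the `e_Z` are eigenvectors of the left
multiplication, only `Z = supp x` contributes to its product with `1 = ∑ e_Z`. -/
theorem lrbQ_eq (x : SetComp n Unit) :
    lrbQ x = ∑ y with x * y = y, refineCoeff x y • single y (1 : ℂ) := by
  obtain ⟨a, ha⟩ := exists_linear_coeff_weights n
  set R := ∑ y with x * y = y, refineCoeff x y • single y (1 : ℂ) with hR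
  have h1 : ∀ M : ℕ, ∑ m : Fin x.length → Fin (n + 1), (∏ i, a (m i)) •
      refinementSum x (fun i => (m i : ℕ) * M) = (M : ℂ) ^ x.length • R := by
    intro M
    simp only [refinementSum_eq, Finset.smul_sum, smul_smul, hR]
    rw [Finset.sum_comm]
    refine Finset.sum_congr rfl fun y _ => ?_
    rw [← Finset.sum_smul]
    congr 1
    -- the weights extract the linear coefficient in each of the variables
    simp only [← Finset.prod_mul_distrib]
    have := Finset.prod_univ_sum (fun _ : Fin x.length => (Finset.univ : Finset (Fin (n + 1))))
      fun i m => a m * (((m : ℕ) * M).choose (x.count y i) : ℂ)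
    rw [Fintype.piFinset_univ] at this
    rw [← this]
    have hM : (M : ℂ) ^ x.length = ∏ _i : Fin x.length, (M : ℂ) := by simp
    rw [hM, refineCoeff, ← Finset.prod_mul_distrib]
    refine Finset.prod_congr rfl fun i _ => ?_
    rw [← ha _ (x.one_le_count y i) (x.count_le y i), ← Fin.sum_univ_eq_sum_range
      (fun m => a m * ((m * M).choose (x.count y i) : ℂ))]
  have h2 : R * fibreSum n 2 = (2 : ℂ) ^ x.length • R := by
    have h3 := h1 1
    rw [Nat.cast_one, one_pow, one_smul] at h3
    rw [← h3, Finset.sum_mul, h3]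
    have h4 := h1 2
    rw [Nat.cast_two] at h4
    rw [← h4]
    refine Finset.sum_congr rfl fun m _ => ?_
    rw [smul_mul_assoc, refinementSum_mul_fibreSum]
    simp only [mul_one]
  have h3 : ∀ Z, Z ≠ x.setPartition → R * lrbIdem Z = 0 := by
    intro Z hZ
    by_cases hZx : Z ≤ x.setPartition
    -- the eigenvalues `2 ^ length x` and `2 ^ length z` are distinct
    · have h4 : (2 : ℂ) ^ x.length • (R * lrbIdem Z) =
          (2 : ℂ) ^ Z.parts.card • (R * lrbIdem Z) := by
        rw [← smul_mul_assoc, ← h2, mul_assoc, fibreSum_mul_lrbIdem, mul_smul_comm,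
          Nat.cast_ofNat]
      obtain ⟨z, rfl⟩ := SetComp.exists_setPartition_eq Z
      rw [z.card_parts] at h4
      have h5 : x.length < z.length := by
        by_contra hc
        exact hZ (SetComp.setPartition_eq_of_le_of_length_le hZx (not_lt.1 hc))
      rw [← sub_eq_zero, ← sub_smul, smul_eq_zero] at h4
      refine h4.resolve_left (sub_ne_zero.2 fun h => h5.ne ?_)
      have : (2 : ℕ) ^ x.length = 2 ^ z.length := by exact_mod_cast h
      exact Nat.pow_right_injective le_rfl this
    · rw [hR, Finset.sum_mul]
      refine Finset.sum_eq_zero fun y hy => ?_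
      rw [smul_mul_assoc, single_mul_lrbIdem_eq_zero, smul_zero]
      exact fun h => hZx (h.trans (SetComp.setPartition_le_of_mul_eq (Finset.mem_filter.1 hy).2))
  have h4 : R * lrbIdem x.setPartition = lrbQ x := by
    rw [hR, Finset.sum_mul, Finset.sum_eq_single_of_mem x]
    · simp [refineCoeff, SetComp.count_self, lrbQ]
    · exact Finset.mem_filter.2 ⟨Finset.mem_univ _, SetComp.mul_eq_left_of_le le_rfl⟩
    · intro y hy hne
      rw [smul_mul_assoc, single_mul_lrbIdem_eq_zero, smul_zero]
      intro h
      exact hne ((Finset.mem_filter.1 hy).2.symm.trans (SetComp.mul_eq_left_of_le h))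
  rw [← h4, ← Finset.sum_eq_single_of_mem (f := fun Z => R * lrbIdem Z) x.setPartition
    (Finset.mem_univ _) (fun Z _ hZ => h3 Z hZ), ← Finset.mul_sum, sum_lrbIdem, mul_one]

end Hsiao

namespace Hsiao

open MonoidAlgebra

/-! ### Orthogonality of characters -/

section Characters

variable {G : Type*} [CommGroup G]

theorem conj_dual_apply [Finite G] (χ : Dual G) (g : G) :
    starRingEnd ℂ (χ g : ℂ) = ((χ g)⁻¹ : ℂˣ) := by
  have h : ((χ g : ℂˣ) : ℂ) ^ Nat.card G = 1 := by
    rw [← Units.val_pow_eq_pow_val, ← map_pow, pow_card_eq_one', map_one, Units.val_one]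
  have := Complex.norm_eq_one_of_pow_eq_one h Nat.card_pos.ne'
  rw [Units.val_inv_eq_inv_val, Complex.inv_eq_conj this]

open Classical in
theorem sum_conj_mul_dual [Finite G] [Fintype G] (χ ψ : Dual G) :
    ∑ g : G, starRingEnd ℂ (χ g : ℂ) * (ψ g : ℂ) = if χ = ψ then (Nat.card G : ℂ) else 0 := by
  have h := sum_hom_units ((Units.coeHom ℂ).comp (χ⁻¹ * ψ))
  have h1 : (Units.coeHom ℂ).comp (χ⁻¹ * ψ) = 1 ↔ χ = ψ := by
    rw [← inv_mul_eq_one (a := χ)]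
    constructor
    · intro h'
      ext g
      simpa using DFunLike.congr_fun h' g
    · intro h'
      rw [h']
      ext g
      simp
  simp only [h1] at h
  rw [Nat.card_eq_fintype_card, ← Nat.cast_zero (R := ℂ), ← Nat.cast_ite, ← h]
  refine Finset.sum_congr rfl fun g _ => ?_
  rw [conj_dual_apply]
  simp

open Classical in
theorem sum_dual_mul_conj [Finite G] [Fintype (Dual G)] (g h : G) :
    ∑ χ : Dual G, (χ h : ℂ) * starRingEnd ℂ (χ g : ℂ) =
      if h = g then (Nat.card G : ℂ) else 0 := by
  have hterm : ∀ χ : Dual G, (χ h : ℂ) * starRingEnd ℂ (χ g : ℂ) = (χ (h * g⁻¹) : ℂ) := fun χ => by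
    rw [conj_dual_apply, map_mul, map_inv, Units.val_mul]
  simp only [hterm]
  split_ifs with hgh
  · subst hgh
    simp only [mul_inv_cancel, map_one, Units.val_one, Finset.sum_const, Finset.card_univ,
      nsmul_eq_mul, mul_one]
    rw [← CommGroup.card_monoidHom_of_hasEnoughRootsOfUnity G ℂ, Nat.card_eq_fintype_card]
  · obtain ⟨ψ, hψ⟩ := CommGroup.exists_apply_ne_one_of_hasEnoughRootsOfUnity G ℂ
      (a := h * g⁻¹) (by rwa [Ne, mul_inv_eq_one])
    have key : (ψ (h * g⁻¹) : ℂ) * ∑ χ : Dual G, (χ (h * g⁻¹) : ℂ) =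
        ∑ χ : Dual G, (χ (h * g⁻¹) : ℂ) := by
      rw [Finset.mul_sum]
      refine Fintype.sum_equiv (Equiv.mulLeft ψ) _ _ fun χ => ?_
      simp
    by_contra hne
    refine hψ (Units.ext ?_)
    rw [Units.val_one]
    exact mul_right_cancel₀ hne (key.trans (one_mul _).symm)

variable {J : Type*} [Fintype J]

/-- The value of a tuple of characters at a tuple of group elements. -/
noncomputable def tupleEval (f : J → Dual G) (g : J → G) : ℂ := ∏ j, (f j (g j) : ℂ)

theorem tupleEval_mul (f : J → Dual G) (g h : J → G) :
    tupleEval f (g * h) = tupleEval f g * tupleEval f h := by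
  simp [tupleEval, Finset.prod_mul_distrib]

theorem conj_tupleEval_mul_self [Finite G] (f : J → Dual G) (g : J → G) :
    starRingEnd ℂ (tupleEval f g) * tupleEval f g = 1 := by
  rw [tupleEval, map_prod, ← Finset.prod_mul_distrib]
  refine Finset.prod_eq_one fun j _ => ?_
  rw [conj_dual_apply, ← Units.val_mul, inv_mul_cancel, Units.val_one]

theorem prod_ite_eq_of_forall {J : Type*} [Fintype J] {α : J → Prop} [DecidablePred α]
    [Decidable (∀ j, α j)] (c : ℂ) :
    ∏ j, (if α j then c else 0) = if ∀ j, α j then c ^ Fintype.card J else 0 := by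
  split_ifs with h
  · simp [h]
  · push Not at h
    obtain ⟨j, hj⟩ := h
    exact Finset.prod_eq_zero (Finset.mem_univ j) (if_neg hj)

open Classical in
theorem sum_conj_mul_tupleEval [DecidableEq J] [Finite G] [Fintype G] (f f' : J → Dual G) :
    ∑ g : J → G, starRingEnd ℂ (tupleEval f g) * tupleEval f' g =
      if f = f' then (Nat.card G : ℂ) ^ Fintype.card J else 0 := by
  have := Finset.prod_univ_sum (fun _ : J => (Finset.univ : Finset G))
    fun j g => starRingEnd ℂ (f j g : ℂ) * (f' j g : ℂ)
  rw [Fintype.piFinset_univ] at this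
  simp only [tupleEval, map_prod, ← Finset.prod_mul_distrib]
  rw [← this]
  simp only [sum_conj_mul_dual]
  rw [prod_ite_eq_of_forall]
  simp only [funext_iff]

open Classical in
theorem sum_tupleEval_mul_conj [DecidableEq J] [Finite G] [Fintype (Dual G)] (g h : J → G) :
    ∑ f : J → Dual G, tupleEval f h * starRingEnd ℂ (tupleEval f g) =
      if h = g then (Nat.card G : ℂ) ^ Fintype.card J else 0 := by
  have := Finset.prod_univ_sum (fun _ : J => (Finset.univ : Finset (Dual G)))
    fun j χ => (χ (h j) : ℂ) * starRingEnd ℂ (χ (g j) : ℂ)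
  rw [Fintype.piFinset_univ] at this
  simp only [tupleEval, map_prod, ← Finset.prod_mul_distrib]
  rw [← this]
  simp only [sum_dual_mul_conj]
  rw [prod_ite_eq_of_forall]
  simp only [funext_iff]

end Characters

namespace SetComp

variable {n : ℕ} {K L M : Type*}

/-! ### Labellings of a set composition -/

/-- The label of the `j`-th block. -/
def lab (s : SetComp n L) (j : Fin s.length) : L := (s.blocks.get j).2

theorem lab_pos (s : SetComp n L) (i : Fin n) : s.lab (s.pos i) = s.labAt i := rfl

/-- The composition with the same blocks as `x` and labels `g`. -/
noncomputable abbrev withLabels (x : SetComp n K) (g : Fin x.length → L) : SetComp n L :=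
  ofFun x.pos g

theorem under_withLabels (x : SetComp n K) (g : Fin x.length → L) :
    (x.withLabels g).under = x.under := under_eq_iff.2 (pos_ofFun_le _ _)

theorem withLabels_injective (x : SetComp n K) :
    Function.Injective (x.withLabels : (Fin x.length → L) → SetComp n L) := by
  intro g g' h
  funext j
  obtain ⟨i, rfl⟩ := x.pos_surjective j
  rw [← labAt_ofFun x.pos g, ← labAt_ofFun x.pos g']
  exact congrArg (fun s => labAt s i) h

theorem exists_eq_withLabels {x : SetComp n K} {s : SetComp n L} (h : s.under = x.under) :
    ∃ g, s = x.withLabels g := by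
  have hp := under_eq_iff.1 h
  refine ⟨fun j => s.labAt (Function.surjInv x.pos_surjective j),
    eq_of_under_eq (h.trans (under_withLabels _ _).symm) fun i => ?_⟩
  rw [labAt_ofFun]
  refine labAt_eq_of_pos_eq _ ((pos_eq_pos_iff_of_le hp _ _).2 ?_)
  exact (Function.surjInv_eq x.pos_surjective _).symm

theorem withLabels_lab (s : SetComp n L) : s.withLabels s.lab = s :=
  eq_of_under_eq (under_withLabels _ _) fun i => by rw [labAt_ofFun, lab_pos]

open Classical in
/-- The compositions with the same blocks as `x` are parametrized by the tuples of labels. -/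
theorem sum_under_eq [Finite L] [Fintype L] {A : Type*} [AddCommMonoid A] (x : SetComp n K)
    (F : SetComp n L → A) :
    ∑ s with s.under = x.under, F s = ∑ g : Fin x.length → L, F (x.withLabels g) := by
  symm
  refine Finset.sum_bij (fun g _ => x.withLabels g) ?_ ?_ ?_ fun _ _ => rfl
  · intro g _
    exact Finset.mem_filter.2 ⟨Finset.mem_univ _, under_withLabels x g⟩
  · intro g _ g' _ h
    exact x.withLabels_injective h
  · intro s hs
    obtain ⟨g, rfl⟩ := exists_eq_withLabels (Finset.mem_filter.1 hs).2
    exact ⟨g, Finset.mem_univ _, rfl⟩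

theorem withLabels_mul [Monoid L] (x : SetComp n K) (g h : Fin x.length → L) :
    x.withLabels g * x.withLabels h = x.withLabels (h * g) := by
  refine eq_of_under_eq ?_ fun i => ?_
  · rw [under_mul, under_withLabels, under_withLabels, under_withLabels,
      mul_eq_left_of_le le_rfl]
  · simp [labAt_mul, labAt_ofFun]

theorem withLabels_one (x : SetComp n K) [Monoid L] :
    x.withLabels (1 : Fin x.length → L) = ofUnit L x.under :=
  eq_of_under_eq (by rw [under_withLabels, under_ofUnit]) fun i => by
    rw [labAt_ofFun, labAt_ofUnit, Pi.one_apply]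

/-! ### Evaluations -/

section eval

variable {G : Type*} [CommGroup G]

theorem eval_withLabels (x : SetComp n K) (f : Fin x.length → Dual G) (g : Fin x.length → G) :
    (((x.withLabels f).eval (x.withLabels g) : ℂˣ) : ℂ) = tupleEval f g := by
  have h1 : (x.withLabels f).eval (x.withLabels g) =
      (((Finset.univ.image x.pos).sort).map fun j => f j (g j)).prod := by
    simp [eval, evalLabels, ofFun, List.zipWith_map, List.zipWith_self]
  rw [h1, ← List.prod_toFinset _ (Finset.sort_nodup _ _), Finset.sort_toFinset,
    Finset.image_univ_of_surjective x.pos_surjective,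
    tupleEval, Units.coe_prod]

theorem eval_pair (z : SetComp n (Dual G × G)) :
    (z.relabel Prod.fst).eval (z.relabel Prod.snd) =
      (z.blocks.map fun B => B.2.1 B.2.2).prod := by
  simp [eval, evalLabels, relabel, List.zipWith_map, List.zipWith_self]

/-- Two compositions with the same blocks come from one composition labelled by pairs. -/
theorem exists_pair {φ : SetComp n K} {s : SetComp n L} (h : φ.under = s.under) :
    ∃ z : SetComp n (K × L), z.relabel Prod.fst = φ ∧ z.relabel Prod.snd = s := by
  obtain ⟨g, rfl⟩ := exists_eq_withLabels h.symm
  refine ⟨φ.withLabels fun j => (φ.lab j, g j), ?_, ?_⟩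
  · refine eq_of_under_eq (by rw [under_relabel, under_withLabels]) fun i => ?_
    rw [labAt_relabel, labAt_ofFun, lab_pos]
  · refine eq_of_under_eq (by rw [under_relabel, under_withLabels, under_withLabels]) fun i => ?_
    rw [labAt_relabel, labAt_ofFun, labAt_ofFun]

theorem relabel_ofUnit_mul [Monoid L] [Monoid M] (f : L →* M) (y : SetComp n Unit)
    (s : SetComp n L) : (ofUnit L y * s).relabel f = ofUnit M y * s.relabel f := by
  refine ((relabelHom f).map_mul _ _).trans (congrArg (· * _) ?_)
  refine SetComp.ext ?_
  simp [relabelHom, ofUnit, relabel, Function.comp_def]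

theorem perm_ofUnit_mul [Monoid L] {y : SetComp n Unit} {s : SetComp n L}
    (h : s.setPartition ≤ y.setPartition) : (ofUnit L y * s).blocks.Perm s.blocks := by
  refine perm_blocks_iff.2 ⟨setPartition_mul_of_ge (by rwa [setPartition_ofUnit]), fun i => ?_⟩
  rw [labAt_mul, labAt_ofUnit, mul_one]

/-- Reordering the blocks of `φ` and `s` simultaneously does not change `φ(s)`. -/
theorem eval_ofUnit_mul {φ : SetComp n (Dual G)} {s : SetComp n G} {y : SetComp n Unit}
    (h : φ.under = s.under) (hy : φ.setPartition ≤ y.setPartition) :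
    (ofUnit (Dual G) y * φ).eval (ofUnit G y * s) = φ.eval s := by
  obtain ⟨z, rfl, rfl⟩ := exists_pair h
  have h1 := relabel_ofUnit_mul (MonoidHom.fst (Dual G) G) y z
  have h2 := relabel_ofUnit_mul (MonoidHom.snd (Dual G) G) y z
  simp only [MonoidHom.coe_fst, MonoidHom.coe_snd] at h1 h2
  rw [← h1, ← h2, eval_pair, eval_pair]
  rw [setPartition_relabel] at hy
  exact ((perm_ofUnit_mul hy).map _).prod_eq

end eval

end SetComp

end Hsiao

namespace Hsiao

open MonoidAlgebra SetComp

variable {G : Type*} [CommGroup G] {n : ℕ}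

/-! ### The isotypic projectors -/

theorem incl_single (x : SetComp n Unit) (c : ℂ) :
    incl G n (single x c) = single (ofUnit G x) c := by
  simp [incl, ofUnit_eq]

section Finite

variable [Finite G]

theorem natCard_ne_zero : (Nat.card G : ℂ) ≠ 0 := by exact_mod_cast Nat.card_pos.ne'

open Classical in
theorem card_filter_under (φ : SetComp n (Dual G)) :
    (Finset.univ.filter fun s : SetComp n G => s.under = φ.under).card =
      Nat.card G ^ φ.length := by
  have := Fintype.ofFinite G
  have h := sum_under_eq φ fun _ : SetComp n G => 1
  rw [Finset.sum_const, Finset.sum_const, smul_eq_mul, smul_eq_mul, mul_one, mul_one] at h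
  rw [h]
  simp [Nat.card_eq_fintype_card]

theorem isoE_withLabels {K : Type*} [Fintype G] (x : SetComp n K)
    (f : Fin x.length → Dual G) :
    isoE (x.withLabels f) = ((Nat.card G : ℂ) ^ x.length)⁻¹ • ∑ g : Fin x.length → G,
      single (x.withLabels g) (starRingEnd ℂ (tupleEval f g)) := by
  have hl : (x.withLabels f).length = x.length := by
    rw [← length_under, under_withLabels, length_under]
  rw [isoE, card_filter_under, Nat.cast_pow, hl, under_withLabels]
  have h := sum_under_eq x fun s : SetComp n G =>
    (single s (starRingEnd ℂ ((x.withLabels f).eval s : ℂ)) : MonoidAlgebra ℂ (SetComp n G))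
  simp only [eval_withLabels] at h
  rw [← h]

theorem isoE_withLabels_mul_single {K : Type*} (x : SetComp n K) (f : Fin x.length → Dual G)
    (g : Fin x.length → G) :
    isoE (x.withLabels f) * single (x.withLabels g) 1 = tupleEval f g • isoE (x.withLabels f) := by
  have := Fintype.ofFinite G
  rw [isoE_withLabels, smul_mul_assoc, smul_comm]
  congr 1
  rw [Finset.sum_mul, Finset.smul_sum]
  refine Fintype.sum_equiv (Equiv.mulLeft g) _ _ fun h => ?_
  rw [single_mul_single, withLabels_mul, smul_single, mul_one, Equiv.coe_mulLeft, smul_eq_mul,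
    tupleEval_mul, map_mul, ← mul_assoc, mul_comm (tupleEval f g), conj_tupleEval_mul_self,
    one_mul]

theorem single_mul_isoE_withLabels {K : Type*} (x : SetComp n K) (f : Fin x.length → Dual G)
    (g : Fin x.length → G) :
    single (x.withLabels g) 1 * isoE (x.withLabels f) = tupleEval f g • isoE (x.withLabels f) := by
  have := Fintype.ofFinite G
  rw [← isoE_withLabels_mul_single, isoE_withLabels, smul_mul_assoc, mul_smul_comm,
    Finset.sum_mul, Finset.mul_sum]
  simp only [single_mul_single, withLabels_mul, mul_one, one_mul, mul_comm g]

open Classical in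
theorem isoE_withLabels_mul_isoE {K : Type*} (x : SetComp n K) (f f' : Fin x.length → Dual G) :
    isoE (x.withLabels f) * isoE (x.withLabels f') =
      if f = f' then isoE (x.withLabels f) else 0 := by
  have := Fintype.ofFinite G
  have h : ∀ g : Fin x.length → G, single (x.withLabels g) (starRingEnd ℂ (tupleEval f g)) *
      isoE (x.withLabels f') = (starRingEnd ℂ (tupleEval f g) * tupleEval f' g) •
        isoE (x.withLabels f') := by
    intro g
    rw [mul_smul, ← single_mul_isoE_withLabels, ← smul_mul_assoc, smul_single, smul_eq_mul,
      mul_one]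
  conv_lhs => enter [1]; rw [isoE_withLabels]
  rw [smul_mul_assoc, Finset.sum_mul, Finset.sum_congr rfl fun g _ => h g, ← Finset.sum_smul,
    sum_conj_mul_tupleEval, smul_smul, Fintype.card_fin]
  split_ifs with hf
  · rw [hf, inv_mul_cancel₀ (pow_ne_zero _ natCard_ne_zero), one_smul]
  · simp

open Classical in
theorem isoE_mul_isoE_of_under_eq {φ ψ : SetComp n (Dual G)} (h : φ.under = ψ.under) :
    isoE φ * isoE ψ = if φ = ψ then isoE φ else 0 := by
  obtain ⟨f, hf⟩ := exists_eq_withLabels h.symm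
  rw [hf]
  conv_lhs => enter [1]; rw [← φ.withLabels_lab]
  rw [isoE_withLabels_mul_isoE]
  have : φ = φ.withLabels f ↔ φ.lab = f := by
    conv_lhs => enter [1]; rw [← φ.withLabels_lab]
    exact (withLabels_injective φ).eq_iff
  simp only [this]
  rw [withLabels_lab]

open Classical in
/-- The isotypic projectors of the maximal subgroup at `x` add up to its unit `H_x`. -/
theorem sum_isoE_under (x : SetComp n Unit) :
    ∑ φ : SetComp n (Dual G) with φ.under = x, isoE φ = single (ofUnit G x) 1 := by
  have := Fintype.ofFinite G
  have := Fintype.ofFinite (Dual G)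
  conv_lhs => rw [← under_unit x]
  rw [sum_under_eq]
  simp only [isoE_withLabels]
  rw [← Finset.smul_sum, Finset.sum_comm]
  have h : ∀ g : Fin x.length → G, ∑ f : Fin x.length → Dual G,
      single (x.withLabels g) (starRingEnd ℂ (tupleEval f g)) =
        if 1 = g then (Nat.card G : ℂ) ^ x.length • single (x.withLabels g) 1 else 0 := by
    intro g
    have h1 : ∀ f : Fin x.length → Dual G, tupleEval f 1 = 1 := fun f => by simp [tupleEval]
    have h2 := sum_tupleEval_mul_conj (J := Fin x.length) g 1
    simp only [h1, one_mul, Fintype.card_fin] at h2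
    have h3 : ∀ f : Fin x.length → Dual G,
        single (x.withLabels g) (starRingEnd ℂ (tupleEval f g)) =
          starRingEnd ℂ (tupleEval f g) • single (x.withLabels g) (1 : ℂ) := fun f => by
      rw [smul_single, smul_eq_mul, mul_one]
    rw [Finset.sum_congr rfl fun f _ => h3 f, ← Finset.sum_smul, h2]
    split_ifs <;> simp
  rw [Finset.sum_congr rfl fun g _ => h g]
  simp only [Finset.sum_ite_eq, Finset.mem_univ, if_true]
  rw [smul_smul, inv_mul_cancel₀ (pow_ne_zero _ natCard_ne_zero), one_smul, withLabels_one,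
    under_unit]

/-- The multiplication by `H_y` reorders the blocks of `E_φ`, if `φ` refines `y`. -/
theorem single_mul_isoE {φ : SetComp n (Dual G)} {y : SetComp n Unit}
    (h : φ.setPartition ≤ y.setPartition) :
    single (ofUnit G y) 1 * isoE φ = isoE (ofUnit (Dual G) y * φ) := by
  classical
  have hc : ((Finset.univ.filter fun s : SetComp n G => s.under = φ.under).card : ℂ) =
      (Finset.univ.filter fun s : SetComp n G =>
        s.under = (ofUnit (Dual G) y * φ).under).card := by
    rw [card_filter_under, card_filter_under, ← card_parts, ← card_parts,
      setPartition_mul_of_ge (by rwa [setPartition_ofUnit])]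
  have hs : ∀ s : SetComp n G, s.under = φ.under → s.setPartition ≤ y.setPartition :=
    fun s hs => by rwa [setPartition_eq_of_under_eq hs]
  rw [isoE, isoE, hc, mul_smul_comm, Finset.mul_sum]
  congr 1
  refine Finset.sum_bij' (fun s _ => ofUnit G y * s) (fun t _ => ofUnit G φ.under * t)
    ?_ ?_ ?_ ?_ ?_
  · intro s hs
    rw [Finset.mem_filter] at hs ⊢
    rw [under_mul, under_mul, under_ofUnit, under_ofUnit, hs.2]
    exact ⟨Finset.mem_univ _, rfl⟩
  · intro t ht
    rw [Finset.mem_filter] at ht ⊢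
    refine ⟨Finset.mem_univ _, ?_⟩
    rw [under_mul_of_le, under_ofUnit]
    rw [setPartition_ofUnit, setPartition_under, setPartition_eq_of_under_eq ht.2,
      setPartition_mul_of_ge (by rwa [setPartition_ofUnit])]
  · intro s hs'
    have hs' := (Finset.mem_filter.1 hs').2
    refine eq_of_under_eq ?_ fun i => by simp [labAt_mul, labAt_ofUnit]
    rw [under_mul_of_le, under_ofUnit, hs']
    rw [setPartition_ofUnit, setPartition_under,
      setPartition_mul_of_ge (by rw [setPartition_ofUnit]; exact hs s hs'),
      setPartition_eq_of_under_eq hs']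
  · intro t ht
    have ht := (Finset.mem_filter.1 ht).2
    refine eq_of_under_eq ?_ fun i => by simp [labAt_mul, labAt_ofUnit]
    rw [ht, under_mul, under_mul, under_ofUnit, under_ofUnit, ht, under_mul, under_ofUnit,
      ← mul_assoc φ.under, ← mul_assoc, mul_eq_left_of_le (x := φ.under) (y := y)
        (by rwa [setPartition_under]), mul_assoc, mul_eq_left_of_le le_rfl]
  · intro s hs
    rw [single_mul_single, one_mul, eval_ofUnit_mul (Finset.mem_filter.1 hs).2.symm h]

theorem isoE_mul_single_ofUnit {φ : SetComp n (Dual G)} {x : SetComp n Unit}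
    (h : φ.setPartition ≤ x.setPartition) : isoE φ * single (ofUnit G x) 1 = isoE φ := by
  classical
  rw [isoE, smul_mul_assoc, Finset.sum_mul]
  refine congrArg _ (Finset.sum_congr rfl fun s hs => ?_)
  rw [single_mul_single, mul_one, mul_ofUnit_of_le]
  rwa [setPartition_eq_of_under_eq (Finset.mem_filter.1 hs).2]

theorem isoE_mul_uniformSection (φ : SetComp n (Dual G)) :
    isoE φ * incl G n (uniformSection φ.setPartition) = isoE φ :=
  mul_uniformSection_eq _ fun x hx => by rw [incl_single, isoE_mul_single_ofUnit hx.ge]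

open Classical in
/-- The isotypic projectors of two compositions with the same underlying set partition are
orthogonal, unless the labelled partitions agree. -/
theorem isoE_mul_isoE {φ ψ : SetComp n (Dual G)} (h : φ.setPartition = ψ.setPartition) :
    isoE φ * isoE ψ = if φ.blocks.Perm ψ.blocks then isoE φ else 0 := by
  rw [← isoE_mul_single_ofUnit (setPartition_under φ).ge, mul_assoc,
    single_mul_isoE (by rw [setPartition_under, h]), isoE_mul_isoE_of_under_eq]
  · have : φ = ofUnit (Dual G) φ.under * ψ ↔ φ.blocks.Perm ψ.blocks := by
      rw [perm_blocks_iff]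
      constructor
      · intro h'
        refine ⟨h, fun i => ?_⟩
        rw [h', labAt_mul, labAt_ofUnit, mul_one]
      · rintro ⟨-, h'⟩
        refine eq_of_under_eq ?_ fun i => ?_
        · rw [under_mul_of_le, under_ofUnit]
          rw [setPartition_ofUnit, setPartition_under, h]
        · rw [labAt_mul, labAt_ofUnit, mul_one, h']
    simp only [this]
    rw [isoE_mul_single_ofUnit (setPartition_under φ).ge]
  · rw [under_mul_of_le, under_ofUnit]
    rw [setPartition_ofUnit, setPartition_under, h]

end Finite

/-! ### Annihilation by the idempotents of `ℂΣ_n` -/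

section Annihilation

variable {X Y : Finpartition (Finset.univ : Finset (Fin n))}

theorem single_mul_incl_lrbIdem_eq_zero {s : SetComp n G} (h : ¬ X ≤ s.setPartition) :
    single s (1 : ℂ) * incl G n (lrbIdem X) = 0 := by
  rw [← mul_ofUnit_under s, ← one_mul (1 : ℂ), ← single_mul_single, ← incl_single, mul_assoc,
    ← map_mul, single_mul_lrbIdem_eq_zero (by rwa [setPartition_under]), map_zero, mul_zero]

theorem single_mul_mul_incl_lrbIdem_eq_zero {s : SetComp n G} (h : ¬ X ≤ s.setPartition)
    (a : MonoidAlgebra ℂ (SetComp n G)) : single s (1 : ℂ) * a * incl G n (lrbIdem X) = 0 := by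
  induction a using MonoidAlgebra.induction_linear with
  | zero => simp
  | add a b ha hb => rw [mul_add, add_mul, ha, hb, add_zero]
  | single t c =>
    have : single s (1 : ℂ) * single t c = c • single (s * t) (1 : ℂ) := by
      rw [single_mul_single, smul_single, smul_eq_mul, one_mul, mul_one]
    rw [this, smul_mul_assoc, single_mul_incl_lrbIdem_eq_zero, smul_zero]
    exact fun hX => h (hX.trans (setPartition_mul_le_left s t))

theorem uniformSection_mul_mul_lrbIdem_eq_zero (h : ¬ X ≤ Y)
    (a : MonoidAlgebra ℂ (SetComp n G)) :
    incl G n (uniformSection Y) * a * incl G n (lrbIdem X) = 0 := by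
  rw [mul_assoc]
  refine uniformSection_mul_eq _ fun x hx => ?_
  rw [incl_single, ← mul_assoc]
  refine single_mul_mul_incl_lrbIdem_eq_zero ?_ a
  rwa [setPartition_ofUnit, hx]

theorem lrbIdem_mul_mul_lrbIdem_eq_zero (h : ¬ X ≤ Y) (a : MonoidAlgebra ℂ (SetComp n G)) :
    incl G n (lrbIdem Y) * a * incl G n (lrbIdem X) = 0 := by
  rw [← uniformSection_mul_lrbIdem, map_mul, mul_assoc _ _ a,
    uniformSection_mul_mul_lrbIdem_eq_zero h]

open Classical in
theorem incl_lrbIdem_mul (Y : Finpartition (Finset.univ : Finset (Fin n)))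
    (a : MonoidAlgebra ℂ (SetComp n G)) :
    incl G n (lrbIdem Y) * a = incl G n (uniformSection Y) * a -
      ∑ Z with Z < Y, incl G n (uniformSection Y) * (incl G n (lrbIdem Z) * a) := by
  rw [lrbIdem_eq, map_sub, map_sum, sub_mul, Finset.sum_mul]
  simp only [map_mul, mul_assoc]

/-- In a product which ends with `e_X`, another factor `e_X` can be replaced by `u_X`, since
`u_X - e_X` is a combination of elements `u_X e_Z` with `Z` strictly finer than `X`. -/
theorem lrbIdem_mul_mul_lrbIdem_self (X : Finpartition (Finset.univ : Finset (Fin n)))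
    (a : MonoidAlgebra ℂ (SetComp n G)) :
    incl G n (lrbIdem X) * a * incl G n (lrbIdem X) =
      incl G n (uniformSection X) * a * incl G n (lrbIdem X) := by
  classical
  rw [mul_assoc, incl_lrbIdem_mul, Finset.sum_eq_zero, sub_zero, mul_assoc]
  intro Z hZ
  rw [← mul_assoc (incl G n (lrbIdem Z)), lrbIdem_mul_mul_lrbIdem_eq_zero, mul_zero]
  exact (Finset.mem_filter.1 hZ).2.not_ge

/-- The orthogonality of `e_Y` and `e_X`, with an arbitrary factor inserted after `u_X`. -/
theorem lrbIdem_mul_uniformSection_mul_mul_lrbIdem_eq_zero (h : Y ≠ X)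
    (a : MonoidAlgebra ℂ (SetComp n G)) :
    incl G n (lrbIdem Y) * (incl G n (uniformSection X) * a) * incl G n (lrbIdem X) = 0 := by
  classical
  induction Y using (wellFounded_lt (α := Finpartition (Finset.univ : Finset (Fin n)))).induction
    with
  | _ Y ih =>
  by_cases hXY : X ≤ Y
  · have hlt := lt_of_le_of_ne hXY h.symm
    rw [mul_assoc, incl_lrbIdem_mul, Finset.sum_eq_single_of_mem X (by simpa using hlt)]
    · rw [← mul_assoc (incl G n (lrbIdem X)), lrbIdem_mul_mul_lrbIdem_self]
      have hu := congrArg (incl G n) (uniformSection_mul_uniformSection (le_refl X))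
      rw [map_mul] at hu
      rw [← mul_assoc (incl G n (uniformSection X)), hu]
      simp only [mul_assoc, sub_self]
    · intro Z hZ hZX
      rw [← mul_assoc (incl G n (lrbIdem Z)), ih Z (Finset.mem_filter.1 hZ).2 hZX, mul_zero]
  · exact lrbIdem_mul_mul_lrbIdem_eq_zero hXY _

end Annihilation

/-! ### The idempotents `e_Φ` -/

section Idem

variable [Finite G]

/-- The element `u_X E_φ e_X`, where `X` is the set partition of `φ`: this is `e_Φ` for the class
`Φ` of `φ`. -/
noncomputable def compIdem (φ : SetComp n (Dual G)) : MonoidAlgebra ℂ (SetComp n G) :=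
  incl G n (uniformSection φ.setPartition) * isoE φ * incl G n (lrbIdem φ.setPartition)

theorem isoQ_eq (φ : SetComp n (Dual G)) :
    isoQ φ = isoE φ * incl G n (lrbIdem φ.setPartition) := by
  rw [isoQ, lrbQ, map_mul, incl_single, ← mul_assoc, setPartition_under,
    isoE_mul_single_ofUnit (setPartition_under φ).ge]

theorem idem_eq (Φ : SetPart n (Dual G)) : idem Φ = compIdem (Quotient.out Φ) := by
  rw [idem, isoQ_eq, compIdem, mul_assoc]

/-- The class of a composition. -/
def SetComp.toPart {L : Type*} (s : SetComp n L) : SetPart n L :=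
  Quotient.mk (SetComp.setoid n L) s

theorem SetComp.toPart_eq_iff {L : Type*} {s t : SetComp n L} :
    s.toPart = t.toPart ↔ s.blocks.Perm t.blocks :=
  Quotient.eq (r := SetComp.setoid n L)

theorem SetComp.toPart_out {L : Type*} (S : SetPart n L) :
    SetComp.toPart (Quotient.out S) = S := Quotient.out_eq _

theorem SetComp.type_toPart {L : Type*} (s : SetComp n L) : s.toPart.type = s.type.supp := rfl

open Classical in
/-- The product `u_X E_φ` is the average of the elements `E_ψ` over the orderings `ψ` of the
labelled blocks of `φ`. -/
theorem uniformSection_mul_isoE (φ : SetComp n (Dual G)) :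
    incl G n (uniformSection φ.setPartition) * isoE φ =
      (φ.length.factorial : ℂ)⁻¹ • ∑ ψ with ψ.toPart = φ.toPart, isoE ψ := by
  rw [uniformSection, map_smul, map_sum, card_filter_setPartition, card_parts, smul_mul_assoc,
    Finset.sum_mul]
  congr 1
  refine Finset.sum_bij' (fun x _ => ofUnit (Dual G) x * φ) (fun ψ _ => ψ.under) ?_ ?_ ?_ ?_ ?_
  · intro x hx
    exact Finset.mem_filter.2 ⟨Finset.mem_univ _, toPart_eq_iff.2
      (perm_ofUnit_mul (Finset.mem_filter.1 hx).2.ge)⟩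
  · intro ψ hψ
    refine Finset.mem_filter.2 ⟨Finset.mem_univ _, ?_⟩
    rw [setPartition_under]
    exact (perm_blocks_iff.1 (toPart_eq_iff.1 (Finset.mem_filter.1 hψ).2)).1
  · intro x hx
    have hx := (Finset.mem_filter.1 hx).2
    rw [under_mul_of_le (by rw [setPartition_ofUnit, hx]), under_ofUnit]
  · intro ψ hψ
    obtain ⟨h1, h2⟩ := perm_blocks_iff.1 (toPart_eq_iff.1 (Finset.mem_filter.1 hψ).2)
    refine eq_of_under_eq ?_ fun i => by rw [labAt_mul, labAt_ofUnit, mul_one, h2]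
    rw [under_mul_of_le, under_ofUnit]
    rw [setPartition_ofUnit, setPartition_under, h1]
  · intro x hx
    rw [incl_single, single_mul_isoE (Finset.mem_filter.1 hx).2.ge]

theorem isoE_mul_incl_lrbIdem_eq_compIdem_mul (φ : SetComp n (Dual G)) :
    single (ofUnit G φ.under) 1 * compIdem φ = isoE φ * incl G n (lrbIdem φ.setPartition) := by
  rw [compIdem, ← mul_assoc, ← mul_assoc, ← incl_single, ← map_mul,
    single_mul_uniformSection (setPartition_under φ).le, incl_single,
    single_mul_isoE (setPartition_under φ).ge, ofUnit_under_mul]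

open Classical in
theorem compIdem_mul_compIdem (ψ φ : SetComp n (Dual G)) :
    compIdem ψ * compIdem φ = if ψ.toPart = φ.toPart then compIdem φ else 0 := by
  by_cases h : ψ.setPartition = φ.setPartition
  · have key : compIdem ψ * compIdem φ = incl G n (uniformSection φ.setPartition) *
        (isoE ψ * isoE φ) * incl G n (lrbIdem φ.setPartition) := by
      rw [compIdem, compIdem, h]
      simp only [mul_assoc]
      have := lrbIdem_mul_mul_lrbIdem_self φ.setPartition
        (incl G n (uniformSection φ.setPartition) * isoE φ)
      simp only [mul_assoc] at this
      rw [this, ← mul_assoc (isoE ψ), ← h, isoE_mul_uniformSection, ← mul_assoc (isoE ψ),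
        isoE_mul_uniformSection]
    rw [key, isoE_mul_isoE h, toPart_eq_iff]
    split_ifs with hp
    · rw [compIdem, ← h, uniformSection_mul_isoE, h, uniformSection_mul_isoE,
        toPart_eq_iff.2 hp, ← card_parts, ← card_parts, h]
    · rw [mul_zero, zero_mul]
  · rw [if_neg fun hp => h (perm_blocks_iff.1 (toPart_eq_iff.1 hp)).1]
    rw [compIdem, compIdem, mul_assoc, ← mul_assoc (incl G n (lrbIdem ψ.setPartition)),
      lrbIdem_mul_uniformSection_mul_mul_lrbIdem_eq_zero h, mul_zero]

open Classical in
theorem idem_mul_idem (Ψ Φ : SetPart n (Dual G)) :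
    idem Ψ * idem Φ = if Ψ = Φ then idem Φ else 0 := by
  rw [idem_eq, idem_eq, compIdem_mul_compIdem, toPart_out, toPart_out]

open Classical in
theorem idem_eq_sum (Φ : SetPart n (Dual G)) :
    idem Φ = ∑ φ : SetComp n (Dual G) with φ.toPart = Φ, (φ.length.factorial : ℂ)⁻¹ • isoQ φ := by
  rw [idem_eq, compIdem, uniformSection_mul_isoE, toPart_out, smul_mul_assoc, Finset.sum_mul,
    Finset.smul_sum]
  refine Finset.sum_congr rfl fun φ hφ => ?_
  have hφ := (Finset.mem_filter.1 hφ).2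
  rw [← toPart_out Φ, toPart_eq_iff, perm_blocks_iff] at hφ
  rw [isoQ_eq, ← card_parts, ← card_parts, hφ.1]

theorem sum_idem : ∑ Φ : SetPart n (Dual G), idem Φ = 1 := by
  classical
  simp only [idem_eq_sum]
  rw [Finset.sum_fiberwise Finset.univ (fun φ : SetComp n (Dual G) => φ.toPart)
      fun φ => (φ.length.factorial : ℂ)⁻¹ • isoQ φ,
    ← Finset.sum_fiberwise Finset.univ fun φ : SetComp n (Dual G) => φ.under]
  have h : ∀ x : SetComp n Unit, ∑ φ : SetComp n (Dual G) with φ.under = x,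
      (φ.length.factorial : ℂ)⁻¹ • isoQ φ =
        ((x.setPartition.parts.card.factorial : ℂ)⁻¹) •
          incl G n (single x 1 * lrbIdem x.setPartition) := by
    intro x
    rw [map_mul, incl_single, ← sum_isoE_under, Finset.sum_mul, Finset.smul_sum]
    refine Finset.sum_congr rfl fun φ hφ => ?_
    have hφ := (Finset.mem_filter.1 hφ).2
    rw [isoQ_eq, ← card_parts, ← hφ, setPartition_under]
  simp only [h]
  rw [← Finset.sum_fiberwise Finset.univ fun x : SetComp n Unit => x.setPartition]
  have h2 : ∀ X : Finpartition (Finset.univ : Finset (Fin n)),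
      ∑ x : SetComp n Unit with x.setPartition = X,
        ((x.setPartition.parts.card.factorial : ℂ)⁻¹) •
          incl G n (single x 1 * lrbIdem x.setPartition) = incl G n (lrbIdem X) := by
    intro X
    conv_rhs => rw [← uniformSection_mul_lrbIdem, uniformSection, card_filter_setPartition,
      smul_mul_assoc, map_smul, Finset.sum_mul, map_sum, Finset.smul_sum]
    refine Finset.sum_congr rfl fun x hx => ?_
    rw [(Finset.mem_filter.1 hx).2]
  simp only [h2]
  rw [← map_sum, sum_lrbIdem, map_one]

open Classical in
theorem coeff_sum_single {M : Type*} (S : Finset M) (a : M → ℂ) (t : M) :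
    (∑ s ∈ S, single s (a s)).coeff t = if t ∈ S then a t else 0 := by
  simp [coeff_sum, Finsupp.single_apply]

theorem coeff_isoE_ne_zero (φ : SetComp n (Dual G)) {t : SetComp n G} (h : t.under = φ.under) :
    (isoE φ).coeff t ≠ 0 := by
  classical
  rw [isoE, coeff_smul_apply, coeff_sum_single, if_pos (by simpa using h), card_filter_under,
    Nat.cast_pow]
  refine mul_ne_zero (inv_ne_zero (pow_ne_zero _ natCard_ne_zero)) ?_
  rw [Ne, map_eq_zero]
  exact Units.ne_zero _

theorem idem_ne_zero (Φ : SetPart n (Dual G)) : idem Φ ≠ 0 := by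
  classical
  obtain ⟨φ, hφ⟩ : ∃ φ : SetComp n (Dual G), compIdem φ = idem Φ := ⟨_, (idem_eq Φ).symm⟩
  rw [← hφ]
  intro h0
  have h1 := isoE_mul_incl_lrbIdem_eq_compIdem_mul φ
  rw [h0, mul_zero, ← isoQ_eq, isoQ, lrbQ_eq, map_sum, Finset.mul_sum] at h1
  -- the coefficient of `H_x` in `E_φ Q_x` comes from the term `H_x` of `Q_x` only
  have h2 := congrArg (fun a : MonoidAlgebra ℂ (SetComp n G) => a.coeff (ofUnit G φ.under)) h1
  simp only [coeff_zero, Finsupp.coe_zero, Pi.zero_apply, coeff_sum, Finsupp.finsetSum_apply] at h2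
  rw [Finset.sum_eq_single_of_mem φ.under] at h2
  · rw [map_smul, incl_single, mul_smul_comm, isoE_mul_single_ofUnit (setPartition_under φ).ge,
      refineCoeff] at h2
    simp only [count_self, tsub_self, pow_zero, Nat.cast_one, div_one, Finset.prod_const_one,
      one_smul] at h2
    exact coeff_isoE_ne_zero φ (under_ofUnit _) h2.symm
  · exact Finset.mem_filter.2 ⟨Finset.mem_univ _, mul_eq_left_of_le le_rfl⟩
  · intro y hy hne
    rw [map_smul, incl_single, mul_smul_comm, isoE, smul_mul_assoc, Finset.sum_mul,
      coeff_smul_apply, coeff_smul_apply, coeff_sum, Finsupp.finsetSum_apply, Finset.sum_eq_zero,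
      smul_zero, smul_zero]
    intro s hs
    rw [single_mul_single, coeff_single, Finsupp.single_eq_of_ne]
    intro h
    have := congrArg under h
    rw [under_mul, under_ofUnit, under_ofUnit, (Finset.mem_filter.1 hs).2,
      (Finset.mem_filter.1 hy).2] at this
    exact hne this.symm

end Idem

end Hsiao

namespace Hsiao

open MonoidAlgebra SetComp

variable {n : ℕ} {K L M : Type*}

/-! ### Types of set compositions -/

namespace SetComp

theorem blocks_type (s : SetComp n L) :
    s.type.blocks = s.blocks.map fun B => (B.1.card, B.2) := rfl

theorem length_type (s : SetComp n L) : s.type.length = s.length := List.length_map _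

theorem getElem?_type (s : SetComp n L) (i : Fin n) :
    s.type.blocks[(s.pos i : ℕ)]? =
      some ((Finset.univ.filter fun j => s.pos j = s.pos i).card, s.labAt i) := by
  have h : s.blocks[(s.pos i : ℕ)]? = some (s.blocks.get (s.pos i)) :=
    List.getElem?_eq_getElem (s.pos i).2
  rw [type, List.getElem?_map, h, Option.map_some, s.get_eq]
  rfl

theorem perm_injective (w : Equiv.Perm (Fin n)) :
    Function.Injective (perm w : SetComp n L → SetComp n L) := by
  intro s t h
  refine ext_pos (fun i j => ?_) fun i => ?_
  · have := pos_perm_le w s (w i) (w j)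
    rw [h, pos_perm_le, Equiv.symm_apply_apply, Equiv.symm_apply_apply] at this
    exact this.symm
  · have := labAt_perm w s (w i)
    rw [h, labAt_perm, Equiv.symm_apply_apply] at this
    exact this.symm

/-- The symmetric group is transitive on the compositions of a given type. -/
theorem exists_perm_of_type_eq {s t : SetComp n L} (h : s.type = t.type) :
    ∃ w : Equiv.Perm (Fin n), s.perm w = t := by
  have hcard : ∀ c : ℕ, Fintype.card {i // (s.pos i : ℕ) = c} =
      Fintype.card {i // (t.pos i : ℕ) = c} := by
    have key : ∀ (s : SetComp n L) (c : ℕ), Fintype.card {i // (s.pos i : ℕ) = c} =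
        (s.type.blocks[c]?.map Prod.fst).getD 0 := by
      intro s c
      rw [Fintype.card_subtype]
      by_cases hc : c < s.length
      · obtain ⟨i, hi⟩ := s.pos_surjective ⟨c, hc⟩
        have hc' : c = s.pos i := by rw [hi]
        rw [hc', getElem?_type]
        simp [Fin.ext_iff]
      · rw [Finset.filter_false_of_mem, List.getElem?_eq_none]
        · simp
        · exact (length_type s).trans_le (not_lt.1 hc)
        · rintro i - rfl
          exact hc (s.pos i).2
    intro c
    rw [key, key, h]
  let w : Equiv.Perm (Fin n) := Equiv.ofFiberEquiv
    (f := fun i => (s.pos i : ℕ)) (g := fun i => (t.pos i : ℕ))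
    fun c => (Fintype.card_eq.1 (hcard c)).some
  have hw : ∀ i, (t.pos (w i) : ℕ) = s.pos i := fun i =>
    Equiv.ofFiberEquiv_map (f := fun i => (s.pos i : ℕ)) (g := fun i => (t.pos i : ℕ)) _ i
  have hw' : ∀ i, (s.pos (w.symm i) : ℕ) = t.pos i := fun i => by
    rw [← hw, Equiv.apply_symm_apply]
  refine ⟨w, ext_pos (fun i j => ?_) fun i => ?_⟩
  · rw [pos_perm_le, Fin.le_def, Fin.le_def, hw', hw']
  · rw [labAt_perm]
    have h1 := s.getElem?_type (w.symm i)
    rw [hw', h, t.getElem?_type] at h1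
    exact (Prod.ext_iff.1 (Option.some_injective _ h1)).2.symm

theorem card_pos_lt (s : SetComp n L) {j : ℕ} (hj : j ≤ s.length) :
    (Finset.univ.filter fun i => (s.pos i : ℕ) < j).card = s.type.partialSum j := by
  induction j with
  | zero => simp [IntComp.partialSum]
  | succ j ih =>
    have hj' : j < s.length := hj
    obtain ⟨a, ha⟩ := s.pos_surjective ⟨j, hj'⟩
    have ha' : (s.pos a : ℕ) = j := by rw [ha]
    have hg := s.getElem?_type a
    rw [ha'] at hg
    rw [IntComp.partialSum, List.take_add_one, hg]
    have hsplit : (Finset.univ.filter fun i => (s.pos i : ℕ) < j + 1) =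
        (Finset.univ.filter fun i => (s.pos i : ℕ) < j) ∪
          (Finset.univ.filter fun i => s.pos i = s.pos a) := by
      ext i
      simp [Fin.ext_iff, ha', le_iff_lt_or_eq]
    rw [hsplit, Finset.card_union_of_disjoint, ih hj'.le, IntComp.partialSum]
    · simp
    · rw [Finset.disjoint_left]
      intro i hi hi'
      simp only [Finset.mem_filter, Finset.mem_univ, true_and] at hi hi'
      rw [hi', ha'] at hi
      exact hi.false

/-- The block of `s.type` with the index of the block of `s` at `a`. -/
noncomputable def typePos (s : SetComp n L) (a : Fin n) : Fin s.type.length :=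
  Fin.cast s.length_type.symm (s.pos a)

theorem typePos_surjective (s : SetComp n L) : Function.Surjective s.typePos :=
  (finCongr s.length_type.symm).surjective.comp s.pos_surjective

theorem get_typePos_snd (s : SetComp n L) (a : Fin n) :
    (s.type.blocks.get (s.typePos a)).2 = s.labAt a := by
  have h := s.getElem?_type a
  obtain ⟨_, h⟩ := List.getElem?_eq_some_iff.1 h
  exact congrArg Prod.snd h

/-! ### Refinement of compositions -/

section Refinement

variable [Monoid L]

/-- The relation `s ≤ t`: `t` refines `s` and its blocks carry the labels of those of `s`. -/
def RefinedBy (s t : SetComp n L) : Prop := s * ofUnit L t.under = t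

theorem refinedBy_iff {s t : SetComp n L} : s.RefinedBy t ↔
    (∀ i j, t.pos i ≤ t.pos j → s.pos i ≤ s.pos j) ∧ ∀ i, s.labAt i = t.labAt i := by
  have hle : ∀ i j, (s * ofUnit L t.under).pos i ≤ (s * ofUnit L t.under).pos j ↔
      s.pos i < s.pos j ∨ s.pos i = s.pos j ∧ t.pos i ≤ t.pos j := fun i j => by
    rw [pos_mul_le, ofUnit, pos_relabel_le, pos_under_le]
  constructor
  · intro h
    constructor
    · intro i j hij
      have := hle i j
      rw [RefinedBy.eq_1] at h
      rw [h] at this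
      rcases this.1 hij with h' | h'
      · exact h'.le
      · exact h'.1.le
    · intro i
      rw [RefinedBy.eq_1] at h
      conv_rhs => rw [← h, labAt_mul, labAt_ofUnit, one_mul]
  · rintro ⟨h, hl⟩
    refine ext_pos (fun i j => ?_) fun i => by rw [labAt_mul, labAt_ofUnit, one_mul, hl]
    rw [hle]
    constructor
    · rintro (h' | h')
      · exact (le_total _ _).resolve_right fun hc => (h j i hc).not_gt h'
      · exact h'.2
    · intro h'
      rcases (h i j h').lt_or_eq with h'' | h''
      · exact Or.inl h''
      · exact Or.inr ⟨h'', h'⟩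

theorem RefinedBy.perm {s t : SetComp n L} (h : s.RefinedBy t) (w : Equiv.Perm (Fin n)) :
    (s.perm w).RefinedBy (t.perm w) := by
  rw [refinedBy_iff] at h ⊢
  refine ⟨fun i j => ?_, fun i => by rw [labAt_perm, labAt_perm, h.2]⟩
  rw [pos_perm_le, pos_perm_le]
  exact h.1 _ _

/-- If `t` refines `s`, the comparison of partial sums of the types detects the block of `s`
which contains a given block of `t`. -/
theorem partialSum_le_iff {s t : SetComp n L} (h : s.RefinedBy t) (a : Fin n) {i : ℕ}
    (hi : i < s.length) :
    (s.type.partialSum i ≤ t.type.partialSum (t.pos a) ∧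
      t.type.partialSum (t.pos a + 1) ≤ s.type.partialSum (i + 1)) ↔ (s.pos a : ℕ) = i := by
  have hle := (refinedBy_iff.1 h).1
  have hta : (t.pos a : ℕ) + 1 ≤ t.length := (t.pos a).2
  have h1 : ∀ i ≤ s.length, s.type.partialSum i ≤ t.type.partialSum (t.pos a) ↔
      i ≤ (s.pos a : ℕ) := by
    intro i hi
    rw [← s.card_pos_lt hi, ← t.card_pos_lt (t.pos a).2.le]
    constructor
    · intro hc
      by_contra hlt
      refine hc.not_gt (Finset.card_lt_card (Finset.ssubset_iff_of_subset ?_ |>.2 ⟨a, ?_, ?_⟩))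
      · intro b hb
        simp only [Finset.mem_filter, Finset.mem_univ, true_and] at hb ⊢
        exact (Fin.le_def.1 (hle b a (Fin.le_def.2 hb.le))).trans_lt (not_le.1 hlt)
      · simpa using hlt
      · simp
    · intro hia
      refine Finset.card_le_card fun b hb => ?_
      simp only [Finset.mem_filter, Finset.mem_univ, true_and] at hb ⊢
      by_contra hc
      exact (hb.trans_le hia).not_ge (hle a b (not_lt.1 hc))
  constructor
  · rintro ⟨h2, h3⟩
    refine le_antisymm ?_ ((h1 i hi.le).1 h2)
    by_contra hc
    have h4 := (h1 (i + 1) hi).2 (not_le.1 hc)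
    have h5 := h3.trans h4
    rw [← t.card_pos_lt hta, ← t.card_pos_lt (t.pos a).2.le] at h5
    refine h5.not_gt (Finset.card_lt_card (Finset.ssubset_iff_of_subset ?_ |>.2 ⟨a, ?_, ?_⟩))
    · intro b hb
      simp only [Finset.mem_filter, Finset.mem_univ, true_and] at hb ⊢
      omega
    · simp
    · simp
  · intro hia
    refine ⟨(h1 i hi.le).2 hia.ge, ?_⟩
    rw [← t.card_pos_lt hta, ← s.card_pos_lt hi]
    refine Finset.card_le_card fun b hb => ?_
    simp only [Finset.mem_filter, Finset.mem_univ, true_and] at hb ⊢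
    have := Fin.le_def.1 (hle b a (Fin.le_def.2 (Nat.lt_succ_iff.1 hb)))
    omega

/-- A composition is determined by its type and by any of its refinements. -/
theorem RefinedBy.eq_of_type_eq {s s' t : SetComp n L} (h : s.RefinedBy t) (h' : s'.RefinedBy t)
    (hs : s.type = s'.type) : s = s' := by
  have hp : ∀ a, (s.pos a : ℕ) = s'.pos a := by
    intro a
    have hl : s.length = s'.length := by rw [← length_type, hs, length_type]
    have := (partialSum_le_iff h a (i := s'.pos a) ((s'.pos a).2.trans_eq hl.symm)).1
    refine this ?_
    rw [hs]
    exact (partialSum_le_iff h' a (s'.pos a).2).2 rfl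
  refine ext_pos (fun i j => by rw [Fin.le_def, Fin.le_def, hp, hp]) fun i => ?_
  rw [(refinedBy_iff.1 h).2, (refinedBy_iff.1 h').2]

theorem typePos_mem_inBlock {s t : SetComp n L} (h : s.RefinedBy t) (a : Fin n)
    (i : Fin s.type.length) : t.typePos a ∈ t.type.inBlock s.type i ↔ s.typePos a = i := by
  rw [IntComp.inBlock, Finset.mem_filter, Fin.ext_iff]
  simp only [Finset.mem_univ, true_and]
  exact partialSum_le_iff h a (i.2.trans_eq s.length_type)

theorem RefinedBy.refines {s t : SetComp n L} (h : s.RefinedBy t) : t.type.Refines s.type := by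
  intro j
  obtain ⟨a, rfl⟩ := t.typePos_surjective j
  exact ⟨s.typePos a, (typePos_mem_inBlock h a _).2 rfl⟩

theorem RefinedBy.labelLE {s t : SetComp n L} (h : s.RefinedBy t) :
    s.type.LabelLE t.type := by
  refine ⟨h.refines, fun i j hj => ?_⟩
  obtain ⟨a, rfl⟩ := t.typePos_surjective j
  rw [typePos_mem_inBlock h] at hj
  rw [← hj, get_typePos_snd, get_typePos_snd, (refinedBy_iff.1 h).2]

theorem card_inBlock {s t : SetComp n L} (h : s.RefinedBy t) (i : Fin s.length) :
    (t.type.inBlock s.type (Fin.cast s.length_type.symm i)).card = s.count t i := by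
  rw [count]
  symm
  refine Finset.card_bij (fun j _ => Fin.cast t.length_type.symm j) ?_ ?_ ?_
  · intro j hj
    obtain ⟨a, ha, rfl⟩ := Finset.mem_image.1 hj
    rw [Finset.mem_filter] at ha
    exact (typePos_mem_inBlock h a _).2 (congrArg _ ha.2)
  · intro j _ j' _ hjj
    simpa using hjj
  · intro j hj
    obtain ⟨a, rfl⟩ := t.typePos_surjective j
    rw [typePos_mem_inBlock h] at hj
    refine ⟨t.pos a, Finset.mem_image_of_mem _ ?_, rfl⟩
    simpa [typePos] using hj

theorem sum_count {s t : SetComp n L} (h : s.RefinedBy t) : ∑ i, s.count t i = t.length := by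
  have hle := (refinedBy_iff.1 h).1
  have heq : ∀ i j, t.pos i = t.pos j → s.pos i = s.pos j := fun i j hij =>
    le_antisymm (hle i j hij.le) (hle j i hij.ge)
  have := Finset.card_eq_sum_card_fiberwise (s := (Finset.univ : Finset (Fin t.length)))
    (f := fun j => s.pos (Function.surjInv t.pos_surjective j))
    (t := Finset.univ) (fun _ _ => Finset.mem_univ _)
  rw [Finset.card_univ, Fintype.card_fin] at this
  rw [this]
  refine Finset.sum_congr rfl fun i _ => ?_
  rw [count]
  congr 1
  ext j
  simp only [Finset.mem_filter, Finset.mem_univ, true_and, Finset.mem_image]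
  constructor
  · rintro ⟨a, rfl, rfl⟩
    exact heq _ _ (Function.surjInv_eq _ _)
  · intro hj
    exact ⟨_, hj, Function.surjInv_eq _ _⟩

end Refinement

end SetComp

end Hsiao

namespace Hsiao

open MonoidAlgebra SetComp

variable {n : ℕ} {K L M : Type*}

/-! ### The standard set composition of an integer composition -/

namespace IntComp

theorem partialSum_zero (p : IntComp n L) : p.partialSum 0 = 0 := by simp [partialSum]

theorem partialSum_succ (p : IntComp n L) (j : Fin p.length) :
    p.partialSum (j + 1) = p.partialSum j + (p.blocks.get j).1 := by
  have hj : (j : ℕ) < p.blocks.length := j.2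
  rw [partialSum, partialSum, List.take_add_one, List.getElem?_eq_getElem hj]
  rw [Option.toList_some, List.map_append, List.sum_append]
  simp only [List.map_cons, List.map_nil, List.sum_singleton]
  rfl

theorem partialSum_eq (p : IntComp n L) (j : ℕ) : p.partialSum j = (p.under.take j).sum := by
  rw [partialSum, under, List.map_take]

theorem length_under (p : IntComp n L) : p.under.length = p.length := List.length_map _

theorem partialSum_length (p : IntComp n L) : p.partialSum p.length = n := by
  rw [partialSum, length, List.take_length, p.sum_eq]

theorem partialSum_mono (p : IntComp n L) : Monotone p.partialSum := by
  refine monotone_nat_of_le_succ fun j => ?_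
  rw [partialSum, partialSum, List.take_add_one, List.map_append, List.sum_append]
  exact Nat.le_add_right _ _

theorem exists_idx (p : IntComp n L) (a : Fin n) :
    ∃ j : Fin p.length, p.partialSum j ≤ a ∧ (a : ℕ) < p.partialSum (j + 1) := by
  have h : ∃ m, (a : ℕ) < p.partialSum m := ⟨p.length, by rw [p.partialSum_length]; exact a.2⟩
  have hle : Nat.find h ≤ p.length := Nat.find_min' h (by rw [p.partialSum_length]; exact a.2)
  obtain ⟨k, hk⟩ : ∃ k, Nat.find h = k + 1 := Nat.exists_eq_succ_of_ne_zero fun h0 => by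
    have := Nat.find_spec h
    rw [h0, partialSum_zero] at this
    exact Nat.not_lt_zero _ this
  exact ⟨⟨k, by omega⟩, not_lt.1 (Nat.find_min h (by rw [hk]; exact Nat.lt_succ_self k)),
    hk ▸ Nat.find_spec h⟩

/-- The index of the block of `p` which contains `a`, when the blocks of `p` are seen as
consecutive intervals of `[n]`. -/
noncomputable def idx (p : IntComp n L) (a : Fin n) : Fin p.length := (p.exists_idx a).choose

theorem idx_eq_iff (p : IntComp n L) {a : Fin n} {j : Fin p.length} :
    p.idx a = j ↔ p.partialSum j ≤ a ∧ (a : ℕ) < p.partialSum (j + 1) := by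
  have hs := (p.exists_idx a).choose_spec
  refine ⟨fun h => h ▸ hs, fun h => ?_⟩
  change p.partialSum (p.idx a) ≤ a ∧ (a : ℕ) < p.partialSum (p.idx a + 1) at hs
  rcases lt_trichotomy (p.idx a) j with h' | h' | h'
  · have := p.partialSum_mono (show (p.idx a : ℕ) + 1 ≤ j from h')
    omega
  · exact h'
  · have := p.partialSum_mono (show (j : ℕ) + 1 ≤ p.idx a from h')
    omega

theorem idx_mono (p : IntComp n L) : Monotone p.idx := by
  intro a b hab
  by_contra hc
  have h1 := (p.idx_eq_iff.1 (rfl : p.idx a = _)).1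
  have h2 := (p.idx_eq_iff.1 (rfl : p.idx b = _)).2
  have h3 := p.partialSum_mono (show (p.idx b : ℕ) + 1 ≤ p.idx a from not_le.1 hc)
  have h4 : (a : ℕ) ≤ b := hab
  omega

theorem partialSum_lt_succ (p : IntComp n L) (j : Fin p.length) :
    p.partialSum j < p.partialSum (j + 1) := by
  rw [partialSum_succ]
  exact Nat.lt_add_of_pos_right (p.pos _ (List.get_mem p.blocks j))

theorem partialSum_succ_le (p : IntComp n L) (j : Fin p.length) : p.partialSum (j + 1) ≤ n :=
  (p.partialSum_mono (show (j : ℕ) + 1 ≤ p.length from j.2)).trans_eq p.partialSum_length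

theorem idx_surjective (p : IntComp n L) : Function.Surjective p.idx := fun j =>
  ⟨⟨p.partialSum j, (p.partialSum_lt_succ j).trans_le (p.partialSum_succ_le j)⟩,
    p.idx_eq_iff.2 ⟨le_rfl, p.partialSum_lt_succ j⟩⟩

theorem card_idx_eq (p : IntComp n L) (j : Fin p.length) :
    (Finset.univ.filter fun a => p.idx a = j).card = (p.blocks.get j).1 := by
  have : (Finset.univ.filter fun a => p.idx a = j).map Fin.valEmbedding =
      Finset.Ico (p.partialSum j) (p.partialSum (j + 1)) := by
    ext m
    simp only [Finset.mem_map, Finset.mem_filter, Finset.mem_univ, true_and, idx_eq_iff,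
      Fin.valEmbedding_apply, Finset.mem_Ico]
    constructor
    · rintro ⟨a, ha, rfl⟩
      exact ha
    · intro hm
      exact ⟨⟨m, hm.2.trans_le (p.partialSum_succ_le j)⟩, hm, rfl⟩
  rw [← Finset.card_map Fin.valEmbedding, this, Nat.card_Ico, partialSum_succ,
    Nat.add_sub_cancel_left]

/-- The set composition of type `p` whose blocks are consecutive intervals. -/
noncomputable def std (p : IntComp n L) : SetComp n L :=
  ofFun p.idx fun j => (p.blocks.get j).2

end IntComp

theorem SetComp.blocks_ofFun_surjective {k : ℕ} {f : Fin n → Fin k} (hf : Function.Surjective f)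
    (g : Fin k → L) : (ofFun f g).blocks =
      List.ofFn fun j => (Finset.univ.filter fun i => f i = j, g j) := by
  have h : (ofFun f g).blocks = ((Finset.univ.image f).sort).map
      fun v => (Finset.univ.filter fun i => f i = v, g v) := rfl
  rw [h, Finset.image_univ_of_surjective hf, Fin.sort_univ, List.ofFn_eq_map]

theorem SetComp.blocks_withLabels (x : SetComp n K) (g : Fin x.length → L) :
    (x.withLabels g).blocks = List.ofFn fun j => ((x.blocks.get j).1, g j) := by
  rw [withLabels, blocks_ofFun_surjective x.pos_surjective]
  congr 1
  funext j
  exact congrArg (·, g j) (x.get_eq j).symm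

theorem IntComp.type_std (p : IntComp n L) : p.std.type = p := by
  refine IntComp.ext ?_
  rw [SetComp.blocks_type, std, SetComp.blocks_ofFun_surjective p.idx_surjective, List.map_ofFn]
  simp only [Function.comp_def, card_idx_eq]
  exact List.ofFn_get p.blocks

theorem IntComp.refinedBy_std [Monoid L] {p q : IntComp n L} (h : p.LabelLE q) :
    p.std.RefinedBy q.std := by
  have key : ∀ a, q.idx a ∈ q.inBlock p (p.idx a) := by
    intro a
    obtain ⟨i, hi⟩ := h.1 (q.idx a)
    have hi' := (Finset.mem_filter.1 hi).2
    have ha := q.idx_eq_iff.1 (rfl : q.idx a = _)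
    have : p.idx a = i := p.idx_eq_iff.2 ⟨hi'.1.trans ha.1, ha.2.trans_le hi'.2⟩
    rwa [this]
  refine refinedBy_iff.2 ⟨fun a b hab => ?_, fun a => ?_⟩
  · rw [std, pos_ofFun_le] at hab ⊢
    rcases le_total a b with hle | hle
    · exact p.idx_mono hle
    · have heq := le_antisymm hab (q.idx_mono hle)
      have h1 := (Finset.mem_filter.1 (key b)).2
      have h2 := q.idx_eq_iff.1 heq
      exact (p.idx_eq_iff.2 ⟨h1.1.trans h2.1, h2.2.trans_le h1.2⟩).le
  · rw [std, std, labAt_ofFun, labAt_ofFun, h.2 _ _ (key a)]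

theorem SetComp.exists_refinedBy [Monoid L] {p : IntComp n L} {t : SetComp n L}
    (h : p.LabelLE t.type) : ∃ s : SetComp n L, s.RefinedBy t ∧ s.type = p := by
  obtain ⟨w, hw⟩ := exists_perm_of_type_eq (s := t.type.std) (t := t) t.type.type_std
  refine ⟨p.std.perm w, ?_, by rw [perm_type, p.type_std]⟩
  conv_rhs => rw [← hw]
  exact (IntComp.refinedBy_std h).perm w

/-! ### Degrees -/

/-- The degree depends only on the sequences of sizes of the blocks. -/
theorem IntComp.deg_eq (q : IntComp n M) (p : IntComp n L) : q.deg p =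
    ∏ i ∈ Finset.range p.under.length, ((Finset.range q.under.length).filter fun j =>
      (p.under.take i).sum ≤ (q.under.take j).sum ∧
        (q.under.take (j + 1)).sum ≤ (p.under.take (i + 1)).sum).card := by
  rw [deg, length_under p, ← Fin.prod_univ_eq_prod_range (fun i =>
    ((Finset.range q.under.length).filter fun j => (p.under.take i).sum ≤ (q.under.take j).sum ∧
        (q.under.take (j + 1)).sum ≤ (p.under.take (i + 1)).sum).card)]
  refine Finset.prod_congr rfl fun i _ => ?_
  refine Finset.card_bij (fun j _ => (j : ℕ)) ?_ (fun j _ j' _ h => Fin.ext h) ?_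
  · intro j hj
    rw [inBlock, Finset.mem_filter] at hj
    refine Finset.mem_filter.2 ⟨Finset.mem_range.2 (j.2.trans_eq (List.length_map _).symm), ?_⟩
    simpa only [partialSum_eq] using hj.2
  · intro j hj
    rw [Finset.mem_filter, Finset.mem_range] at hj
    refine ⟨⟨j, hj.1.trans_eq (List.length_map _)⟩, ?_, rfl⟩
    rw [inBlock, Finset.mem_filter]
    refine ⟨Finset.mem_univ _, ?_⟩
    simpa only [partialSum_eq] using hj.2

/-- The coefficient `(-1) ^ (ℓ(q) - ℓ(p)) / deg(q/p)`. -/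
noncomputable def degCoeff (p : IntComp n L) (q : IntComp n M) : ℂ :=
  (-1 : ℂ) ^ (q.length - p.length) / (q.deg p : ℂ)

theorem degCoeff_congr {L' M' : Type*} {p : IntComp n L} {q : IntComp n M} {p' : IntComp n L'}
    {q' : IntComp n M'} (hp : p.under = p'.under) (hq : q.under = q'.under) :
    degCoeff p q = degCoeff p' q' := by
  have h1 : p.length = p'.length := by
    rw [← p.length_under, hp, p'.length_under]
  have h2 : q.length = q'.length := by
    rw [← q.length_under, hq, q'.length_under]
  rw [degCoeff, degCoeff, h1, h2, IntComp.deg_eq, IntComp.deg_eq, hp, hq]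

theorem SetComp.under_type_under (s : SetComp n L) : s.under.type.under = s.type.under := by
  simp [IntComp.under, type, under, relabel, Function.comp_def]

theorem refineCoeff_eq {x y : SetComp n Unit} (h : x * y = y) :
    refineCoeff x y = degCoeff x.type y.type := by
  have hr : x.RefinedBy y := by
    rw [RefinedBy]
    conv_rhs => rw [← h]
    exact congrArg _ (ext_pos (fun i j => by rw [ofUnit, pos_relabel_le, pos_under_le])
      fun _ => rfl)
  have hdeg : y.type.deg x.type = ∏ i, x.count y i := by
    rw [IntComp.deg]
    symm
    exact Fintype.prod_equiv (finCongr x.length_type.symm) _ _ fun i => (card_inBlock hr i).symm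
  rw [refineCoeff, degCoeff, hdeg, length_type, length_type, Finset.prod_div_distrib,
    Finset.prod_pow_eq_pow_sum, Nat.cast_prod,
    Finset.sum_tsub_distrib _ fun i _ => x.one_le_count y i, sum_count hr]
  simp

/-! ### Sums over the compositions of a given type -/

theorem SetComp.eval_eq_eval_type {G : Type*} [CommGroup G] (φ : SetComp n (Dual G))
    (s : SetComp n G) : φ.eval s = φ.type.eval s.type := by
  simp [SetComp.eval, IntComp.eval, type, Function.comp_def]

section Sums

variable {G : Type*} [CommGroup G] [Finite G]

open Classical in
/-- The basis elements `Q_s = H_s Q_{|s|}` of `ℂΣ_n[G]`. -/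
theorem single_mul_incl_lrbQ (s : SetComp n G) :
    single s (1 : ℂ) * incl G n (lrbQ s.under) =
      ∑ t with s.RefinedBy t, degCoeff s.type t.type • single t (1 : ℂ) := by
  rw [lrbQ_eq, map_sum, Finset.mul_sum]
  refine Finset.sum_bij' (fun y _ => s * ofUnit G y) (fun t _ => t.under) ?_ ?_ ?_ ?_ ?_
  · intro y hy
    have hy := (Finset.mem_filter.1 hy).2
    refine Finset.mem_filter.2 ⟨Finset.mem_univ _, ?_⟩
    rw [RefinedBy, under_mul, under_ofUnit, hy]
  · intro t ht
    have ht := congrArg under (Finset.mem_filter.1 ht).2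
    rw [under_mul, under_ofUnit] at ht
    exact Finset.mem_filter.2 ⟨Finset.mem_univ _, ht⟩
  · intro y hy
    rw [under_mul, under_ofUnit, (Finset.mem_filter.1 hy).2]
  · intro t ht
    exact (Finset.mem_filter.1 ht).2
  · intro y hy
    have hy := (Finset.mem_filter.1 hy).2
    rw [refineCoeff_eq hy, map_smul, incl_single, mul_smul_comm, single_mul_single, one_mul]
    congr 1
    refine degCoeff_congr s.under_type_under ?_
    rw [← under_type_under (s * ofUnit G y), under_mul, under_ofUnit, hy]

open Classical in
/-- Each `t` with `p ≤ type t` refines exactly one composition of type `p`. -/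
theorem sum_refinedBy (p : IntComp n G) :
    ∑ s : SetComp n G with s.type = p, ∑ t with s.RefinedBy t,
      degCoeff s.type t.type • single t (1 : ℂ) =
        ∑ q with p.LabelLE q, degCoeff p q • symH q := by
  have hr : ∑ q with p.LabelLE q, degCoeff p q • symH q =
      ∑ t : SetComp n G with p.LabelLE t.type, degCoeff p t.type • single t (1 : ℂ) := by
    simp only [symH, Finset.smul_sum]
    rw [Finset.sum_sigma']
    refine Finset.sum_bij' (fun x _ => x.2) (fun t _ => ⟨t.type, t⟩) ?_ ?_ ?_ ?_ ?_
    · rintro ⟨q, t⟩ h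
      simp only [Finset.mem_sigma, Finset.mem_filter, Finset.mem_univ, true_and] at h ⊢
      rw [h.2]; exact h.1
    · intro t h
      simpa using h
    · rintro ⟨q, t⟩ h
      simp only [Finset.mem_sigma, Finset.mem_filter, Finset.mem_univ, true_and] at h
      rw [h.2]
    · intro t h
      rfl
    · rintro ⟨q, t⟩ h
      simp only [Finset.mem_sigma, Finset.mem_filter, Finset.mem_univ, true_and] at h
      simp only [h.2]
  rw [hr, Finset.sum_sigma']
  refine Finset.sum_bij (fun x _ => x.2) ?_ ?_ ?_ ?_
  · rintro ⟨s, t⟩ h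
    simp only [Finset.mem_sigma, Finset.mem_filter, Finset.mem_univ, true_and] at h ⊢
    rw [← h.1]
    exact h.2.labelLE
  · rintro ⟨s, t⟩ h ⟨s', t'⟩ h' htt
    simp only [Finset.mem_sigma, Finset.mem_filter, Finset.mem_univ, true_and] at h h' htt
    subst htt
    rw [h.2.eq_of_type_eq h'.2 (h.1.trans h'.1.symm)]
  · intro t ht
    obtain ⟨s, hs, hp⟩ := exists_refinedBy (Finset.mem_filter.1 ht).2
    exact ⟨⟨s, t⟩, by simp [hs, hp], rfl⟩
  · rintro ⟨s, t⟩ h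
    simp only [Finset.mem_sigma, Finset.mem_filter, Finset.mem_univ, true_and] at h
    rw [h.1]

theorem SetComp.eq_of_type_eq_of_under_eq {φ ψ : SetComp n L} (h : φ.type = ψ.type)
    (hu : φ.under = ψ.under) : φ = ψ := by
  have h1 : φ.blocks.map Prod.fst = ψ.blocks.map Prod.fst := by
    have := congrArg (fun x : SetComp n Unit => x.blocks.map Prod.fst) hu
    simpa [under, relabel, Function.comp_def] using this
  have h2 : φ.blocks.map Prod.snd = ψ.blocks.map Prod.snd := by
    have := congrArg (fun x : IntComp n L => x.blocks.map Prod.snd) h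
    simpa [type, Function.comp_def] using this
  refine SetComp.ext ?_
  exact (List.zip_of_prod h1 h2).trans (List.zip_of_prod rfl rfl).symm

theorem SetComp.exists_type_eq {s : SetComp n L} {α : IntComp n M} (h : s.type.under = α.under) :
    ∃ φ : SetComp n M, φ.type = α ∧ φ.under = s.under := by
  have hl : s.length = α.length := by
    rw [← s.length_type, ← s.type.length_under, h, α.length_under]
  refine ⟨s.withLabels fun j => (α.blocks.get (Fin.cast hl j)).2, IntComp.ext ?_,
    under_withLabels _ _⟩
  rw [blocks_type, blocks_withLabels, List.map_ofFn]
  refine List.ext_get (by simp only [List.length_ofFn]; exact hl) fun j h1 h2 => ?_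
  have hg := congrArg (fun l : List ℕ => l[j]?) h
  have h3 : j < s.blocks.length := by simpa using h1
  have h4 : j < α.blocks.length := h2
  simp only [IntComp.under, type, List.getElem?_map, List.getElem?_eq_getElem h3,
    List.getElem?_eq_getElem h4, Option.map_some, Option.some.injEq] at hg
  simp only [List.get_eq_getElem, List.getElem_ofFn, Function.comp_apply]
  exact Prod.ext hg rfl

theorem SetComp.type_under_eq_of_under_eq {φ : SetComp n L} {s : SetComp n M}
    (h : s.under = φ.under) : s.type.under = φ.type.under := by
  rw [← under_type_under, h, under_type_under]

open Classical in
/-- Sums over the compositions with labels in `Ĝ` of a given type, and over the compositions with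
labels in `G` and the same blocks, can be computed in the opposite order. -/
theorem sum_type_sum_under {A : Type*} [AddCommMonoid A] [Module ℂ A] (α : IntComp n (Dual G))
    (F : SetComp n G → A) :
    ∑ φ : SetComp n (Dual G) with φ.type = α, ∑ s : SetComp n G with s.under = φ.under,
      starRingEnd ℂ (φ.eval s : ℂ) • F s =
        ∑ p : IntComp n G with p.under = α.under, starRingEnd ℂ (α.eval p : ℂ) •
          ∑ s : SetComp n G with s.type = p, F s := by
  simp only [Finset.smul_sum]
  rw [Finset.sum_sigma', Finset.sum_sigma']
  refine Finset.sum_bij (fun x _ => ⟨x.2.type, x.2⟩) ?_ ?_ ?_ ?_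
  · rintro ⟨φ, s⟩ h
    simp only [Finset.mem_sigma, Finset.mem_filter, Finset.mem_univ, true_and] at h ⊢
    rw [← h.1, type_under_eq_of_under_eq h.2]
    exact ⟨rfl, trivial⟩
  · rintro ⟨φ, s⟩ h ⟨ψ, t⟩ h' hst
    simp only [Finset.mem_sigma, Finset.mem_filter, Finset.mem_univ, true_and] at h h'
    obtain rfl : s = t := by simpa using (Sigma.mk.inj_iff.1 hst).2
    rw [eq_of_type_eq_of_under_eq (h.1.trans h'.1.symm) (h.2.symm.trans h'.2)]
  · rintro ⟨p, s⟩ h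
    simp only [Finset.mem_sigma, Finset.mem_filter, Finset.mem_univ, true_and] at h
    obtain ⟨h, rfl⟩ := h
    obtain ⟨φ, hφ, hu⟩ := exists_type_eq h
    exact ⟨⟨φ, s⟩, by simp [hφ, hu], rfl⟩
  · rintro ⟨φ, s⟩ h
    simp only [Finset.mem_sigma, Finset.mem_filter, Finset.mem_univ, true_and] at h ⊢
    rw [eval_eq_eval_type, h.1]

theorem isoE_eq (φ : SetComp n (Dual G)) {c : ℕ} (hc : φ.length = c)
    [DecidablePred fun s : SetComp n G => s.under = φ.under] :
    isoE φ = ((Nat.card G : ℂ) ^ c)⁻¹ • ∑ s : SetComp n G with s.under = φ.under,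
      starRingEnd ℂ (φ.eval s : ℂ) • single s (1 : ℂ) := by
  classical
  rw [isoE, card_filter_under, hc, Nat.cast_pow]
  simp only [smul_single, smul_eq_mul, mul_one]
  congr!

open Classical in
theorem symE_eq (α : IntComp n (Dual G)) :
    symE α = ((Nat.card G : ℂ) ^ α.length)⁻¹ • ∑ p : IntComp n G with p.under = α.under,
      starRingEnd ℂ (α.eval p : ℂ) • symH p := by
  rw [symE]
  simp only [symH]
  rw [← sum_type_sum_under, Finset.smul_sum]
  refine Finset.sum_congr rfl fun φ hφ => ?_
  rw [← isoE_eq]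
  rw [← (Finset.mem_filter.1 hφ).2, length_type]

open Classical in
theorem sum_isoQ (α : IntComp n (Dual G)) :
    ∑ φ : SetComp n (Dual G) with φ.type = α, isoQ φ =
      ((Nat.card G : ℂ) ^ α.length)⁻¹ • ∑ p : IntComp n G with p.under = α.under,
        starRingEnd ℂ (α.eval p : ℂ) • ∑ q with p.LabelLE q, degCoeff p q • symH q := by
  simp only [← sum_refinedBy]
  rw [← sum_type_sum_under, Finset.smul_sum]
  refine Finset.sum_congr rfl fun φ hφ => ?_
  rw [isoQ, isoE_eq φ (c := α.length), smul_mul_assoc, Finset.sum_mul]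
  · refine congrArg _ (Finset.sum_congr rfl fun s hs => ?_)
    rw [← single_mul_incl_lrbQ, smul_mul_assoc, (Finset.mem_filter.1 hs).2]
  · rw [← (Finset.mem_filter.1 hφ).2, length_type]

open Classical in
theorem invIdem_eq_sum_isoQ (l : IntPart n (Dual G)) :
    invIdem l = ((l.length.factorial : ℂ))⁻¹ • ∑ α : IntComp n (Dual G) with α.supp = l,
      ∑ φ : SetComp n (Dual G) with φ.type = α, isoQ φ := by
  rw [invIdem]
  simp only [idem_eq_sum]
  rw [Finset.sum_sigma', Finset.sum_sigma', Finset.smul_sum]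
  refine Finset.sum_bij' (fun x _ => ⟨x.2.type, x.2⟩) (fun x _ => ⟨x.2.toPart, x.2⟩) ?_ ?_ ?_ ?_ ?_
  · rintro ⟨Φ, φ⟩ h
    simp only [Finset.mem_sigma, Finset.mem_filter, Finset.mem_univ, true_and] at h ⊢
    rw [← h.1, ← h.2, type_toPart]
    exact ⟨rfl, trivial⟩
  · rintro ⟨Φ, φ⟩ h
    simp only [Finset.mem_sigma, Finset.mem_filter, Finset.mem_univ, true_and] at h ⊢
    rw [← h.1, ← h.2, type_toPart]
    exact ⟨rfl, trivial⟩
  · rintro ⟨Φ, φ⟩ h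
    simp only [Finset.mem_sigma, Finset.mem_filter, Finset.mem_univ, true_and] at h
    rw [h.2]
  · rintro ⟨Φ, φ⟩ h
    simp only [Finset.mem_sigma, Finset.mem_filter, Finset.mem_univ, true_and] at h
    rw [h.2]
  · rintro ⟨Φ, φ⟩ h
    simp only [Finset.mem_sigma, Finset.mem_filter, Finset.mem_univ, true_and] at h
    have : l.length = φ.length := by
      rw [← h.1, ← h.2, type_toPart, ← length_type]
      rfl
    rw [this]

end Sums

end Hsiao

namespace Hsiao

open MonoidAlgebra SetComp

variable {n : ℕ} {K L M : Type*}

/-! ### Labellings of an integer composition -/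

namespace IntComp

/-- The label of the `j`-th block. -/
def lab (p : IntComp n L) (j : Fin p.length) : L := (p.blocks.get j).2

/-- The composition with the same blocks as `p` and labels `g`. -/
def withLabels (p : IntComp n K) (g : Fin p.length → L) : IntComp n L where
  blocks := List.ofFn fun j : Fin p.length => ((p.blocks.get j).1, g j)
  pos := by
    intro b hb
    obtain ⟨j, rfl⟩ := List.mem_ofFn.1 hb
    exact p.pos _ (List.get_mem p.blocks j)
  sum_eq := by
    rw [List.map_ofFn]
    refine Eq.trans ?_ p.sum_eq
    congr 1
    refine Eq.trans ?_ (congrArg (List.map Prod.fst) (List.ofFn_get p.blocks))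
    rw [List.map_ofFn]
    rfl

theorem under_withLabels (p : IntComp n K) (g : Fin p.length → L) :
    (p.withLabels g).under = p.under := by
  refine Eq.trans ?_ (congrArg (List.map Prod.fst) (List.ofFn_get p.blocks))
  rw [under, withLabels, List.map_ofFn, List.map_ofFn]
  rfl

theorem length_eq_of_under_eq {p : IntComp n K} {q : IntComp n L} (h : p.under = q.under) :
    p.length = q.length := by
  rw [← p.length_under, h, q.length_under]

theorem length_withLabels (p : IntComp n K) (g : Fin p.length → L) :
    (p.withLabels g).length = p.length := length_eq_of_under_eq (under_withLabels p g)

theorem get_withLabels (p : IntComp n K) (g : Fin p.length → L)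
    (j : Fin (p.withLabels g).length) :
    ((p.withLabels g).blocks.get j).2 = g (Fin.cast (p.length_withLabels g) j) := by
  exact congrArg Prod.snd (List.get_ofFn _ _)

theorem withLabels_injective (p : IntComp n K) :
    Function.Injective (p.withLabels : (Fin p.length → L) → IntComp n L) := by
  intro g g' h
  have := List.ofFn_injective (congrArg blocks h)
  funext j
  exact congrArg Prod.snd (congrFun this j)

theorem exists_eq_withLabels {p : IntComp n K} {q : IntComp n L} (h : q.under = p.under) :
    ∃ g, q = p.withLabels g := by
  have hl := length_eq_of_under_eq h
  refine ⟨fun j => (q.blocks.get (Fin.cast hl.symm j)).2, IntComp.ext ?_⟩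
  refine List.ext_get (by simp only [withLabels, List.length_ofFn]; exact hl) fun j h1 h2 => ?_
  have hg := congrArg (fun l : List ℕ => l[j]?) h
  have h4 : j < p.blocks.length := h1.trans_eq hl
  simp only [under, List.getElem?_map, List.getElem?_eq_getElem h1,
    List.getElem?_eq_getElem h4, Option.map_some, Option.some.injEq] at hg
  simp only [withLabels, List.get_eq_getElem, List.getElem_ofFn]
  exact Prod.ext hg rfl

theorem withLabels_lab (p : IntComp n L) : p.withLabels p.lab = p :=
  IntComp.ext (List.ofFn_get p.blocks)

open Classical in
theorem sum_under_eq [Finite L] [Fintype L] {A : Type*} [AddCommMonoid A] (p : IntComp n K)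
    (F : IntComp n L → A) :
    ∑ q with q.under = p.under, F q = ∑ g : Fin p.length → L, F (p.withLabels g) := by
  symm
  refine Finset.sum_bij (fun g _ => p.withLabels g) ?_ ?_ ?_ fun _ _ => rfl
  · intro g _
    exact Finset.mem_filter.2 ⟨Finset.mem_univ _, under_withLabels p g⟩
  · intro g _ g' _ h
    exact p.withLabels_injective h
  · intro q hq
    obtain ⟨g, rfl⟩ := exists_eq_withLabels (Finset.mem_filter.1 hq).2
    exact ⟨g, Finset.mem_univ _, rfl⟩

theorem eval_withLabels {G : Type*} [CommGroup G] (p : IntComp n K) (f : Fin p.length → Dual G)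
    (g : Fin p.length → G) :
    (((p.withLabels f).eval (p.withLabels g) : ℂˣ) : ℂ) = tupleEval f g := by
  have h1 : (p.withLabels f).eval (p.withLabels g) =
      (List.ofFn fun j => f j (g j)).prod := by
    simp [eval, evalLabels, withLabels, List.ofFn_eq_map, List.zipWith_map, List.zipWith_self,
      Function.comp_def]
  rw [h1, List.prod_ofFn, tupleEval, Units.coe_prod]

theorem mem_inBlock_congr {K' L' : Type*} {q : IntComp n K} {q' : IntComp n K'} {p : IntComp n L}
    {p' : IntComp n L'} (hq : q.under = q'.under) (hp : p.under = p'.under) {j : Fin q.length}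
    {j' : Fin q'.length} {i : Fin p.length} {i' : Fin p'.length} (hj : (j : ℕ) = j')
    (hi : (i : ℕ) = i') : j ∈ q.inBlock p i ↔ j' ∈ q'.inBlock p' i' := by
  simp only [inBlock, Finset.mem_filter, Finset.mem_univ, true_and, partialSum_eq, hq, hp, hj, hi]

theorem refines_congr {K' L' : Type*} {q : IntComp n K} {q' : IntComp n K'} {p : IntComp n L}
    {p' : IntComp n L'} (hq : q.under = q'.under) (hp : p.under = p'.under) (h : q.Refines p) :
    q'.Refines p' := by
  intro j
  obtain ⟨i, hi⟩ := h (Fin.cast (length_eq_of_under_eq hq).symm j)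
  exact ⟨Fin.cast (length_eq_of_under_eq hp) i, (mem_inBlock_congr hq hp (by simp) (by simp)).1 hi⟩

/-- The index of the block of `p` in which the `j`-th block of `q` starts. -/
noncomputable def blockOf (q : IntComp n M) (p : IntComp n L) (j : Fin q.length) :
    Fin p.length :=
  p.idx ⟨q.partialSum j, (q.partialSum_lt_succ j).trans_le (q.partialSum_succ_le j)⟩

theorem Refines.mem_inBlock_iff {q : IntComp n M} {p : IntComp n L} (h : q.Refines p)
    {j : Fin q.length} {i : Fin p.length} : j ∈ q.inBlock p i ↔ q.blockOf p j = i := by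
  have key : ∀ i', j ∈ q.inBlock p i' → q.blockOf p j = i' := fun i' hi => by
    have hi := (Finset.mem_filter.1 hi).2
    exact p.idx_eq_iff.2 ⟨hi.1, (q.partialSum_lt_succ j).trans_le hi.2⟩
  refine ⟨key i, fun hi => ?_⟩
  obtain ⟨i', hi'⟩ := h j
  rwa [← hi, key i' hi']

theorem labelLE_withLabels_iff {p : IntComp n K} {q : IntComp n L} (h : q.Refines p)
    (g : Fin p.length → L) :
    (p.withLabels g).LabelLE q ↔ g ∘ q.blockOf p = q.lab := by
  have hu := under_withLabels p g
  constructor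
  · rintro ⟨-, hl⟩
    funext j
    have := hl (Fin.cast (length_withLabels p g).symm (q.blockOf p j)) j
      ((mem_inBlock_congr rfl hu.symm rfl (by simp)).1 (h.mem_inBlock_iff.2 rfl))
    rw [get_withLabels] at this
    exact this.symm
  · intro hg
    refine ⟨refines_congr rfl hu.symm h, fun i j hj => ?_⟩
    rw [get_withLabels]
    have hj' : j ∈ q.inBlock p (Fin.cast (length_withLabels p g) i) :=
      (mem_inBlock_congr rfl hu rfl (by simp)).1 hj
    rw [← h.mem_inBlock_iff.1 hj']
    exact (congrFun hg j).symm

theorem mulLE_withLabels_iff [CommMonoid L] {p : IntComp n L} {q : IntComp n K} (h : q.Refines p)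
    (g : Fin q.length → L) [DecidableEq (Fin p.length)] :
    p.MulLE (q.withLabels g) ↔
      ∀ i, ∏ j with q.blockOf p j = i, g j = p.lab i := by
  have hu := under_withLabels q g
  have hprod : ∀ i, ∏ j ∈ (q.withLabels g).inBlock p i, ((q.withLabels g).blocks.get j).2 =
      ∏ j with q.blockOf p j = i, g j := by
    intro i
    refine Finset.prod_bij (fun j _ => Fin.cast (length_withLabels q g) j) ?_ ?_ ?_ ?_
    · intro j hj
      refine Finset.mem_filter.2 ⟨Finset.mem_univ _, h.mem_inBlock_iff.1 ?_⟩
      exact (mem_inBlock_congr hu rfl (by simp) rfl).1 hj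
    · intro j _ j' _ hjj
      exact Fin.cast_injective _ hjj
    · intro j hj
      refine ⟨Fin.cast (length_withLabels q g).symm j, ?_, by simp⟩
      exact (mem_inBlock_congr hu.symm rfl (by simp) rfl).1
        (h.mem_inBlock_iff.2 (Finset.mem_filter.1 hj).2)
    · intro j _
      exact get_withLabels q g j
  refine ⟨fun hm i => (hprod i).symm.trans (hm.2 i), fun hm => ⟨refines_congr hu.symm rfl h,
    fun i => (hprod i).trans (hm i)⟩⟩

end IntComp

/-! ### The Fourier transform along a refinement -/

section Fourier

variable {G : Type*} [CommGroup G] {I J : Type*} [Fintype I] [Fintype J]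

theorem tupleEval_comp [DecidableEq I] (σ : J → I) (b : J → Dual G) (h : I → G) :
    tupleEval b (h ∘ σ) = tupleEval (fun i => ∏ j with σ j = i, b j) h := by
  rw [tupleEval, tupleEval, ← Finset.prod_fiberwise Finset.univ σ]
  refine Finset.prod_congr rfl fun i _ => ?_
  rw [MonoidHom.finsetProd_apply, Units.coe_prod]
  refine Finset.prod_congr rfl fun j hj => ?_
  rw [Function.comp_apply, (Finset.mem_filter.1 hj).2]

open Classical in
/-- Up to normalization, the Fourier transform exchanges the indicator function of the tuples of
characters with prescribed products along the fibres of `σ` and the functions supported on the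
tuples which are constant along the fibres of `σ`. -/
theorem sum_conj_tupleEval_fibres [Finite G] [Fintype G] [Fintype (Dual G)] (σ : J → I)
    (a : I → Dual G) (g : J → G) :
    ((Nat.card G : ℂ) ^ Fintype.card J)⁻¹ *
      ∑ b : J → Dual G with ∀ i, ∏ j with σ j = i, b j = a i, starRingEnd ℂ (tupleEval b g) =
    ((Nat.card G : ℂ) ^ Fintype.card I)⁻¹ *
      ∑ h : I → G with h ∘ σ = g, starRingEnd ℂ (tupleEval a h) := by
  have hG : (Nat.card G : ℂ) ≠ 0 := natCard_ne_zero
  -- the indicator function of the condition on `b`, as a sum over the characters of `I → Dual G`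
  have h1 : ∀ b : J → Dual G, (if ∀ i, ∏ j with σ j = i, b j = a i then
      starRingEnd ℂ (tupleEval b g) else 0) = ((Nat.card G : ℂ) ^ Fintype.card I)⁻¹ *
        ∑ h : I → G, starRingEnd ℂ (tupleEval a h) *
          (tupleEval b (h ∘ σ) * starRingEnd ℂ (tupleEval b g)) := by
    intro b
    simp only [tupleEval_comp, ← mul_assoc]
    have hiff : (∀ i, ∏ j with σ j = i, b j = a i) ↔ a = fun i => ∏ j with σ j = i, b j := by
      rw [eq_comm, funext_iff]
    rw [← Finset.sum_mul, sum_conj_mul_tupleEval, if_congr hiff rfl rfl]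
    split_ifs with hc
    · rw [← mul_assoc, inv_mul_cancel₀ (pow_ne_zero _ hG), one_mul]
    · simp
  rw [Finset.sum_filter, Finset.sum_congr rfl fun b _ => h1 b, ← Finset.mul_sum, Finset.sum_comm]
  simp only [← Finset.mul_sum, sum_tupleEval_mul_conj]
  rw [mul_left_comm, Finset.sum_filter, Finset.mul_sum]
  congr 1
  refine Finset.sum_congr rfl fun h _ => ?_
  split_ifs with hc
  · rw [mul_comm, mul_assoc, mul_inv_cancel₀ (pow_ne_zero _ hG), mul_one]
  · simp

end Fourier

section Formulas

variable {G : Type*} [CommGroup G] [Finite G]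

open Classical in
/-- The coefficients of the orbit sum `H_q` in the two closed forms agree, by Fourier inversion. -/
theorem sum_mulLE_eq_sum_labelLE (α : IntComp n (Dual G)) (q : IntComp n G) :
    ((Nat.card G : ℂ) ^ q.length)⁻¹ * ∑ β : IntComp n (Dual G) with β.under = q.under,
      (if α.MulLE β then starRingEnd ℂ (β.eval q : ℂ) else 0) =
    ((Nat.card G : ℂ) ^ α.length)⁻¹ * ∑ p : IntComp n G with p.under = α.under,
      (if p.LabelLE q then starRingEnd ℂ (α.eval p : ℂ) else 0) := by
  have := Fintype.ofFinite G
  have := Fintype.ofFinite (Dual G)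
  by_cases h : q.Refines α
  · have hF := sum_conj_tupleEval_fibres (q.blockOf α) α.lab q.lab
    rw [Fintype.card_fin, Fintype.card_fin, Finset.sum_filter, Finset.sum_filter] at hF
    rw [IntComp.sum_under_eq, IntComp.sum_under_eq]
    convert hF using 4 with b _ h _
    · exact (IntComp.mulLE_withLabels_iff h b).trans (by congr!)
    · rw [← IntComp.eval_withLabels, IntComp.withLabels_lab]
    · rw [IntComp.labelLE_withLabels_iff ‹_›]
    · rw [← IntComp.eval_withLabels, IntComp.withLabels_lab]
  · rw [Finset.sum_eq_zero, Finset.sum_eq_zero, mul_zero, mul_zero]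
    · intro p hp
      exact if_neg fun hl => h (IntComp.refines_congr rfl (Finset.mem_filter.1 hp).2 hl.1)
    · intro β hβ
      exact if_neg fun hl => h (IntComp.refines_congr (Finset.mem_filter.1 hβ).2 rfl hl.1)

open Classical in
/-- The inner sums of the two closed forms of `e_λ` agree, for each `α` with support `λ`. -/
theorem sum_degCoeff_smul_symE (α : IntComp n (Dual G)) :
    ∑ β with α.MulLE β, degCoeff α β • symE β =
      ((Nat.card G : ℂ) ^ α.length)⁻¹ • ∑ p : IntComp n G with p.under = α.under,
        starRingEnd ℂ (α.eval p : ℂ) • ∑ q with p.LabelLE q, degCoeff p q • symH q := by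
  have hl : ∑ β with α.MulLE β, degCoeff α β • symE β = ∑ q : IntComp n G,
      (degCoeff α q * (((Nat.card G : ℂ) ^ q.length)⁻¹ *
        ∑ β : IntComp n (Dual G) with β.under = q.under,
          (if α.MulLE β then starRingEnd ℂ (β.eval q : ℂ) else 0))) • symH q := by
    simp only [symE_eq, Finset.smul_sum, Finset.mul_sum, Finset.sum_smul, ← Finset.sum_filter,
      Finset.filter_filter]
    rw [Finset.sum_comm' (t' := Finset.univ) (s' := fun q => Finset.univ.filter
      fun β : IntComp n (Dual G) => β.under = q.under ∧ α.MulLE β)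
      (by simp [and_comm, eq_comm])]
    refine Finset.sum_congr rfl fun q _ => Finset.sum_congr rfl fun β hβ => ?_
    have hu := (Finset.mem_filter.1 hβ).2.1
    rw [smul_smul, smul_smul, degCoeff_congr rfl hu, IntComp.length_eq_of_under_eq hu, mul_assoc]
  have hr : ((Nat.card G : ℂ) ^ α.length)⁻¹ • ∑ p : IntComp n G with p.under = α.under,
        starRingEnd ℂ (α.eval p : ℂ) • ∑ q with p.LabelLE q, degCoeff p q • symH q =
      ∑ q : IntComp n G, (degCoeff α q * (((Nat.card G : ℂ) ^ α.length)⁻¹ *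
        ∑ p : IntComp n G with p.under = α.under,
          (if p.LabelLE q then starRingEnd ℂ (α.eval p : ℂ) else 0))) • symH q := by
    simp only [Finset.smul_sum, Finset.mul_sum, Finset.sum_smul, ← Finset.sum_filter,
      Finset.filter_filter]
    rw [Finset.sum_comm' (t' := Finset.univ) (s' := fun q => Finset.univ.filter
      fun p : IntComp n G => p.under = α.under ∧ p.LabelLE q) (by simp)]
    refine Finset.sum_congr rfl fun q _ => Finset.sum_congr rfl fun p hp => ?_
    have hu := (Finset.mem_filter.1 hp).2.1
    rw [smul_smul, smul_smul, degCoeff_congr hu rfl]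
    congr 1
    ring
  rw [hl, hr]
  simp only [sum_mulLE_eq_sum_labelLE]

theorem IntComp.length_supp (α : IntComp n L) : α.supp.length = α.length := rfl

open Classical in
theorem invIdem_eq_sum_symE (l : IntPart n (Dual G)) :
    invIdem l = (1 / (l.length.factorial : ℂ)) • ∑ α : IntComp n (Dual G) with α.supp = l,
      ∑ β with α.MulLE β, degCoeff α β • symE β := by
  rw [invIdem_eq_sum_isoQ, one_div]
  simp only [sum_isoQ, sum_degCoeff_smul_symE]

open Classical in
theorem invIdem_eq_sum_symH (l : IntPart n (Dual G)) :
    invIdem l = (1 / ((Nat.card G : ℂ) ^ l.length * (l.length.factorial : ℂ))) •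
      ∑ α : IntComp n (Dual G) with α.supp = l, ∑ p : IntComp n G with p.under = α.under,
        starRingEnd ℂ (α.eval p : ℂ) • ∑ q with p.LabelLE q, degCoeff p q • symH q := by
  rw [invIdem_eq_sum_isoQ, one_div, mul_inv, mul_comm, mul_smul, Finset.smul_sum (r := (_ ^ _)⁻¹)]
  refine congrArg _ (Finset.sum_congr rfl fun α hα => ?_)
  rw [sum_isoQ, ← (Finset.mem_filter.1 hα).2, α.length_supp]

/-! ### The two bases of the invariant subalgebra -/

theorem coeff_symH {G : Type*} [Finite G] (p : IntComp n G) (s : SetComp n G)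
    [Decidable (s.type = p)] : (symH p).coeff s = if s.type = p then 1 else 0 := by
  rw [symH, coeff_sum_single]
  simp

theorem mem_invariants_iff {a : MonoidAlgebra ℂ (SetComp n G)} :
    a ∈ invariants G n ↔ ∀ w s, a.coeff (perm w s) = a.coeff s := by
  have h1 : a ∈ invariants G n ↔ ∀ w : Equiv.Perm (Fin n),
      mapDomainAlgHom ℂ ℂ (permHom w) a = a := by
    simp [invariants, Algebra.mem_iInf, AlgHom.mem_equalizer]
  rw [h1]
  refine forall_congr' fun w => ?_
  have h2 : ∀ s, (mapDomainAlgHom ℂ ℂ (permHom w) a).coeff (perm w s) = a.coeff s := fun s =>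
    Finsupp.mapDomain_apply (perm_injective w) a.coeff s
  refine ⟨fun h s => by
    have := h2 s
    rwa [h] at this, fun h => ?_⟩
  ext t
  obtain ⟨s, rfl⟩ := Finite.surjective_of_injective (perm_injective (L := G) w) t
  rw [h2, h]

theorem symH_mem_invariants (p : IntComp n G) : symH p ∈ invariants G n := by
  classical
  refine mem_invariants_iff.2 fun w s => ?_
  rw [coeff_symH, coeff_symH]
  simp only [perm_type]

theorem coeff_symH_std {G : Type*} [Finite G] (p q : IntComp n G) [Decidable (p = q)] :
    (symH q).coeff p.std = if p = q then 1 else 0 := by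
  classical
  rw [coeff_symH]
  simp only [IntComp.type_std]

/-- The coefficients of an invariant element are constant on the compositions of a given type, which
is represented by a standard composition. -/
theorem eq_sum_symH {a : MonoidAlgebra ℂ (SetComp n G)} (ha : a ∈ invariants G n) :
    a = ∑ q : IntComp n G, a.coeff q.std • symH q := by
  classical
  ext s
  obtain ⟨w, hw⟩ := exists_perm_of_type_eq s.type.type_std
  simp only [coeff_sum, coeff_smul_apply, coeff_symH, Finsupp.finsetSum_apply]
  simp only [smul_eq_mul, mul_ite, mul_one, mul_zero, Finset.sum_ite_eq, Finset.mem_univ, if_true]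
  have h := mem_invariants_iff.1 ha w s.type.std
  rwa [hw] at h

theorem linearIndependent_symH {G : Type*} [Finite G] :
    LinearIndependent ℂ (symH : IntComp n G → MonoidAlgebra ℂ (SetComp n G)) := by
  classical
  refine Fintype.linearIndependent_iff.2 fun c hc p => ?_
  have := congrArg (fun a => a.coeff p.std) hc
  simpa [coeff_sum, coeff_symH_std] using this

theorem span_symH : Submodule.span ℂ (Set.range (symH : IntComp n G → _)) =
    Subalgebra.toSubmodule (invariants G n) := by
  refine le_antisymm (Submodule.span_le.2 ?_) fun a ha => ?_
  · rintro _ ⟨p, rfl⟩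
    exact symH_mem_invariants p
  · rw [eq_sum_symH ha]
    exact Submodule.sum_mem _ fun q _ =>
      Submodule.smul_mem _ _ (Submodule.subset_span ⟨q, rfl⟩)

open Classical in
theorem IntComp.sum_eval_mul_conj (p q : IntComp n G) (h : q.under = p.under) :
    ∑ β : IntComp n (Dual G) with β.under = p.under,
      (β.eval p : ℂ) * starRingEnd ℂ (β.eval q : ℂ) =
        if q = p then (Nat.card G : ℂ) ^ p.length else 0 := by
  have := Fintype.ofFinite G
  have := Fintype.ofFinite (Dual G)
  obtain ⟨g, rfl⟩ := exists_eq_withLabels h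
  rw [sum_under_eq]
  have h1 := sum_tupleEval_mul_conj g p.lab
  simp only [← eval_withLabels, withLabels_lab, Fintype.card_fin] at h1
  rw [h1]
  refine if_congr ?_ rfl rfl
  rw [eq_comm, ← p.withLabels_injective.eq_iff, withLabels_lab]

open Classical in
theorem IntComp.sum_conj_mul_eval (α β : IntComp n (Dual G)) (h : β.under = α.under) :
    ∑ p : IntComp n G with p.under = α.under,
      starRingEnd ℂ (β.eval p : ℂ) * (α.eval p : ℂ) =
        if β = α then (Nat.card G : ℂ) ^ α.length else 0 := by
  have := Fintype.ofFinite G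
  obtain ⟨g, rfl⟩ := exists_eq_withLabels h
  rw [sum_under_eq]
  have h1 := sum_conj_mul_tupleEval g α.lab
  simp only [← eval_withLabels, withLabels_lab, Fintype.card_fin] at h1
  rw [h1]
  refine if_congr ?_ rfl rfl
  rw [← α.withLabels_injective.eq_iff, withLabels_lab]

open Classical in
/-- Fourier inversion of `symE_eq`. -/
theorem symH_eq (p : IntComp n G) :
    symH p = ∑ β : IntComp n (Dual G) with β.under = p.under, (β.eval p : ℂ) • symE β := by
  have h : ∀ β ∈ Finset.univ.filter fun β : IntComp n (Dual G) => β.under = p.under,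
      (β.eval p : ℂ) • symE β = ((Nat.card G : ℂ) ^ p.length)⁻¹ •
        ∑ q : IntComp n G with q.under = p.under,
          ((β.eval p : ℂ) * starRingEnd ℂ (β.eval q : ℂ)) • symH q := by
    intro β hβ
    have hu := (Finset.mem_filter.1 hβ).2
    rw [symE_eq, smul_comm, IntComp.length_eq_of_under_eq hu, hu]
    simp only [Finset.smul_sum, smul_smul]
  rw [Finset.sum_congr rfl h, ← Finset.smul_sum, Finset.sum_comm]
  simp only [← Finset.sum_smul]
  rw [Finset.sum_eq_single p, p.sum_eval_mul_conj p rfl, if_pos rfl, smul_smul,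
    inv_mul_cancel₀ (pow_ne_zero _ natCard_ne_zero), one_smul]
  · intro q hq hne
    rw [p.sum_eval_mul_conj q (Finset.mem_filter.1 hq).2, if_neg hne, zero_smul]
  · simp

open Classical in
theorem coeff_symE_std (α : IntComp n (Dual G)) (p : IntComp n G) :
    (symE α).coeff p.std = if p.under = α.under then
      ((Nat.card G : ℂ) ^ α.length)⁻¹ * starRingEnd ℂ (α.eval p : ℂ) else 0 := by
  rw [symE_eq]
  simp [coeff_sum, coeff_symH_std]

theorem linearIndependent_symE :
    LinearIndependent ℂ (symE : IntComp n (Dual G) → MonoidAlgebra ℂ (SetComp n G)) := by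
  classical
  refine Fintype.linearIndependent_iff.2 fun c hc α => ?_
  have h : ∀ p : IntComp n G, ∑ β, c β * (symE β).coeff p.std = 0 := fun p => by
    have := congrArg (fun a => a.coeff p.std) hc
    simpa [coeff_sum] using this
  -- the pairing with the character `α` isolates the coefficient of `E_α`
  have h1 : ∑ p : IntComp n G with p.under = α.under,
      (∑ β, c β * (symE β).coeff p.std) * (α.eval p : ℂ) = c α := by
    simp only [Finset.sum_mul]
    rw [Finset.sum_comm, Finset.sum_eq_single α]
    · have h2 := IntComp.sum_conj_mul_eval α α rfl
      rw [if_pos rfl] at h2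
      have h3 : c α = (c α * ((Nat.card G : ℂ) ^ α.length)⁻¹) * (Nat.card G : ℂ) ^ α.length := by
        rw [mul_assoc, inv_mul_cancel₀ (pow_ne_zero _ natCard_ne_zero), mul_one]
      refine Eq.trans ?_ ((congrArg (_ * ·) h2).trans h3.symm)
      rw [Finset.mul_sum]
      refine Finset.sum_congr rfl fun p hp => ?_
      rw [coeff_symE_std, if_pos (Finset.mem_filter.1 hp).2]
      ring
    · intro β _ hne
      by_cases hu : β.under = α.under
      · rw [Finset.sum_congr rfl (g := fun p => (c β * ((Nat.card G : ℂ) ^ β.length)⁻¹) *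
          (starRingEnd ℂ (β.eval p : ℂ) * (α.eval p : ℂ))), ← Finset.mul_sum,
          IntComp.sum_conj_mul_eval α β hu, if_neg hne, mul_zero]
        intro p hp
        rw [coeff_symE_std, if_pos ((Finset.mem_filter.1 hp).2.trans hu.symm)]
        ring
      · refine Finset.sum_eq_zero fun p hp => ?_
        rw [coeff_symE_std, if_neg fun h => hu (h.symm.trans (Finset.mem_filter.1 hp).2),
          mul_zero, zero_mul]
    · simp
  rw [← h1]
  simp only [h, zero_mul, Finset.sum_const_zero]

theorem symE_mem_invariants (α : IntComp n (Dual G)) : symE α ∈ invariants G n := by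
  classical
  rw [symE_eq]
  exact Subalgebra.smul_mem _ (Subalgebra.sum_mem _ fun p _ =>
    Subalgebra.smul_mem _ (symH_mem_invariants p) _) _

theorem span_symE : Submodule.span ℂ (Set.range (symE : IntComp n (Dual G) → _)) =
    Subalgebra.toSubmodule (invariants G n) := by
  classical
  refine le_antisymm (Submodule.span_le.2 ?_) ?_
  · rintro _ ⟨p, rfl⟩
    exact symE_mem_invariants p
  · rw [← span_symH, Submodule.span_le]
    rintro _ ⟨p, rfl⟩
    rw [symH_eq]
    exact Submodule.sum_mem _ fun q _ =>
      Submodule.smul_mem _ _ (Submodule.subset_span ⟨q, rfl⟩)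

theorem invIdem_mem_invariants (l : IntPart n (Dual G)) : invIdem l ∈ invariants G n := by
  classical
  rw [invIdem_eq_sum_symE]
  exact Subalgebra.smul_mem _ (Subalgebra.sum_mem _ fun α _ => Subalgebra.sum_mem _ fun β _ =>
    Subalgebra.smul_mem _ (symE_mem_invariants β) _) _

end Formulas

end Hsiao

namespace Hsiao

open MonoidAlgebra SetComp

variable {n : ℕ} {L : Type*}

/-! ### The compressions of the algebra by the idempotents -/

/-- Two compositions of `[n]` whose supports have the same type are conjugate under the symmetric
group, up to the order of the blocks. -/
theorem SetComp.exists_perm_of_type_toPart_eq {s t : SetComp n L}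
    (h : s.toPart.type = t.toPart.type) :
    ∃ (s' : SetComp n L) (w : Equiv.Perm (Fin n)), s'.toPart = s.toPart ∧ s'.perm w = t := by
  have h1 : t.type.blocks.Perm s.type.blocks :=
    Multiset.coe_eq_coe.1 (congrArg IntPart.blocks h).symm
  have h2 : List.Forall₂ (fun (a : ℕ × L) (B : Finset (Fin n) × L) => a = (B.1.card, B.2))
      s.type.blocks s.blocks := by
    rw [blocks_type, List.forall₂_map_left_iff]
    exact List.forall₂_same.2 fun _ _ => rfl
  -- lift the permutation of the types to the blocks of `s`
  obtain ⟨z, hz, hp⟩ := List.perm_comp_forall₂ h1 h2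
  let s' : SetComp n L :=
    { blocks := z
      nonempty := fun B hB => s.nonempty B (hp.mem_iff.1 hB)
      disjoint := hp.symm.pairwise s.disjoint fun h => h.symm
      cover := fun i => by
        obtain ⟨B, hB, hi⟩ := s.cover i
        exact ⟨B, hp.mem_iff.2 hB, hi⟩ }
  have h3 : s'.type = t.type := by
    refine IntComp.ext ?_
    rw [blocks_type]
    change z.map _ = _
    refine List.forall₂_eq_eq_eq ▸ ?_
    rw [List.forall₂_map_left_iff]
    exact hz.flip.imp fun _ _ h => h.symm
  obtain ⟨w, hw⟩ := exists_perm_of_type_eq h3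
  exact ⟨s', w, toPart_eq_iff.2 hp, hw⟩

theorem SetComp.setPartition_eq_of_toPart_eq {s t : SetComp n L} (h : s.toPart = t.toPart) :
    s.setPartition = t.setPartition := (perm_blocks_iff.1 (toPart_eq_iff.1 h)).1

theorem SetComp.pos_perm_eq (w : Equiv.Perm (Fin n)) (s : SetComp n L) (i j : Fin n) :
    (s.perm w).pos i = (s.perm w).pos j ↔ s.pos (w.symm i) = s.pos (w.symm j) := by
  rw [le_antisymm_iff, le_antisymm_iff, pos_perm_le, pos_perm_le]

section Character

variable {G : Type*} [CommGroup G]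

open Classical in
/-- The character of `ℂΣ_n[G]` attached to `ψ`: the scalar by which `H_s` acts on the isotypic
projector of `ψ` from the right, modulo the span of the compositions with more blocks. -/
noncomputable def character (ψ : SetComp n (Dual G)) (s : SetComp n G) : ℂ :=
  if ψ.setPartition ≤ s.setPartition then (ψ.eval (ofUnit G ψ.under * s) : ℂ) else 0

theorem character_congr {φ ψ : SetComp n (Dual G)} (h : φ.toPart = ψ.toPart) (s : SetComp n G) :
    character φ s = character ψ s := by
  have hp := setPartition_eq_of_toPart_eq h
  rw [character, character, hp]
  split_ifs with hs
  · have hψ : ψ = ofUnit (Dual G) ψ.under * φ := by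
      refine eq_of_under_eq ?_ fun i => ?_
      · rw [under_mul_of_le, under_ofUnit]
        rw [setPartition_ofUnit, setPartition_under, hp]
      · rw [labAt_mul, labAt_ofUnit, mul_one, (perm_blocks_iff.1 (toPart_eq_iff.1 h)).2]
    have hu : φ.under = (ofUnit G φ.under * s).under := by
      rw [under_mul, under_ofUnit, mul_eq_left_of_le]
      rw [setPartition_under, setPartition_under, hp]
      exact hs
    have h1 := eval_ofUnit_mul hu (y := ψ.under) (by rw [setPartition_under, hp])
    rw [← h1, ← mul_assoc, ← ofUnit_mul, mul_eq_left_of_le, ← hψ]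
    rw [setPartition_under, setPartition_under, hp]
  · rfl

theorem character_perm (w : Equiv.Perm (Fin n)) (ψ : SetComp n (Dual G)) (s : SetComp n G) :
    character (ψ.perm w) (s.perm w) = character ψ s := by
  have h1 : ofUnit G (ψ.perm w).under * s.perm w = (ofUnit G ψ.under * s).perm w := by
    refine Eq.trans (congrArg (· * _) ?_) ((permHom w).map_mul _ _).symm
    refine SetComp.ext ?_
    simp [permHom, ofUnit, relabel, under, perm, Function.comp_def]
  have h2 : ∀ t : SetComp n G, (ψ.perm w).eval (t.perm w) = ψ.eval t := fun t => by
    rw [eval_eq_eval_type, perm_type, perm_type, ← eval_eq_eval_type]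
  have h3 : (ψ.perm w).setPartition ≤ (s.perm w).setPartition ↔
      ψ.setPartition ≤ s.setPartition := by
    simp only [setPartition_le_iff, pos_perm_eq]
    refine ⟨fun h i j => ?_, fun h i j => h _ _⟩
    simpa using h (w i) (w j)
  rw [character, character, h1, h2]
  classical
  convert if_congr h3 rfl rfl

variable [Finite G]

theorem isoE_mul_single {ψ : SetComp n (Dual G)} {s : SetComp n G}
    (h : ψ.setPartition ≤ s.setPartition) :
    isoE ψ * single s (1 : ℂ) = character ψ s • isoE ψ := by
  have hu : (ofUnit G ψ.under * s).under = ψ.under := by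
    rw [under_mul, under_ofUnit, mul_eq_left_of_le]
    rwa [setPartition_under, setPartition_under]
  obtain ⟨g, hg⟩ := exists_eq_withLabels hu
  have h1 := isoE_withLabels_mul_single ψ ψ.lab g
  rw [← eval_withLabels, withLabels_lab, ← hg] at h1
  rw [character, if_pos h, ← h1, ← one_mul (1 : ℂ), ← single_mul_single, ← mul_assoc,
    isoE_mul_single_ofUnit (setPartition_under ψ).ge]
  simp

/-- Two elements `e_Φ` with the same set partition `X` enclose any element as if the middle factor
`e_X` were absent. -/
theorem compIdem_mul_mul_compIdem {ψ φ : SetComp n (Dual G)}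
    (h : ψ.setPartition = φ.setPartition) (a : MonoidAlgebra ℂ (SetComp n G)) :
    compIdem ψ * a * compIdem φ = incl G n (uniformSection φ.setPartition) * (isoE ψ * a) *
      (incl G n (uniformSection φ.setPartition) * isoE φ) *
        incl G n (lrbIdem φ.setPartition) := by
  have h1 := lrbIdem_mul_mul_lrbIdem_self φ.setPartition
    (a * (incl G n (uniformSection φ.setPartition) * isoE φ))
  have h2 := isoE_mul_uniformSection ψ
  rw [h] at h2
  calc compIdem ψ * a * compIdem φ
      = incl G n (uniformSection φ.setPartition) * isoE ψ * (incl G n (lrbIdem φ.setPartition) *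
        (a * (incl G n (uniformSection φ.setPartition) * isoE φ)) *
          incl G n (lrbIdem φ.setPartition)) := by
        rw [compIdem, compIdem, h]
        simp only [mul_assoc]
    _ = incl G n (uniformSection φ.setPartition) *
        (isoE ψ * incl G n (uniformSection φ.setPartition)) *
        a * (incl G n (uniformSection φ.setPartition) * isoE φ) *
          incl G n (lrbIdem φ.setPartition) := by
        rw [h1]
        simp only [mul_assoc]
    _ = _ := by
        rw [h2]
        simp only [mul_assoc]

open Classical in
/-- For partitions with the same number of blocks, the idempotents compress each basis element to
a scalar multiple of an idempotent. -/
theorem compIdem_mul_single_mul_compIdem {ψ φ : SetComp n (Dual G)} (hl : ψ.length = φ.length)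
    (s : SetComp n G) : compIdem ψ * single s 1 * compIdem φ =
      if ψ.toPart = φ.toPart then character ψ s • compIdem φ else 0 := by
  by_cases h : ψ.setPartition = φ.setPartition
  · by_cases hs : ψ.setPartition ≤ s.setPartition
    · have h1 := compIdem_mul_mul_compIdem h 1
      rw [mul_one, mul_one, compIdem_mul_compIdem] at h1
      rw [compIdem_mul_mul_compIdem h, isoE_mul_single hs, mul_smul_comm, smul_mul_assoc,
        smul_mul_assoc, ← h1, smul_ite, smul_zero]
    · have h0 : compIdem ψ * single s 1 * compIdem φ = 0 := by
        rw [compIdem.eq_def φ, mul_assoc, ← mul_assoc (single s 1),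
          single_mul_mul_incl_lrbIdem_eq_zero (by rwa [← h]), mul_zero]
      rw [h0, character, if_neg hs, zero_smul, ite_self]
  · rw [if_neg fun h' => h (setPartition_eq_of_toPart_eq h')]
    have h' : ¬ φ.setPartition ≤ ψ.setPartition := fun hle => h (by
      have := setPartition_eq_of_le_of_length_le (x := ψ.under) (y := φ.under)
        (by rwa [setPartition_under, setPartition_under])
        (by rw [SetComp.length_under, SetComp.length_under, hl])
      rw [setPartition_under, setPartition_under] at this
      first | exact this | exact this.symm)
    rw [compIdem, compIdem]
    have h1 := lrbIdem_mul_mul_lrbIdem_eq_zero h'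
      (single s 1 * (incl G n (uniformSection φ.setPartition) * isoE φ))
    rw [mul_assoc, mul_assoc, ← mul_assoc (single s 1), ← mul_assoc (incl G n (lrbIdem _)), h1,
      mul_zero]

open Classical in
/-- The compression of the invariant subalgebra by one of its idempotents `e_λ` is one-dimensional:
the symmetric group permutes transitively the partitions of type `λ`, so that an invariant element
acts on all of the `e_Φ` of type `λ` by the same scalar. -/
theorem exists_invIdem_mul_mul_invIdem_eq_smul (l : IntPart n (Dual G))
    {a : MonoidAlgebra ℂ (SetComp n G)} (ha : a ∈ invariants G n) :
    ∃ c : ℂ, invIdem l * a * invIdem l = c • invIdem l := by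
  let χ : SetComp n (Dual G) → ℂ := fun ψ => ∑ s, a.coeff s * character ψ s
  have hlen : ∀ Φ Ψ : SetPart n (Dual G), Φ.type = Ψ.type →
      (Quotient.out Φ : SetComp n (Dual G)).length = (Quotient.out Ψ).length := by
    intro Φ Ψ h
    rw [← toPart_out Φ, ← toPart_out Ψ, type_toPart, type_toPart] at h
    have := congrArg IntPart.length h
    rwa [IntComp.length_supp, IntComp.length_supp, length_type, length_type] at this
  have hχ : ∀ φ ψ : SetComp n (Dual G), φ.toPart.type = ψ.toPart.type → χ φ = χ ψ := by
    intro φ ψ h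
    obtain ⟨φ', w, h1, rfl⟩ := exists_perm_of_type_toPart_eq h
    refine Fintype.sum_bijective (perm w)
      (Finite.injective_iff_bijective.1 (perm_injective w)) _ _ fun s => ?_
    rw [mem_invariants_iff.1 ha, character_perm, character_congr h1]
  have hsum : ∀ Φ Ψ : SetPart n (Dual G), Ψ.type = Φ.type →
      idem Ψ * a * idem Φ = if Ψ = Φ then χ (Quotient.out Φ) • idem Φ else 0 := by
    intro Φ Ψ h
    have haa : a = ∑ s, a.coeff s • single s (1 : ℂ) := by
      ext t
      simp [coeff_sum]
    conv_lhs => rw [haa]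
    rw [Finset.mul_sum, Finset.sum_mul, idem_eq, idem_eq]
    simp only [mul_smul_comm, smul_mul_assoc, compIdem_mul_single_mul_compIdem (hlen _ _ h),
      toPart_out]
    split_ifs with hΦ
    · subst hΦ
      simp only [smul_smul, ← Finset.sum_smul, χ]
    · simp
  by_cases hne : ∃ Φ₀ : SetPart n (Dual G), Φ₀.type = l
  · obtain ⟨Φ₀, h₀⟩ := hne
    refine ⟨χ (Quotient.out Φ₀), ?_⟩
    rw [invIdem, Finset.sum_mul, Finset.smul_sum, Finset.sum_mul]
    refine Finset.sum_congr rfl fun Φ hΦ => ?_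
    have hΦ' := (Finset.mem_filter.1 hΦ).2
    rw [Finset.mul_sum, Finset.sum_eq_single Φ]
    · rw [hsum _ _ rfl, if_pos rfl, hχ _ (Quotient.out Φ₀)]
      rw [toPart_out, toPart_out, hΦ', h₀]
    · intro Ψ hΨ hn
      rw [hsum _ _ (hΦ'.trans (Finset.mem_filter.1 hΨ).2.symm), if_neg hn.symm]
    · exact fun h => absurd hΦ h
  · refine ⟨0, ?_⟩
    rw [invIdem, Finset.sum_eq_zero fun Φ hΦ => absurd ⟨Φ, (Finset.mem_filter.1 hΦ).2⟩ hne]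
    simp

/-! ### The idempotents of the invariant subalgebra -/

theorem exists_type_eq (l : IntPart n L) : ∃ Φ : SetPart n L, Φ.type = l := by
  obtain ⟨m, hpos, hsum⟩ := l
  induction m using Quotient.inductionOn with
  | h b =>
    let α : IntComp n L := ⟨b, hpos, by simpa using hsum⟩
    exact ⟨α.std.toPart, by rw [type_toPart, α.type_std]; rfl⟩

open Classical in
theorem invIdem_mul_idem (l : IntPart n (Dual G)) (Φ : SetPart n (Dual G)) :
    invIdem l * idem Φ = if Φ.type = l then idem Φ else 0 := by
  rw [invIdem, Finset.sum_mul]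
  simp only [idem_mul_idem]
  simp

theorem invIdem_ne_zero (l : IntPart n (Dual G)) : invIdem l ≠ 0 := by
  classical
  obtain ⟨Φ, hΦ⟩ := exists_type_eq l
  intro h0
  have := invIdem_mul_idem l Φ
  rw [h0, zero_mul, if_pos hΦ] at this
  exact idem_ne_zero Φ this.symm

open Classical in
theorem invIdem_mul_invIdem (l m : IntPart n (Dual G)) :
    invIdem l * invIdem m = if l = m then invIdem l else 0 := by
  rw [invIdem.eq_def m, Finset.mul_sum]
  simp only [invIdem_mul_idem]
  split_ifs with h
  · subst h
    exact Finset.sum_congr rfl fun Φ hΦ => if_pos (Finset.mem_filter.1 hΦ).2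
  · exact Finset.sum_eq_zero fun Φ hΦ =>
      if_neg fun h' => h (h'.symm.trans (Finset.mem_filter.1 hΦ).2)

theorem sum_invIdem : ∑ l : IntPart n (Dual G), invIdem l = 1 := by
  classical
  simp only [invIdem]
  rw [Finset.sum_fiberwise Finset.univ (fun Φ : SetPart n (Dual G) => Φ.type) idem, sum_idem]

end Character

/-- An idempotent by which every element is compressed to a scalar is primitive. -/
theorem isPrimitiveIdem_of_forall_exists_smul {A : Type*} [Ring A] [Algebra ℂ A] {e : A}
    (he : IsIdempotentElem e) (h0 : e ≠ 0) (h : ∀ a : A, ∃ c : ℂ, e * a * e = c • e) :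
    IsPrimitiveIdem e := by
  refine ⟨he, h0, fun a b ha hb hab hba hs => ?_⟩
  obtain ⟨c, hc⟩ := h a
  have h1 : e * a * e = a := by
    rw [hs]
    simp only [add_mul, mul_add, hab, hba, ha.eq, add_zero]
  rw [h1] at hc
  have h2 : (c * c - c) • e = 0 := by
    have := ha.eq
    rw [hc, smul_mul_smul_comm, he.eq] at this
    rw [sub_smul, this, sub_self]
  rcases smul_eq_zero.1 h2 with h3 | h3
  · have h4 : c * (c - 1) = 0 := by rw [← h3]; ring
    rcases mul_eq_zero.1 h4 with h5 | h5
    · exact Or.inl (by rw [hc, h5, zero_smul])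
    · refine Or.inr ?_
      rw [sub_eq_zero.1 h5, one_smul] at hc
      rw [hc] at hs
      simpa using hs.symm
  · exact absurd h3 h0

theorem isCSoPOI_invIdem {G : Type*} [CommGroup G] [Finite G] (n : ℕ) :
    IsCSoPOI fun l : IntPart n (Dual G) =>
      (⟨invIdem l, invIdem_mem_invariants l⟩ : invariants G n) := by
  classical
  refine ⟨fun l => isPrimitiveIdem_of_forall_exists_smul ?_ ?_ ?_, ⟨⟨fun l => ?_, ?_⟩, ?_⟩⟩
  · exact Subtype.ext ((invIdem_mul_invIdem l l).trans (if_pos rfl))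
  · exact fun h => invIdem_ne_zero l (congrArg Subtype.val h)
  · rintro ⟨a, ha⟩
    obtain ⟨c, hc⟩ := exists_invIdem_mul_mul_invIdem_eq_smul l ha
    exact ⟨c, Subtype.ext hc⟩
  · exact Subtype.ext ((invIdem_mul_invIdem l l).trans (if_pos rfl))
  · intro l m h
    exact Subtype.ext ((invIdem_mul_invIdem l m).trans (if_neg h))
  · refine Subtype.ext ?_
    refine Eq.trans ?_ sum_invIdem
    simp

end Hsiao

open Hsiao in
open Classical in
theorem corollary6p7 {G : Type*} [CommGroup G] [Finite G] (n : ℕ) :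
    -- the elements `H_q` and `E_β` are bases of the invariant subalgebra
    (LinearIndependent ℂ (symH : IntComp n G → _) ∧
      Submodule.span ℂ (Set.range (symH : IntComp n G → _)) =
        Subalgebra.toSubmodule (invariants G n)) ∧
    (LinearIndependent ℂ (symE : IntComp n (Dual G) → _) ∧
      Submodule.span ℂ (Set.range (symE : IntComp n (Dual G) → _)) =
        Subalgebra.toSubmodule (invariants G n)) ∧
    -- the elements `e_λ` form a complete system of primitive orthogonal idempotents of it
    (∃ h : ∀ l : IntPart n (Dual G), invIdem l ∈ invariants G n,
      IsCSoPOI fun l : IntPart n (Dual G) => (⟨invIdem l, h l⟩ : invariants G n)) ∧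
    -- and they have two closed forms
    ∀ l : IntPart n (Dual G),
      invIdem l =
        (1 / (l.length.factorial : ℂ)) •
          ∑ α : IntComp n (Dual G) with α.supp = l,
            ∑ β : IntComp n (Dual G) with α.MulLE β,
              ((-1 : ℂ) ^ (β.length - α.length) / (β.deg α : ℂ)) • symE β ∧
      invIdem l =
        (1 / ((Nat.card G : ℂ) ^ l.length * (l.length.factorial : ℂ))) •
          ∑ α : IntComp n (Dual G) with α.supp = l,
            ∑ p : IntComp n G with p.under = α.under,
              starRingEnd ℂ (α.eval p : ℂ) •
                ∑ q : IntComp n G with p.LabelLE q,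
                  ((-1 : ℂ) ^ (q.length - p.length) / (q.deg p : ℂ)) • symH q :=
  ⟨⟨linearIndependent_symH, span_symH⟩, ⟨linearIndependent_symE, span_symE⟩,
    ⟨invIdem_mem_invariants, isCSoPOI_invIdem n⟩,
    fun l => ⟨invIdem_eq_sum_symE l, invIdem_eq_sum_symH l⟩⟩
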